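/- Fix $n\ge 0$ and order $\mathbb Z_2^n$ by putting even degrees before odd ones ($\gamma$ is even or odd according to $\langle\gamma,\gamma\rangle=\sum_i\gamma_i\gamma_i \bmod 2$) and ordering each class lexicographically. For $\vec d=(d_\gamma)_{\gamma\in\mathbb Z_2^n}$, $d_\gamma\in\mathbb N$, let $\mathbb R^{\vec d}$ be the $\mathbb Z_2^n$-superdomain $(\mathbb R^{d_0},C^\infty(-)[[\xi]])$, with formal variables $\xi_\gamma^j$ ($\gamma\neq 0$, $1\le j\le d_\gamma$) of degree $\gamma$ satisfying $\xi\eta=(-1)^{\langle\tilde\xi,\tilde\eta\rangle}\eta\xi$. A $\mathbb Z_2^n$-ringed space is a topological space with a sheaf of associative unital $\mathbb Z_2^n$-graded, $\mathbb Z_2^n$-commutative $\mathbb R$-algebras; morphisms are pairs $g=(\bar g,g^*)$ with $\bar g$ continuous and $g^*$ a morphism of sheaves of unital $\mathbb R$-algebras of weight zero, local on stalks. A $\mathbb Z_2^n$-supermanifold of dimension $\vec d$ is a Hausdorff, second countable $\mathbb Z_2^n$-ringed space locally isomorphic to $\mathbb R^{\vec d}$. Let $\vec k,\vec m\in\mathbb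 N^{\mathbb Z_2^n}$ and $\beta_\gamma=\sum_{\gamma'+\gamma''=\gamma}k_{\gamma'}(m_{\gamma''}-k_{\gamma''})$. A $\vec k$-index is a family $I=(I_\gamma)$ of subsets $I_\gamma\subseteq\{1,\dots,m_\gamma\}$ with $|I_\gamma|=k_\gamma$. For each $\vec k$-index $I$ let $U_I$ be a copy of $\mathbb R^{\vec\beta}$, labelled by the $\vec k\times\vec m$ block matrix $A_I$ whose columns with indices in $I$ form the identity matrix and whose other entries are the coordinates of $U_I$ (the coordinates of degree $\gamma$ filling, in order, from up to down and from left to right, the remaining places in the blocks $(\gamma',\gamma'')$ with $\gamma'+\gamma''=\gamma$). For a $\vec k\times\vec m$ matrix $A$ let $M_IA$ be the square matrix of the columns of $A$ with indices in $I$, and $D_IA$ the matrix of the remaining columns. Let $\widetilde U_{I,J}\subseteq U_I$ be the open set of points at which $M_JA_I$ is invertible (i.e. at which the real matrix of the values of its entries is invertible). Then: 0. For all $I,J$, the matrix $M_IA_J$ is invertible over the sections of the structure sheaf of $U_J$ over $\widetilde U_{J,I}$, and there is a unique morphism $g_{I,J}=(\bar g_{I,J},g_{I,J}^*)\colon \widetilde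 U_{J,I}\to\widetilde U_{I,J}$ (open subspaces of $U_J$ and $U_I$) satisfying the pasting equation $D_I\big((M_IA_J)^{-1}A_J\big)=D_I(A_I)$, i.e. $g_{I,J}^*$ maps each entry of $D_I(A_I)$ to the corresponding entry of $D_I\big((M_IA_J)^{-1}A_J\big)$. 1. $\widetilde U_{I,I}=U_I$ and $g_{I,I}=\mathrm{id}$; in particular $g_{I,I}^*=\mathrm{id}$. 2. $g_{I,J}\circ g_{J,I}=\mathrm{id}$ on $\widetilde U_{I,J}$; in particular $g_{J,I}^*\circ g_{I,J}^*=\mathrm{id}$. 3. The morphisms restrict to the triple overlaps, and $g_{I,J}\circ g_{J,S}\circ g_{S,I}=\mathrm{id}$ on $\widetilde U_{I,J}\cap\widetilde U_{I,S}$; in particular $g_{S,I}^*\circ g_{J,S}^*\circ g_{I,J}^*=\mathrm{id}$ there. 4. Hence the $U_I$ glue along the $g_{I,J}$: there is a $\mathbb Z_2^n$-supermanifold $G=G_{\vec k}(\vec m)$ of dimension $\vec\beta$ with an open cover $(W_I)_I$ and isomorphisms $\varphi_I\colon U_I\to W_I$ such that $\varphi_I^{-1}(W_J)=\widetilde U_{I,J}$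 and $\varphi_J=\varphi_I\circ g_{I,J}$ on $\widetilde U_{J,I}$, for all $I,J$. -/

import Mathlib

open CategoryTheory TopologicalSpace Opposite AlgebraicGeometry
open scoped ContDiff

noncomputable section

/-- The grading group `ℤ₂ⁿ`. -/
def Z2n (n : ℕ) : Type := Fin n → ZMod 2

namespace Z2n

variable {n : ℕ}

instance : AddCommGroup (Z2n n) := inferInstanceAs (AddCommGroup (Fin n → ZMod 2))
instance : Fintype (Z2n n) := inferInstanceAs (Fintype (Fin n → ZMod 2))
instance : DecidableEq (Z2n n) := inferInstanceAs (DecidableEq (Fin n → ZMod 2))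

/-- The bi-additive form `⟨a, b⟩ = ∑ aᵢ bᵢ mod 2`. -/
def pairing (a b : Z2n n) : ZMod 2 := ∑ i : Fin n, a i * b i

theorem pairing_add_left (a b c : Z2n n) : pairing (a + b) c = pairing a c + pairing b c := by
  simp only [pairing, ← Finset.sum_add_distrib]
  exact Finset.sum_congr rfl fun i _ => add_mul (a i) (b i) (c i)

theorem pairing_comm (a b : Z2n n) : pairing a b = pairing b a :=
  Finset.sum_congr rfl fun i _ => mul_comm (a i) (b i)

/-- `(-1)^e` for `e : ℤ₂`, as a real number. -/
def sign (e : ZMod 2) : ℝ := if e = 0 then 1 else -1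

theorem sign_zero : sign 0 = 1 := if_pos rfl

theorem sign_add (a b : ZMod 2) : sign (a + b) = sign a * sign b := by
  have h : ∀ a : ZMod 2, a = 0 ∨ a = 1 := by decide
  have h1 : (1 : ZMod 2) + 1 = 0 := by decide
  rcases h a with rfl | rfl <;> rcases h b with rfl | rfl <;> simp [sign, h1]

/-- The key by which degrees are ordered: even degrees come before odd ones, and degrees of
the same parity are ordered lexicographically. -/
def key (a : Z2n n) : Lex (ℕ × Lex (Fin n → ℕ)) :=
  toLex ((pairing a a).val, toLex fun i => (a i).val)

theorem key_injective : Function.Injective (key (n := n)) := by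
  intro a b h
  have h2 : (fun i => (a i).val) = fun i => (b i).val := 
    congrArg (fun p : Lex (ℕ × Lex (Fin n → ℕ)) => ofLex (ofLex p).2) h
  funext i
  exact ZMod.val_injective 2 (congrFun h2 i)

instance : LinearOrder (Z2n n) := LinearOrder.lift' key key_injective

end Z2n

/-- For a dimension vector `d = (d_γ)_γ`, the index set of pairs `(γ, j)`, `1 ≤ j ≤ d_γ`. It
indexes the coordinates of `ℝ^d`, and also the rows or columns of block matrices. -/
@[ext] structure Idx {n : ℕ} (d : Z2n n → ℕ) where
  deg : Z2n n
  pos : Fin (d deg)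

namespace Idx

variable {n : ℕ} {d : Z2n n → ℕ}

def toSigmaLex (a : Idx d) : Σₗ γ : Z2n n, Fin (d γ) := toLex ⟨a.deg, a.pos⟩

theorem toSigmaLex_injective : Function.Injective (toSigmaLex (d := d)) := by
  rintro ⟨a, i⟩ ⟨b, j⟩ h
  have h' : (⟨a, i⟩ : Σ γ : Z2n n, Fin (d γ)) = ⟨b, j⟩ := h
  cases h'
  rfl

def equivSigma : Idx d ≃ Σ γ : Z2n n, Fin (d γ) where
  toFun a := ⟨a.deg, a.pos⟩
  invFun a := ⟨a.1, a.2⟩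
  left_inv _ := rfl
  right_inv _ := rfl

instance : Fintype (Idx d) := Fintype.ofEquiv _ equivSigma.symm

/-- Lexicographic order: first by degree block, then by position in the block. -/
instance : LinearOrder (Idx d) := LinearOrder.lift' toSigmaLex toSigmaLex_injective

end Idx

/-- The formal variables `ξ_γ^j`, `γ ≠ 0`, of the superdomain `ℝ^d`. -/
abbrev FormalVar {n : ℕ} (d : Z2n n → ℕ) : Type := {v : Idx d // v.deg ≠ 0}

variable {n : ℕ}

/-- Exponents of the normally ordered monomials `ξ^α`: a variable of odd degree occurs at most
once (it squares to zero). -/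
def Admissible {d : Z2n n → ℕ} (α : FormalVar d →₀ ℕ) : Prop :=
  ∀ v, Z2n.pairing v.1.deg v.1.deg = 1 → α v ≤ 1

/-- The exponent of the sign obtained on bringing `ξ^α * ξ^β` into normal order. -/
def crossing {d : Z2n n → ℕ} (α β : FormalVar d →₀ ℕ) : ZMod 2 :=
  ∑ u, ∑ v, if v < u then (α u : ZMod 2) * (β v : ZMod 2) * Z2n.pairing u.1.deg v.1.deg else 0

/-- The degree of the monomial `ξ^α`. -/
def monoDeg {d : Z2n n → ℕ} (α : FormalVar d →₀ ℕ) : Z2n n := ∑ v, α v • v.1.deg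

section exponents

variable {d : Z2n n → ℕ}

theorem Admissible.mono {α β : FormalVar d →₀ ℕ} (h : Admissible β) (hle : α ≤ β) :
    Admissible α := fun v hv => (hle v).trans (h v hv)

theorem admissible_zero : Admissible (0 : FormalVar d →₀ ℕ) := fun _ _ => Nat.zero_le _

theorem crossing_add_left (α β γ : FormalVar d →₀ ℕ) :
    crossing (α + β) γ = crossing α γ + crossing β γ := by
  simp only [crossing, ← Finset.sum_add_distrib]
  refine Finset.sum_congr rfl fun u _ => Finset.sum_congr rfl fun v _ => ?_
  split_ifs <;> simp [add_mul]

theorem crossing_add_right (α β γ : FormalVar d →₀ ℕ) :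
    crossing α (β + γ) = crossing α β + crossing α γ := by
  simp only [crossing, ← Finset.sum_add_distrib]
  refine Finset.sum_congr rfl fun u _ => Finset.sum_congr rfl fun v _ => ?_
  split_ifs <;> simp [add_mul, mul_add]

theorem crossing_zero_left (α : FormalVar d →₀ ℕ) : crossing 0 α = 0 := by simp [crossing]

theorem crossing_zero_right (α : FormalVar d →₀ ℕ) : crossing α 0 = 0 := by simp [crossing]

theorem monoDeg_add (α β : FormalVar d →₀ ℕ) : monoDeg (α + β) = monoDeg α + monoDeg β := by
  simp only [monoDeg, ← Finset.sum_add_distrib]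
  exact Finset.sum_congr rfl fun v _ => add_smul _ _ _

theorem monoDeg_zero : monoDeg (0 : FormalVar d →₀ ℕ) = 0 := by simp [monoDeg]

theorem pairing_monoDeg (α β : FormalVar d →₀ ℕ) :
    Z2n.pairing (monoDeg α) (monoDeg β) =
      ∑ u, ∑ v, (α u : ZMod 2) * (β v : ZMod 2) * Z2n.pairing u.1.deg v.1.deg := by
  let P : Z2n n →+ Z2n n →+ ZMod 2 := AddMonoidHom.mk' (fun a => AddMonoidHom.mk' (Z2n.pairing a)
    (fun b c => by rw [Z2n.pairing_comm, Z2n.pairing_add_left, Z2n.pairing_comm b,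
      Z2n.pairing_comm c])) (fun a b => by ext c; exact Z2n.pairing_add_left a b c)
  change P (monoDeg α) (monoDeg β) = ∑ u, ∑ v, (α u : ZMod 2) * (β v : ZMod 2) * P u.1.deg v.1.deg
  simp only [monoDeg, map_sum, AddMonoidHom.finsetSum_apply, map_nsmul, AddMonoidHom.nsmul_apply,
    nsmul_eq_mul, Finset.mul_sum, mul_assoc]
  rw [Finset.sum_comm]
  refine Finset.sum_congr rfl fun u _ => Finset.sum_congr rfl fun v _ => ?_
  rw [← mul_assoc, mul_comm (β v : ZMod 2), mul_assoc]

/-- Exchanging two monomials whose product is a monomial costs the sign `(-1)^⟨deg, deg⟩`. -/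
theorem crossing_swap (α β : FormalVar d →₀ ℕ) (h : Admissible (α + β)) :
    crossing α β = Z2n.pairing (monoDeg α) (monoDeg β) + crossing β α := by
  have h2 : ∀ a : ZMod 2, a + a = 0 := by decide
  rw [pairing_monoDeg]
  have hs : crossing β α = ∑ u, ∑ v,
      if u < v then (α u : ZMod 2) * (β v : ZMod 2) * Z2n.pairing u.1.deg v.1.deg else 0 := by
    rw [crossing, Finset.sum_comm]
    refine Finset.sum_congr rfl fun u _ => Finset.sum_congr rfl fun v _ => ?_
    rw [Z2n.pairing_comm v.1.deg, mul_comm (β v : ZMod 2)]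
  rw [hs, crossing, ← Finset.sum_add_distrib]
  refine Finset.sum_congr rfl fun u _ => ?_
  rw [← Finset.sum_add_distrib]
  refine Finset.sum_congr rfl fun v _ => ?_
  rcases lt_trichotomy u v with huv | huv | huv
  · simp [huv, huv.le, h2]
  · subst huv
    have hd : ∀ a : ZMod 2, a = 0 ∨ a = 1 := by decide
    rcases hd (Z2n.pairing u.1.deg u.1.deg) with h0 | h1
    · simp [h0]
    · have h3 := h u h1
      have h4 : α u + β u ≤ 1 := h3
      rcases Nat.eq_zero_or_pos (α u) with h5 | h5
      · simp [h5]
      · have : β u = 0 := by omega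
        simp [this]
  · simp [huv, huv.le]

end exponents

/-- Coefficient families supported on the admissible exponents. -/
def seriesSubmodule (d : Z2n n → ℕ) : Submodule ℝ ((FormalVar d →₀ ℕ) → ℝ) where
  carrier := {f | ∀ α, ¬ Admissible α → f α = 0}
  add_mem' := fun hf hg α h => by simp [hf α h, hg α h]
  zero_mem' := fun _ _ => rfl
  smul_mem' := fun c f hf α h => by simp [hf α h]

/-- The `ℤ₂ⁿ`-commutative algebra `ℝ[[ξ]]` of formal power series `∑ f_α ξ^α` in the formal
variables of `ℝ^d`, where `ξ_u ξ_v = (-1)^⟨deg u, deg v⟩ ξ_v ξ_u`. A series is the family of its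
coefficients on normally ordered monomials. -/
def PSeries (d : Z2n n → ℕ) : Type := seriesSubmodule d

namespace PSeries

variable {d : Z2n n → ℕ}

instance : AddCommGroup (PSeries d) := inferInstanceAs (AddCommGroup (seriesSubmodule d))
instance : Module ℝ (PSeries d) := inferInstanceAs (Module ℝ (seriesSubmodule d))

/-- The coefficient of `ξ^α`. -/
def coeff (α : FormalVar d →₀ ℕ) : PSeries d →ₗ[ℝ] ℝ :=
  (LinearMap.proj α).comp (seriesSubmodule d).subtype

@[ext] theorem ext {f g : PSeries d} (h : ∀ α, coeff α f = coeff α g) : f = g :=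
  Subtype.ext (funext h)

theorem coeff_of_not (f : PSeries d) {α : FormalVar d →₀ ℕ} (h : ¬ Admissible α) :
    coeff α f = 0 := f.2 α h

open Classical in
/-- The series with coefficients `c α` at the admissible exponents `α`. -/
def mk (c : (FormalVar d →₀ ℕ) → ℝ) : PSeries d :=
  ⟨fun α => if Admissible α then c α else 0, fun _ h => if_neg h⟩

theorem coeff_mk (c : (FormalVar d →₀ ℕ) → ℝ) {α : FormalVar d →₀ ℕ} (h : Admissible α) :
    coeff α (mk c) = c α := if_pos h

open Classical in
instance : One (PSeries d) := ⟨mk fun α => if α = 0 then 1 else 0⟩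

open Classical in
theorem coeff_one (α : FormalVar d →₀ ℕ) : coeff α (1 : PSeries d) = if α = 0 then 1 else 0 := by
  by_cases h : Admissible α
  · exact coeff_mk _ h
  · rw [coeff_of_not _ h, if_neg]
    rintro rfl
    exact h admissible_zero

open Classical in
/-- Multiplication: `ξ^α * ξ^β` is `± ξ^(α + β)`, with the sign of the reordering, if `α + β` is
admissible, and `0` otherwise. -/
instance : Mul (PSeries d) := ⟨fun f g => mk fun η =>
  ∑ p ∈ Finset.HasAntidiagonal.antidiagonal η, Z2n.sign (crossing p.1 p.2) * (coeff p.1 f * coeff p.2 g)⟩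

open Classical in
theorem coeff_mul (f g : PSeries d) {η : FormalVar d →₀ ℕ} (h : Admissible η) :
    coeff η (f * g) = ∑ p ∈ Finset.HasAntidiagonal.antidiagonal η,
      Z2n.sign (crossing p.1 p.2) * (coeff p.1 f * coeff p.2 g) := coeff_mk _ h

theorem ext' {f g : PSeries d} (h : ∀ α, Admissible α → coeff α f = coeff α g) : f = g := by
  ext α
  by_cases hα : Admissible α
  · exact h α hα
  · rw [coeff_of_not _ hα, coeff_of_not _ hα]

protected theorem mul_assoc (f g h : PSeries d) : f * g * h = f * (g * h) := by
  classical
  refine ext' fun η hη => ?_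
  rw [coeff_mul _ _ hη, coeff_mul _ _ hη]
  have h1 : ∀ p ∈ Finset.HasAntidiagonal.antidiagonal η,
      Z2n.sign (crossing p.1 p.2) * (coeff p.1 (f * g) * coeff p.2 h) =
      ∑ q ∈ Finset.HasAntidiagonal.antidiagonal p.1, Z2n.sign (crossing q.1 q.2 + crossing q.1 p.2
        + crossing q.2 p.2) * (coeff q.1 f * (coeff q.2 g * coeff p.2 h)) := by
    intro p hp
    rw [Finset.HasAntidiagonal.mem_antidiagonal] at hp
    rw [coeff_mul _ _ (hη.mono (hp ▸ le_self_add)), Finset.sum_mul, Finset.mul_sum]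
    refine Finset.sum_congr rfl fun q hq => ?_
    rw [Finset.HasAntidiagonal.mem_antidiagonal] at hq
    rw [← hq, crossing_add_left, Z2n.sign_add, Z2n.sign_add, Z2n.sign_add]
    ring
  have h2 : ∀ p ∈ Finset.HasAntidiagonal.antidiagonal η,
      Z2n.sign (crossing p.1 p.2) * (coeff p.1 f * coeff p.2 (g * h)) =
      ∑ q ∈ Finset.HasAntidiagonal.antidiagonal p.2, Z2n.sign (crossing p.1 q.1 + crossing p.1 q.2
        + crossing q.1 q.2) * (coeff p.1 f * (coeff q.1 g * coeff q.2 h)) := by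
    intro p hp
    rw [Finset.HasAntidiagonal.mem_antidiagonal] at hp
    rw [coeff_mul _ _ (hη.mono (hp ▸ le_add_self)), Finset.mul_sum, Finset.mul_sum]
    refine Finset.sum_congr rfl fun q hq => ?_
    rw [Finset.HasAntidiagonal.mem_antidiagonal] at hq
    rw [← hq, crossing_add_right, Z2n.sign_add, Z2n.sign_add, Z2n.sign_add]
    ring
  rw [Finset.sum_congr rfl h1, Finset.sum_congr rfl h2, Finset.sum_sigma', Finset.sum_sigma']
  apply Finset.sum_nbij' (fun ⟨⟨_i, j⟩, ⟨k, l⟩⟩ ↦ ⟨(k, l + j), (l, j)⟩)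
    (fun ⟨⟨i, _j⟩, ⟨k, l⟩⟩ ↦ ⟨(i + k, l), (i, k)⟩) <;> simp +contextual [add_assoc]
  all_goals grind

protected theorem one_mul (f : PSeries d) : 1 * f = f := by
  classical
  refine ext' fun η hη => ?_
  rw [coeff_mul _ _ hη, Finset.sum_eq_single (0, η)]
  · simp [coeff_one, crossing_zero_left, Z2n.sign_zero]
  · rintro ⟨a, b⟩ hp hne
    rw [Finset.HasAntidiagonal.mem_antidiagonal] at hp
    have : a ≠ 0 := by
      rintro rfl
      simp at hp
      exact hne (by rw [hp])
    simp [coeff_one, this]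
  · simp

protected theorem mul_one (f : PSeries d) : f * 1 = f := by
  classical
  refine ext' fun η hη => ?_
  rw [coeff_mul _ _ hη, Finset.sum_eq_single (η, 0)]
  · simp [coeff_one, crossing_zero_right, Z2n.sign_zero]
  · rintro ⟨a, b⟩ hp hne
    rw [Finset.HasAntidiagonal.mem_antidiagonal] at hp
    have : b ≠ 0 := by
      rintro rfl
      simp at hp
      exact hne (by rw [hp])
    simp [coeff_one, this]
  · simp

instance : Ring (PSeries d) :=
  { (inferInstance : AddCommGroup (PSeries d)) with
    mul := (· * ·)
    one := 1
    mul_assoc := PSeries.mul_assoc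
    one_mul := PSeries.one_mul
    mul_one := PSeries.mul_one
    zero_mul := fun f => by
      refine ext' fun η hη => ?_
      rw [coeff_mul _ _ hη]; simp
    mul_zero := fun f => by
      refine ext' fun η hη => ?_
      rw [coeff_mul _ _ hη]; simp
    left_distrib := fun f g h => by
      refine ext' fun η hη => ?_
      rw [map_add, coeff_mul _ _ hη, coeff_mul _ _ hη, coeff_mul _ _ hη, ← Finset.sum_add_distrib]
      exact Finset.sum_congr rfl fun p _ => by rw [map_add]; ring
    right_distrib := fun f g h => by
      refine ext' fun η hη => ?_
      rw [map_add, coeff_mul _ _ hη, coeff_mul _ _ hη, coeff_mul _ _ hη, ← Finset.sum_add_distrib]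
      exact Finset.sum_congr rfl fun p _ => by rw [map_add]; ring }

instance : Algebra ℝ (PSeries d) := Algebra.ofModule
  (fun r f g => by
    refine ext' fun η hη => ?_
    rw [map_smul, coeff_mul _ _ hη, coeff_mul _ _ hη, Finset.smul_sum]
    exact Finset.sum_congr rfl fun p _ => by rw [map_smul]; simp only [smul_eq_mul]; ring)
  (fun r f g => by
    refine ext' fun η hη => ?_
    rw [map_smul, coeff_mul _ _ hη, coeff_mul _ _ hη, Finset.smul_sum]
    exact Finset.sum_congr rfl fun p _ => by rw [map_smul]; simp only [smul_eq_mul]; ring)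

open Classical in
/-- The formal variable `ξ_v` as a series. -/
def X (v : FormalVar d) : PSeries d := mk fun α => if α = Finsupp.single v 1 then 1 else 0

/-- The set of series all of whose monomials have degree `γ`. -/
def IsHomog (γ : Z2n n) (f : PSeries d) : Prop := ∀ α, coeff α f ≠ 0 → monoDeg α = γ

theorem isHomog_mul {γ δ : Z2n n} {f g : PSeries d} (hf : IsHomog γ f) (hg : IsHomog δ g) :
    IsHomog (γ + δ) (f * g) := by
  classical
  intro η h
  by_cases hη : Admissible η
  · rw [coeff_mul _ _ hη] at h
    obtain ⟨p, hp, hne⟩ := Finset.exists_ne_zero_of_sum_ne_zero h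
    rw [Finset.HasAntidiagonal.mem_antidiagonal] at hp
    have h1 : coeff p.1 f ≠ 0 := fun h0 => hne (by simp [h0])
    have h2 : coeff p.2 g ≠ 0 := fun h0 => hne (by simp [h0])
    rw [← hp, monoDeg_add, hf _ h1, hg _ h2]
  · exact absurd (coeff_of_not _ hη) h

theorem isHomog_comm {γ δ : Z2n n} {f g : PSeries d} (hf : IsHomog γ f) (hg : IsHomog δ g) :
    f * g = Z2n.sign (Z2n.pairing γ δ) • (g * f) := by
  classical
  refine ext' fun η hη => ?_
  rw [map_smul, coeff_mul _ _ hη, coeff_mul _ _ hη, Finset.smul_sum]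
  refine Finset.sum_nbij' Prod.swap Prod.swap (fun p hp => ?_) (fun p hp => ?_) (fun _ _ => rfl)
    (fun _ _ => rfl) (fun p hp => ?_)
  · simpa [add_comm] using hp
  · simpa [add_comm] using hp
  rw [Finset.HasAntidiagonal.mem_antidiagonal] at hp
  simp only [Prod.fst_swap, Prod.snd_swap, smul_eq_mul]
  by_cases h1 : coeff p.1 f = 0
  · simp [h1]
  by_cases h2 : coeff p.2 g = 0
  · simp [h2]
  rw [crossing_swap p.1 p.2 (by rwa [hp]), hf _ h1, hg _ h2, Z2n.sign_add]
  ring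

end PSeries

/-- Smooth real functions on an open subset of `ℝ^N`. -/
def SmoothOn {N : ℕ} {U : Opens (Fin N → ℝ)} (c : U → ℝ) : Prop :=
  ContDiffOn ℝ ∞ (Function.extend Subtype.val c 0) U

namespace SmoothOn

variable {N : ℕ} {U V : Opens (Fin N → ℝ)} {b c : U → ℝ}

theorem of_eq (F : (Fin N → ℝ) → ℝ) (hF : ContDiffOn ℝ ∞ F U) (h : ∀ x : U, c x = F x) :
    SmoothOn c := by
  refine hF.congr fun x hx => ?_
  rw [← h ⟨x, hx⟩]
  exact Subtype.val_injective.extend_apply c 0 ⟨x, hx⟩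

theorem extend_apply (c : U → ℝ) (x : U) : Function.extend Subtype.val c 0 (x : Fin N → ℝ) = c x :=
  Subtype.val_injective.extend_apply c 0 x

theorem const (r : ℝ) : SmoothOn (fun _ : U => r) := of_eq (fun _ => r) contDiffOn_const fun _ => rfl

theorem add (hb : SmoothOn b) (hc : SmoothOn c) : SmoothOn (fun x => b x + c x) :=
  of_eq _ (ContDiffOn.add hb hc) fun x => by simp only [extend_apply]

theorem mul (hb : SmoothOn b) (hc : SmoothOn c) : SmoothOn (fun x => b x * c x) :=
  of_eq _ (ContDiffOn.mul hb hc) fun x => by simp only [extend_apply]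

theorem sum {ι : Type} (s : Finset ι) (c : ι → U → ℝ) (h : ∀ i ∈ s, SmoothOn (c i)) :
    SmoothOn (fun x => ∑ i ∈ s, c i x) :=
  of_eq _ (ContDiffOn.sum (f := fun i => Function.extend Subtype.val (c i) 0) h)
    fun x => by simp only [extend_apply]

theorem res (hc : SmoothOn c) (h : V ≤ U) : SmoothOn (fun x : V => c ⟨x, h x.2⟩) :=
  of_eq _ (ContDiffOn.mono hc h) fun x => (extend_apply c ⟨x, h x.2⟩).symm

theorem of_locally (h : ∀ x : U, ∃ (W : Opens (Fin N → ℝ)) (_ : (x : Fin N → ℝ) ∈ W) (hW : W ≤ U),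
    SmoothOn (fun y : W => c ⟨y, hW y.2⟩)) : SmoothOn c := by
  intro x hx
  obtain ⟨W, hxW, hW, hc⟩ := h ⟨x, hx⟩
  have h1 : ContDiffOn ℝ ∞ (Function.extend Subtype.val c 0) W := by
    refine ContDiffOn.congr hc fun y hy => ?_
    rw [extend_apply c ⟨y, hW hy⟩]
    exact (extend_apply (fun y : W => c ⟨y, hW y.2⟩) ⟨y, hy⟩).symm
  exact (h1.contDiffAt (W.isOpen.mem_nhds hxW)).contDiffWithinAt

end SmoothOn

/-- The algebra `C^∞(U)[[ξ]]`: a formal power series with coefficients in `C^∞(U)` is regarded as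
a function from `U` to `ℝ[[ξ]]` all of whose coefficients are smooth. -/
def smoothSeries (d : Z2n n → ℕ) (U : Opens (Fin (d 0) → ℝ)) : Subalgebra ℝ (U → PSeries d) where
  carrier := {f | ∀ α, SmoothOn fun x => PSeries.coeff α (f x)}
  mul_mem' := fun {f g} hf hg η => by
    classical
    by_cases hη : Admissible η
    · simp only [Pi.mul_apply, PSeries.coeff_mul _ _ hη]
      exact SmoothOn.sum _ _ fun p _ => (SmoothOn.const _).mul ((hf p.1).mul (hg p.2))
    · simp only [PSeries.coeff_of_not _ hη]
      exact SmoothOn.const 0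
  add_mem' := fun {f g} hf hg η => by
    simp only [Pi.add_apply, map_add]
    exact (hf η).add (hg η)
  algebraMap_mem' := fun r η => SmoothOn.const (PSeries.coeff η (algebraMap ℝ (PSeries d) r))

/-- Restriction of functions. -/
def smoothSeriesRes (d : Z2n n → ℕ) {U V : Opens (Fin (d 0) → ℝ)} (h : V ≤ U) :
    smoothSeries d U →ₐ[ℝ] smoothSeries d V where
  toFun f := ⟨fun x => f.1 ⟨x, h x.2⟩, fun α => (f.2 α).res h⟩
  map_one' := rfl
  map_mul' _ _ := rfl
  map_zero' := rfl
  map_add' _ _ := rfl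
  commutes' _ := rfl

/-- The presheaf `U ↦ C^∞(U)[[ξ]]` on `ℝ^{d₀}`. -/
def superdomainPresheaf (d : Z2n n → ℕ) :
    TopCat.Presheaf (AlgCat.{0} ℝ) (TopCat.of (Fin (d 0) → ℝ)) where
  obj U := AlgCat.of ℝ (smoothSeries d U.unop)
  map i := AlgCat.ofHom (smoothSeriesRes d i.unop.le)
  map_id _ := rfl
  map_comp _ _ := rfl

/-- The property of having smooth coefficients is local. -/
def smoothLocalPredicate (d : Z2n n → ℕ) :
    TopCat.LocalPredicate fun _ : TopCat.of (Fin (d 0) → ℝ) => PSeries d where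
  pred {U} f := ∀ α, SmoothOn (U := U) fun x => PSeries.coeff α (f x)
  res := fun i _ hf α => (hf α).res i.le
  locality := fun {U} f hf α => SmoothOn.of_locally (U := U) fun x => by
    obtain ⟨W, hx, i, h⟩ := hf x
    exact ⟨W, hx, i.le, h α⟩

theorem superdomainPresheaf_isSheaf (d : Z2n n → ℕ) : (superdomainPresheaf d).IsSheaf := by
  rw [TopCat.Presheaf.isSheaf_iff_isSheaf_comp (CategoryTheory.forget (AlgCat.{0} ℝ))]
  exact TopCat.subpresheafToTypes.isSheaf (smoothLocalPredicate d)

/-- A `ℤ₂ⁿ`-ringed space: a topological space with a sheaf of associative unital `ℝ`-algebras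
which are `ℤ₂ⁿ`-graded and `ℤ₂ⁿ`-commutative, the restriction maps being of weight zero. -/
structure Z2nRingedSpace (n : ℕ) extends SheafedSpace.{_, _, 0} (AlgCat.{0} ℝ) where
  /-- the homogeneous sections of degree `γ` over `U` -/
  gr (U : Opens carrier) (γ : Z2n n) : Submodule ℝ (presheaf.obj (op U))
  isInternal : ∀ U, DirectSum.IsInternal (gr U)
  one_mem : ∀ U, (1 : presheaf.obj (op U)) ∈ gr U 0
  mul_mem : ∀ U γ δ (a b : presheaf.obj (op U)), a ∈ gr U γ → b ∈ gr U δ → a * b ∈ gr U (γ + δ)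
  comm : ∀ U γ δ (a b : presheaf.obj (op U)), a ∈ gr U γ → b ∈ gr U δ →
    a * b = Z2n.sign (Z2n.pairing γ δ) • (b * a)
  res_mem : ∀ (U V : Opens carrier) (h : V ≤ U) γ (a : presheaf.obj (op U)), a ∈ gr U γ →
    (presheaf.map (homOfLE h).op).hom a ∈ gr V γ

namespace Z2nRingedSpace

instance : CoeSort (Z2nRingedSpace n) Type := ⟨fun X => X.carrier⟩

instance topology (X : Z2nRingedSpace n) : TopologicalSpace X := X.carrier.str

/-- The sections of the structure sheaf over `U`. -/
abbrev Sec (X : Z2nRingedSpace n) (U : Opens X) : Type := X.presheaf.obj (op U)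

/-- Restriction of sections. -/
def res (X : Z2nRingedSpace n) {U V : Opens X} (h : V ≤ U) : X.Sec U →ₐ[ℝ] X.Sec V :=
  (X.presheaf.map (homOfLE h).op).hom

/-- The section `s` has an inverse on some neighbourhood of the point `x` (i.e. its germ at `x`
is a unit of the stalk). -/
def UnitNear (X : Z2nRingedSpace n) {U : Opens X} (s : X.Sec U) (x : X) : Prop :=
  ∃ (W : Opens X) (h : W ≤ U), x ∈ W ∧ IsUnit (X.res h s)

/-- The pullback `ψ* : 𝒪_Y(V) → 𝒪_X(ψ⁻¹ V)`. -/
def pull {X Y : Z2nRingedSpace n} (f : X.toSheafedSpace ⟶ Y.toSheafedSpace) (V : Opens Y) :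
    Y.Sec V →ₐ[ℝ] X.Sec ((Opens.map f.hom.base).obj V) := (f.hom.c.app (op V)).hom

/-- Morphisms of `ℤ₂ⁿ`-ringed spaces: a continuous map together with a morphism of sheaves of
algebras in the opposite direction, of weight zero, and local: a germ is invertible as soon as its
pullback is. -/
@[ext] structure Hom (X Y : Z2nRingedSpace n) where
  toHom : X.toSheafedSpace ⟶ Y.toSheafedSpace
  weight_zero : ∀ (V : Opens Y) γ (s : Y.Sec V), s ∈ Y.gr V γ → pull toHom V s ∈ X.gr _ γ
  isLocal : ∀ (V : Opens Y) (s : Y.Sec V) (x : X),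
    X.UnitNear (pull toHom V s) x → Y.UnitNear s (toHom.hom.base x)

instance : Category (Z2nRingedSpace n) where
  Hom := Hom
  id _ := ⟨𝟙 _, fun _ _ _ hs => hs, fun _ _ _ h => h⟩
  comp f g := ⟨f.toHom ≫ g.toHom, fun _ _ _ hs => f.weight_zero _ _ _ (g.weight_zero _ _ _ hs),
    fun _ _ _ h => g.isLocal _ _ _ (f.isLocal _ _ _ h)⟩
  id_comp _ := Hom.ext (Category.id_comp _)
  comp_id _ := Hom.ext (Category.comp_id _)
  assoc _ _ _ := Hom.ext (Category.assoc _ _ _)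

theorem map_map (X : Z2nRingedSpace n) {A B C : (Opens X)ᵒᵖ} (f : A ⟶ B) (g : B ⟶ C) (h : A ⟶ C)
    (s : X.presheaf.obj A) :
    (X.presheaf.map g).hom ((X.presheaf.map f).hom s) = (X.presheaf.map h).hom s := by
  rw [Subsingleton.elim h (f ≫ g), X.presheaf.map_comp]
  rfl

/-- The open subspace `(U, 𝒪_X|_U)`. -/
def restrict (X : Z2nRingedSpace n) (U : Opens X) : Z2nRingedSpace n where
  toSheafedSpace := X.toSheafedSpace.restrict U.isOpenEmbedding
  gr W := X.gr (U.isOpenEmbedding.functor.obj W)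
  isInternal _ := X.isInternal _
  one_mem _ := X.one_mem _
  mul_mem _ := X.mul_mem _
  comm _ := X.comm _
  res_mem _ _ h := X.res_mem _ _ (U.isOpenEmbedding.functor.map (homOfLE h)).le

/-- The inclusion `(U, 𝒪_X|_U) ⟶ X`. -/
def incl (X : Z2nRingedSpace n) (U : Opens X) : X.restrict U ⟶ X where
  toHom := X.toSheafedSpace.ofRestrict U.isOpenEmbedding
  weight_zero _ γ s hs := X.res_mem _ _ _ γ s hs
  isLocal V s x := by
    rintro ⟨W, hW, hx, hu⟩
    refine ⟨U.isOpenEmbedding.functor.obj W, ?_, ⟨x, hx, rfl⟩, ?_⟩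
    · rintro _ ⟨y, hy, rfl⟩
      exact hW hy
    · have e := map_map X (A := op V)
        (homOfLE (by rintro _ ⟨y, hy, rfl⟩; exact hy) :
          U.isOpenEmbedding.functor.obj ((Opens.map U.inclusion').obj V) ⟶ V).op
        (U.isOpenEmbedding.functor.map (homOfLE hW)).op
        (homOfLE (by rintro _ ⟨y, hy, rfl⟩; exact hW hy)).op s
      exact (congrArg IsUnit e).mp hu

theorem image_le (X : Z2nRingedSpace n) {U V : Opens X} (h : U ≤ V) (W : Opens V) :
    U.isOpenEmbedding.functor.obj ((Opens.map ((Opens.toTopCat X.carrier).map (homOfLE h))).obj W) ≤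
      V.isOpenEmbedding.functor.obj W := by
  rintro _ ⟨y, hy, rfl⟩
  exact ⟨⟨y.1, h y.2⟩, hy, rfl⟩

/-- For `U ⊆ V`, the inclusion `(U, 𝒪_X|_U) ⟶ (V, 𝒪_X|_V)`. -/
def inclLE (X : Z2nRingedSpace n) {U V : Opens X} (h : U ≤ V) : X.restrict U ⟶ X.restrict V where
  toHom := InducedCategory.homMk
    { base := (Opens.toTopCat X.carrier).map (homOfLE h)
      c :=
      { app := fun W => X.presheaf.map (homOfLE (image_le X h W.unop)).op
        naturality := fun A B i => by
          refine AlgCat.Hom.ext (AlgHom.ext fun s => ?_)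
          have hle : U.isOpenEmbedding.functor.obj
              ((Opens.map ((Opens.toTopCat X.carrier).map (homOfLE h))).obj B.unop) ≤
              V.isOpenEmbedding.functor.obj A.unop :=
            (image_le X h B.unop).trans (V.isOpenEmbedding.functor.map i.unop).le
          exact (map_map X _ _ (homOfLE hle).op s).trans (map_map X _ _ (homOfLE hle).op s).symm } }
  weight_zero _ γ s hs := X.res_mem _ _ _ γ s hs
  isLocal A s x := by
    rintro ⟨W, hW, hx, hu⟩
    have ho : Topology.IsOpenEmbedding ((Opens.toTopCat X.carrier).map (homOfLE h)) :=
      Opens.isOpenEmbedding_of_le h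
    have hle : ho.functor.obj W ≤ A := by
      rintro _ ⟨y, hy, rfl⟩
      exact hW hy
    have e : V.isOpenEmbedding.functor.obj (ho.functor.obj W) ≤
        U.isOpenEmbedding.functor.obj W := by
      rintro _ ⟨_, ⟨y, hy, rfl⟩, rfl⟩
      exact ⟨y, hy, rfl⟩
    refine ⟨ho.functor.obj W, hle, ⟨x, hx, rfl⟩, ?_⟩
    have h1 := map_map X (homOfLE (image_le X h A)).op
      (U.isOpenEmbedding.functor.map (homOfLE hW)).op
      (homOfLE ((U.isOpenEmbedding.functor.map (homOfLE hW)).le.trans (image_le X h A))).op s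
    have h2 := map_map X
      (homOfLE ((U.isOpenEmbedding.functor.map (homOfLE hW)).le.trans (image_le X h A))).op
      (homOfLE e).op (V.isOpenEmbedding.functor.map (homOfLE hle)).op s
    have h3 := ((congrArg IsUnit h1).mp hu).map (X.presheaf.map (homOfLE e).op).hom
    exact (congrArg IsUnit h2).mp h3

end Z2nRingedSpace

/-- Homogeneous parts of `C^∞(U)[[ξ]]`. -/
def smoothSeriesGr (d : Z2n n → ℕ) (U : Opens (Fin (d 0) → ℝ)) (γ : Z2n n) :
    Submodule ℝ (smoothSeries d U) where
  carrier := {f | ∀ x, PSeries.IsHomog γ (f.1 x)}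
  add_mem' := fun {f g} hf hg x α h => by
    by_contra hne
    have h1 : PSeries.coeff α (f.1 x) = 0 := by_contra fun h0 => hne (hf x α h0)
    have h2 : PSeries.coeff α (g.1 x) = 0 := by_contra fun h0 => hne (hg x α h0)
    refine h ?_
    change PSeries.coeff α (f.1 x + g.1 x) = 0
    rw [map_add, h1, h2, add_zero]
  zero_mem' := fun _ _ h => absurd (map_zero _) h
  smul_mem' := fun c f hf x α h => hf x α fun h0 => h (by
    change PSeries.coeff α (c • f.1 x) = 0
    rw [map_smul, h0, smul_zero])

/-- The homogeneous component of degree `γ`. -/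
def smoothSeriesProj (d : Z2n n → ℕ) (U : Opens (Fin (d 0) → ℝ)) (γ : Z2n n)
    (f : smoothSeries d U) : smoothSeriesGr d U γ :=
  ⟨⟨fun x => PSeries.mk fun α => if monoDeg α = γ then PSeries.coeff α (f.1 x) else 0, fun α => by
    by_cases hα : Admissible α
    · simp only [PSeries.coeff_mk _ hα]
      split_ifs
      · exact f.2 α
      · exact SmoothOn.const 0
    · simp only [PSeries.coeff_of_not _ hα]
      exact SmoothOn.const 0⟩, fun x α h => by
    by_cases hα : Admissible α
    · by_contra hne
      exact h ((PSeries.coeff_mk _ hα).trans (if_neg hne))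
    · exact absurd (PSeries.coeff_of_not _ hα) h⟩

theorem coeff_smoothSeriesProj (d : Z2n n → ℕ) (U : Opens (Fin (d 0) → ℝ))
    (f : smoothSeries d U) (x : U) (α : FormalVar d →₀ ℕ) :
    PSeries.coeff α ((smoothSeriesProj d U (monoDeg α) f).1.1 x) = PSeries.coeff α (f.1 x) := by
  by_cases hα : Admissible α
  · exact (PSeries.coeff_mk _ hα).trans (if_pos rfl)
  · exact (PSeries.coeff_of_not _ hα).trans (PSeries.coeff_of_not (f.1 x) hα).symm

theorem smoothSeries_isInternal (d : Z2n n → ℕ) (U : Opens (Fin (d 0) → ℝ)) :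
    DirectSum.IsInternal (smoothSeriesGr d U) := by
  classical
  let ev (x : U) (α : FormalVar d →₀ ℕ) : smoothSeries d U →ₗ[ℝ] ℝ :=
    (PSeries.coeff α) ∘ₗ (LinearMap.proj x) ∘ₗ (smoothSeries d U).val.toLinearMap
  have hev : ∀ (v : DirectSum (Z2n n) fun γ => smoothSeriesGr d U γ) (x : U) (α),
      ev x α (DirectSum.coeAddMonoidHom (smoothSeriesGr d U) v) = ev x α (v (monoDeg α)).1 := by
    intro v x α
    rw [DirectSum.coeAddMonoidHom_eq_dfinsuppSum, DFinsupp.sum_eq_sum_fintype _ (fun _ => rfl),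
      map_sum]
    refine Finset.sum_eq_single_of_mem _ (Finset.mem_univ _) fun γ _ hγ => ?_
    by_contra h
    exact hγ ((v γ).2 x α h).symm
  have hext : ∀ f g : smoothSeries d U, (∀ x α, ev x α f = ev x α g) → f = g := fun f g h =>
    Subtype.ext (funext fun x => PSeries.ext (h x))
  constructor
  · intro v w hvw
    refine DFinsupp.ext fun γ => Subtype.ext (hext _ _ fun x α => ?_)
    by_cases h : monoDeg α = γ
    · subst h
      rw [← hev v, ← hev w, hvw]
    · have h1 : ∀ u : smoothSeriesGr d U γ, ev x α u.1 = 0 := fun u =>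
        by_contra fun h0 => h (u.2 x α h0)
      rw [h1, h1]
  · intro f
    refine ⟨DirectSum.mk _ Finset.univ fun γ => smoothSeriesProj d U γ f, hext _ _ fun x α => ?_⟩
    rw [hev, DirectSum.mk_apply_of_mem (Finset.mem_univ _)]
    exact coeff_smoothSeriesProj d U f x α

/-- The superdomain `ℝ^d = (ℝ^{d₀}, C^∞(-)[[ξ]])`. -/
def superdomain (d : Z2n n → ℕ) : Z2nRingedSpace n where
  carrier := TopCat.of (Fin (d 0) → ℝ)
  presheaf := superdomainPresheaf d
  IsSheaf := superdomainPresheaf_isSheaf d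
  gr U γ := smoothSeriesGr d U γ
  isInternal U := smoothSeries_isInternal d U
  one_mem U := fun x α h => by
    classical
    change PSeries.coeff α 1 ≠ 0 at h
    rw [PSeries.coeff_one] at h
    have : α = 0 := by_contra fun h0 => h (if_neg h0)
    rw [this, monoDeg_zero]
  mul_mem U γ δ a b ha hb := fun x => PSeries.isHomog_mul (ha x) (hb x)
  comm U γ δ a b ha hb := Subtype.ext (funext fun x => PSeries.isHomog_comm (ha x) (hb x))
  res_mem U V h γ a ha := fun x => ha ⟨x.1, h x.2⟩

/-- A `ℤ₂ⁿ`-supermanifold of dimension `d`: a Hausdorff, second countable `ℤ₂ⁿ`-ringed space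
which is locally isomorphic to `ℝ^d`. -/
def IsSupermanifold (d : Z2n n → ℕ) (X : Z2nRingedSpace n) : Prop :=
  T2Space X ∧ SecondCountableTopology X ∧
    ∀ x : X, ∃ U : Opens X, x ∈ U ∧ ∃ V : Opens (superdomain d),
      Nonempty (X.restrict U ≅ (superdomain d).restrict V)

/-- The coordinate of `ℝ^d` with index `a = (γ, j)` at the point `x`: the real number `x_j` if
`γ = 0`, the formal variable `ξ_γ^j` otherwise. -/
def coordAt {d : Z2n n → ℕ} (a : Idx d) (x : Fin (d 0) → ℝ) : PSeries d :=
  if h : a.deg = 0 then algebraMap ℝ (PSeries d) (x (Fin.cast (congrArg d h) a.pos))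
  else PSeries.X ⟨a, h⟩

theorem smoothOn_coordAt {d : Z2n n → ℕ} (a : Idx d) (U : Opens (Fin (d 0) → ℝ))
    (α : FormalVar d →₀ ℕ) : SmoothOn fun x : U => PSeries.coeff α (coordAt a x) := by
  by_cases h : a.deg = 0
  · simp only [coordAt, dif_pos h, Algebra.algebraMap_eq_smul_one, map_smul, smul_eq_mul]
    refine SmoothOn.mul ?_ (SmoothOn.const _)
    exact SmoothOn.of_eq (fun x => x (Fin.cast (congrArg d h) a.pos))
      (contDiff_apply ℝ ℝ _).contDiffOn fun _ => rfl
  · simp only [coordAt, dif_neg h]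
    exact SmoothOn.const _

section Grassmannian

variable {k m : Z2n n → ℕ}

/-- The dimension `β_γ = ∑_{γ' + γ'' = γ} k_γ' (m_γ'' - k_γ'')`. -/
def grDim (k m : Z2n n → ℕ) (γ : Z2n n) : ℕ :=
  ∑ p : Z2n n × Z2n n with p.1 + p.2 = γ, k p.1 * (m p.2 - k p.2)

/-- A `k`-index: for every degree `γ` a set `I_γ ⊆ {1, …, m_γ}` with `k_γ` elements. -/
structure KIndex (k m : Z2n n → ℕ) where
  cols : ∀ γ, Finset (Fin (m γ))
  card_cols : ∀ γ, (cols γ).card = k γ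

namespace KIndex

/-- The columns with indices in `I`. -/
def Mem (I : KIndex k m) (c : Idx m) : Prop := c.pos ∈ I.cols c.deg

instance (I : KIndex k m) : DecidablePred I.Mem := fun c =>
  inferInstanceAs (Decidable (c.pos ∈ I.cols c.deg))

/-- The columns with indices in `I` in ascending order; the one in position `r`. -/
def col (I : KIndex k m) (r : Idx k) : Idx m :=
  ⟨r.deg, (I.cols r.deg).orderEmbOfFin (I.card_cols r.deg) r.pos⟩

/-- The entries outside the columns in `I` which lie in a block of degree `γ`, as pairs
(column, row), ordered from up to down and from left to right. -/
def freePos (I : KIndex k m) (γ : Z2n n) : Finset (Idx m ×ₗ Idx k) :=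
  (Finset.univ.filter fun p : Idx m × Idx k => ¬ I.Mem p.1 ∧ p.2.deg + p.1.deg = γ).map
    toLex.toEmbedding

theorem mem_freePos (I : KIndex k m) {r : Idx k} {c : Idx m} (h : ¬ I.Mem c) :
    toLex (c, r) ∈ I.freePos (r.deg + c.deg) :=
  Finset.mem_map_of_mem _ (Finset.mem_filter.mpr ⟨Finset.mem_univ _, h, rfl⟩)

theorem card_freePos (I : KIndex k m) (γ : Z2n n) : (I.freePos γ).card = grDim k m γ := by
  rw [freePos, Finset.card_map, grDim, Finset.card_eq_sum_card_fiberwise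
    (f := fun p : Idx m × Idx k => (p.2.deg, p.1.deg))
    (t := Finset.univ.filter fun p : Z2n n × Z2n n => p.1 + p.2 = γ)]
  · refine Finset.sum_congr rfl fun q hq => ?_
    have h1 : (Finset.univ ×ˢ (I.cols q.2)ᶜ : Finset (Fin (k q.1) × Fin (m q.2))).card =
        k q.1 * (m q.2 - k q.2) := by
      rw [Finset.card_product, Finset.card_compl, I.card_cols, Finset.card_univ, Fintype.card_fin,
        Fintype.card_fin]
    rw [← h1]
    symm
    refine Finset.card_bij (fun a _ => ((⟨q.2, a.2⟩ : Idx m), (⟨q.1, a.1⟩ : Idx k))) ?_ ?_ ?_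
    · rintro ⟨a, b⟩ hab
      simp only [Finset.mem_product, Finset.mem_compl, Finset.mem_filter, Finset.mem_univ,
        true_and] at hab hq ⊢
      exact ⟨⟨hab, hq⟩, trivial⟩
    · rintro ⟨a, b⟩ _ ⟨a', b'⟩ _ h
      simpa [and_comm] using h
    · rintro ⟨⟨γ₁, b⟩, ⟨γ₂, a⟩⟩ h
      simp only [Finset.mem_filter, Finset.mem_univ, true_and] at h
      obtain ⟨⟨hb, -⟩, rfl⟩ := h
      exact ⟨(a, b), by simpa [Mem] using hb, rfl⟩
  · intro p hp
    simpa using (Finset.mem_filter.mp hp).2.2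

/-- The coordinate of the chart which is the entry in row `r` and column `c ∉ I` of `A_I`: the
coordinates of each degree fill the places of that degree in order. -/
def coordIdx (I : KIndex k m) (r : Idx k) (c : Idx m) (h : ¬ I.Mem c) : Idx (grDim k m) :=
  ⟨r.deg + c.deg, ((I.freePos (r.deg + c.deg)).orderIsoOfFin (I.card_freePos _)).symm
    ⟨toLex (c, r), I.mem_freePos h⟩⟩

/-- The value at `x` of the label `A_I` of the chart `U_I`: the columns in `I` form the identity
matrix, the other entries are the coordinates. -/
def labelAt (I : KIndex k m) (x : Fin (grDim k m 0) → ℝ) :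
    Matrix (Idx k) (Idx m) (PSeries (grDim k m)) := fun r c =>
  if h : I.Mem c then if c = I.col r then 1 else 0 else coordAt (I.coordIdx r c h) x

/-- `M_I A`, the square matrix formed by the columns of `A` with indices in `I`. -/
def minor {R : Type} (I : KIndex k m) (A : Matrix (Idx k) (Idx m) R) :
    Matrix (Idx k) (Idx k) R := A.submatrix id I.col

/-- `D_I A`, the matrix which remains of `A` after omitting the columns with indices in `I`. -/
def omitCols {R : Type} (I : KIndex k m) (A : Matrix (Idx k) (Idx m) R) :
    Matrix (Idx k) {c : Idx m // ¬ I.Mem c} R := A.submatrix id Subtype.val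

theorem smoothOn_labelAt (I : KIndex k m) (U : Opens (Fin (grDim k m 0) → ℝ)) (r : Idx k)
    (c : Idx m) (α : FormalVar (grDim k m) →₀ ℕ) :
    SmoothOn fun x : U => PSeries.coeff α (I.labelAt x r c) := by
  by_cases h : I.Mem c
  · simp only [labelAt, dif_pos h]
    exact SmoothOn.const _
  · simp only [labelAt, dif_neg h]
    exact smoothOn_coordAt _ U α

end KIndex

/-- The superdomain `ℝ^β`, of which a copy `U_I` is taken for every `k`-index `I`. -/
abbrev chart (k m : Z2n n → ℕ) : Z2nRingedSpace n := superdomain (grDim k m)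

/-- The label `A_I` as a matrix of sections of the structure sheaf of the chart over `U`. -/
def label (I : KIndex k m) (U : Opens (chart k m)) :
    Matrix (Idx k) (Idx m) ((chart k m).Sec U) := fun r c =>
  (⟨fun x => I.labelAt x.1 r c, I.smoothOn_labelAt U r c⟩ : smoothSeries (grDim k m) U)

/-- The label `A_I` as a matrix of global sections of the open subspace `U` of the chart. -/
def labelOn (I : KIndex k m) (U : Opens (chart k m)) :
    Matrix (Idx k) (Idx m) (((chart k m).restrict U).Sec ⊤) :=
  label I (U.isOpenEmbedding.functor.obj ⊤)

/-- The open set `Ũ_{I,J}` of the points of `U_I` at which `M_J A_I` is invertible, i.e. at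
which the real matrix of the values (the coefficients of `ξ^0`) of its entries is invertible. -/
def overlap (I J : KIndex k m) : Opens (chart k m) where
  carrier := {x | IsUnit ((J.minor (I.labelAt x)).map (PSeries.coeff 0))}
  is_open' := by
    have h1 : Continuous fun x : Fin (grDim k m 0) → ℝ =>
        ((J.minor (I.labelAt x)).map (PSeries.coeff 0)).det := by
      refine Continuous.matrix_det (continuous_matrix fun r c => ?_)
      have h := I.smoothOn_labelAt ⊤ r (J.col c) 0
      refine continuousOn_univ.mp ((ContDiffOn.continuousOn h).congr fun x hx => ?_)
      exact (SmoothOn.extend_apply (U := ⊤) (fun x => PSeries.coeff 0 (I.labelAt x r (J.col c)))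
        ⟨x, trivial⟩).symm
    have h2 : {x : Fin (grDim k m 0) → ℝ | IsUnit ((J.minor (I.labelAt x)).map (PSeries.coeff 0))} =
        (fun x => ((J.minor (I.labelAt x)).map (PSeries.coeff 0)).det) ⁻¹' {0}ᶜ := by
      ext x
      exact (Matrix.isUnit_iff_isUnit_det _).trans isUnit_iff_ne_zero
    change IsOpen {x : Fin (grDim k m 0) → ℝ | _}
    rw [h2]
    exact isOpen_compl_singleton.preimage h1

/-- The pasting equation `D_I((M_I A_J)⁻¹ A_J) = D_I(A_I)` for a morphism from `Ũ_{J,I}` to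
`Ũ_{I,J}`: the pullback of every entry of `D_I(A_I)` is the corresponding entry of the left-hand
side. -/
def IsPasting (I J : KIndex k m)
    (g : (chart k m).restrict (overlap J I) ⟶ (chart k m).restrict (overlap I J)) : Prop :=
  (I.omitCols (labelOn I (overlap I J))).map (Z2nRingedSpace.pull g.toHom ⊤) =
    I.omitCols (Ring.inverse (I.minor (labelOn J (overlap J I))) * labelOn J (overlap J I))

/-- `h` is the restriction of `g` to smaller open subspaces of the source and the target. -/
def IsRestriction {X Y : Z2nRingedSpace n} {U U' : Opens X} {V V' : Opens Y}
    (g : X.restrict U ⟶ Y.restrict V) (h : X.restrict U' ⟶ Y.restrict V') : Prop :=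
  ∃ (hU : U' ≤ U) (hV : V' ≤ V), h ≫ Y.inclLE hV = X.inclLE hU ≫ g

/-- A choice of morphisms `g_{I,J} : U_J ⊇ Ũ_{J,I} ⟶ Ũ_{I,J} ⊆ U_I`. -/
abbrev Transitions (k m : Z2n n → ℕ) : Type := ∀ I J : KIndex k m,
  (chart k m).restrict (overlap J I) ⟶ (chart k m).restrict (overlap I J)

/-- The composite `g_{I,J} ∘ g_{J,S} ∘ g_{S,I}` of the restrictions to the triple overlaps is
defined, and it is the identity of the part `Ũ_{I,J} ∩ Ũ_{I,S}` of `U_I`. -/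
def Cocycle (g : Transitions k m) (I J S : KIndex k m) : Prop :=
  ∃ (gIJ : (chart k m).restrict (overlap J I ⊓ overlap J S) ⟶
      (chart k m).restrict (overlap I J ⊓ overlap I S))
    (gJS : (chart k m).restrict (overlap S I ⊓ overlap S J) ⟶
      (chart k m).restrict (overlap J I ⊓ overlap J S))
    (gSI : (chart k m).restrict (overlap I J ⊓ overlap I S) ⟶
      (chart k m).restrict (overlap S I ⊓ overlap S J)),
    IsRestriction (g I J) gIJ ∧ IsRestriction (g J S) gJS ∧ IsRestriction (g S I) gSI ∧
      gSI ≫ gJS ≫ gIJ = 𝟙 _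

/-- `G` is obtained by gluing the charts `U_I` through the morphisms `g_{I,J}`: it is covered by
open subspaces `W_I` with isomorphisms `φ_I : U_I ≅ W_I`, such that `φ_I⁻¹(W_J) = Ũ_{I,J}` and
`φ_J = φ_I ∘ g_{I,J}` on `Ũ_{J,I}`. -/
def IsGluing (g : Transitions k m) (G : Z2nRingedSpace n) : Prop :=
  ∃ (W : KIndex k m → Opens G) (φ : ∀ I, chart k m ≅ G.restrict (W I)),
    (∀ x : G, ∃ I, x ∈ W I) ∧
    (∀ I J (x : chart k m),
      ((φ I).hom ≫ G.incl (W I)).toHom.hom.base x ∈ W J ↔ x ∈ overlap I J) ∧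
    ∀ I J, (chart k m).incl (overlap J I) ≫ (φ J).hom ≫ G.incl (W J) =
      g I J ≫ (chart k m).incl (overlap I J) ≫ (φ I).hom ≫ G.incl (W I)

end Grassmannian

end

/-! The proof rests on the description of morphisms into a superdomain. A morphism from an open
subspace of a superdomain to `ℝ^d` amounts to one section of degree `γ` for each coordinate of
degree `γ`; it acts by substituting these sections for the coordinates.

Existence is Taylor expansion. A degree-zero section is its body plus a formal part of positive
order, so the Taylor series of a smooth function at the body, evaluated on the formal part,
converges in the filtration `Fil` by order. Homogeneous elements multiply like the formal variables
(`mono_mul_mono`, `mono_eq_zero`), so substitution is multiplicative (`subst_mul`).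

Uniqueness is Hadamard's lemma. Every section is a constant plus a combination of the coordinates
centred at a point. Two homomorphisms that agree on coordinates therefore agree modulo `Fil N` for
every `N` (`algHom_ext_of_coordSec`), and the filtration is separated. Locality on stalks forces the
continuous map to be the body of the pulled-back coordinates (`body_coordsAt`).

A square matrix of sections is invertible once its real values are: the matrix of underlying
functions is inverted by its determinant, and the correction is a geometric series
(`isUnit_matrix_smoothSeries`). The inverse of a degree-zero block matrix again has degree zero
(`IsHomogMatrix.inverse`). So the entries of `(M_I A_J)⁻¹ A_J` are admissible pullbacks of the
coordinates of `U_I`, and the pasting equation has exactly one solution.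

For the cocycle law, put `B = (M_J A_I)⁻¹ A_I`. Its columns in `J` form the identity, so
substituting its entries for the coordinates of `U_J` turns the label `A_J` into `B`. Hence `(M_K
A_J)⁻¹ A_J` becomes `(M_K B)⁻¹ B = (M_K A_I)⁻¹ A_I`, by cancellation in a noncommutative ring
(`subst_trans`). The statements on `g_{I,I}`, inverses and triple overlaps are instances of this.

The space `G` is a quotient of the disjoint union of the charts, with compatible families of series
as sections. It is Hausdorff because the graph of each coordinate change is the closed set `M_J
A_I(x) · A_J(y) = A_I(x)` of real matrices: the columns in `I` of this equation already force `M_J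
A_I(x)` to be invertible. -/

open CategoryTheory TopologicalSpace Opposite AlgebraicGeometry
open scoped ContDiff

noncomputable section

variable {n : ℕ}

/-! ### Hadamard's lemma -/

section analysis

/-- Integration over a parameter in `[0, 1]` preserves smoothness. -/
theorem contDiff_intervalIntegral_param {E : Type} [NormedAddCommGroup E] [NormedSpace ℝ E]
    [FiniteDimensional ℝ E] (r : ℕ) : ∀ {F : Type} [NormedAddCommGroup F] [NormedSpace ℝ F]
    [CompleteSpace F] (G : ℝ × E → F), ContDiff ℝ ∞ G →
    ContDiff ℝ r fun z => ∫ t in (0 : ℝ)..1, G (t, z) := by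
  induction r with
  | zero =>
    intro F _ _ _ G hG
    have h : Continuous (Function.uncurry fun (z : E) (t : ℝ) => G (t, z)) :=
      hG.continuous.comp continuous_swap
    exact contDiff_zero.mpr
      (intervalIntegral.continuous_parametric_intervalIntegral_of_continuous' h 0 1)
  | succ r ih =>
    intro F _ _ _ G hG
    -- The derivative of the integral is the integral of the partial derivative, whose values lie in
    -- `E →L[ℝ] F`; the target space therefore has to vary in the induction.
    let G' : ℝ × E → E →L[ℝ] F := fun p =>
      (fderiv ℝ G p).comp (ContinuousLinearMap.inr ℝ ℝ E)
    have hG' : ContDiff ℝ ∞ G' :=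
      (hG.fderiv_right (m := ∞) (by simp)).clm_comp contDiff_const
    have hd (t : ℝ) (z : E) : HasFDerivAt (fun z => G (t, z)) (G' (t, z)) z :=
      ((hG.differentiable (by simp)) (t, z)).hasFDerivAt.comp z (hasFDerivAt_prodMk_right t z)
    rw [Nat.cast_succ, contDiff_succ_iff_hasFDerivAt]
    refine ⟨fun z => ∫ t in (0 : ℝ)..1, G' (t, z), ih G' hG', fun z => ?_⟩
    -- Compactness of `[0, 1]` times the closed unit ball gives the constant that dominates the
    -- derivative.
    obtain ⟨C, hC⟩ := ((isCompact_Icc (a := (0 : ℝ)) (b := 1)).prod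
      (isCompact_closedBall z 1)).exists_bound_of_continuousOn hG'.continuous.continuousOn
    refine (intervalIntegral.hasFDerivAt_integral_of_dominated_of_fderiv_le (𝕜 := ℝ)
      (F := fun z t => G (t, z)) (F' := fun z t => G' (t, z)) (bound := fun _ => C)
      (s := Metric.ball z 1) (Metric.ball_mem_nhds z one_pos)
      (Filter.Eventually.of_forall fun w => ?_) ?_ ?_ ?_ ?_ ?_)
    · exact (hG.continuous.comp (by fun_prop)).aestronglyMeasurable
    · exact (hG.continuous.comp (by fun_prop)).intervalIntegrable _ _
    · exact (hG'.continuous.comp (by fun_prop)).aestronglyMeasurable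
    · refine Filter.Eventually.of_forall fun t ht w hw => hC (t, w) ⟨?_, Metric.ball_subset_closedBall hw⟩
      rw [Set.uIoc_of_le zero_le_one] at ht
      exact ⟨ht.1.le, ht.2⟩
    · exact intervalIntegrable_const
    · exact Filter.Eventually.of_forall fun t _ w _ => hd t w

theorem fin_pi_eq_sum_single {N : ℕ} (v : Fin N → ℝ) : v = ∑ i, v i • (Pi.single i 1 : Fin N → ℝ) := by
  ext j
  simp [Finset.sum_apply, Pi.single_apply]

/-- Hadamard's lemma for smooth functions on `ℝ^N`. -/
theorem hadamard_global {N : ℕ} {g : (Fin N → ℝ) → ℝ} (hg : ContDiff ℝ ∞ g) (y : Fin N → ℝ) :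
    ∃ h : Fin N → (Fin N → ℝ) → ℝ, (∀ i, ContDiff ℝ ∞ (h i)) ∧
      ∀ z, g z = g y + ∑ i, (z i - y i) * h i z := by
  have hsm (i : Fin N) : ContDiff ℝ ∞ fun p : ℝ × (Fin N → ℝ) =>
      fderiv ℝ g (y + p.1 • (p.2 - y)) (Pi.single i 1) :=
    ((hg.fderiv_right (m := ∞) (by simp)).comp (by fun_prop)).clm_apply contDiff_const
  -- The witnesses come from integrating the derivative of `g` along the segment from `y` to `z` and
  -- splitting `z - y` into coordinates.
  refine ⟨fun i z => ∫ t in (0 : ℝ)..1, fderiv ℝ g (y + t • (z - y)) (Pi.single i 1), fun i => ?_,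
    fun z => ?_⟩
  · exact contDiff_infty.mpr fun r => contDiff_intervalIntegral_param r _ (hsm i)
  · have hder : ∀ t : ℝ, HasDerivAt (fun t : ℝ => g (y + t • (z - y)))
        (fderiv ℝ g (y + t • (z - y)) (z - y)) t := by
      intro t
      have h1 : HasDerivAt (fun t : ℝ => y + t • (z - y)) (z - y) t := by
        simpa using ((hasDerivAt_id t).smul_const (z - y)).const_add y
      exact ((hg.differentiable (by simp)) _).hasFDerivAt.comp_hasDerivAt t h1
    have hcont : Continuous fun t : ℝ => fderiv ℝ g (y + t • (z - y)) (z - y) :=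
      ((hg.continuous_fderiv (by simp)).comp (by fun_prop)).clm_apply continuous_const
    have hint := intervalIntegral.integral_eq_sub_of_hasDerivAt (a := 0) (b := 1)
      (fun t _ => hder t) (hcont.intervalIntegrable _ _)
    have hsum : ∀ t : ℝ, fderiv ℝ g (y + t • (z - y)) (z - y) =
        ∑ i, (z i - y i) * fderiv ℝ g (y + t • (z - y)) (Pi.single i 1) := by
      intro t
      refine (congrArg (fderiv ℝ g (y + t • (z - y))) (fin_pi_eq_sum_single (z - y))).trans ?_
      simp only [map_sum, map_smul, Pi.sub_apply, smul_eq_mul]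
    simp only [hsum] at hint
    rw [intervalIntegral.integral_finsetSum] at hint
    · simp only [intervalIntegral.integral_const_mul] at hint
      rw [hint]
      simp
    · intro i _
      exact (continuous_const.mul
        ((hsm i).continuous.comp (by fun_prop : Continuous fun t : ℝ => (t, z)))).intervalIntegrable _ _

/-- Hadamard's lemma on an open subset of `ℝ^N`. -/
theorem hadamard {N : ℕ} {W : Set (Fin N → ℝ)} (hW : IsOpen W) {f : (Fin N → ℝ) → ℝ}
    (hf : ContDiffOn ℝ ∞ f W) {y : Fin N → ℝ} (hy : y ∈ W) :
    ∃ h : Fin N → (Fin N → ℝ) → ℝ, (∀ i, ContDiffOn ℝ ∞ (h i) W) ∧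
      ∀ z ∈ W, f z = f y + ∑ i, (z i - y i) * h i z := by
  obtain ⟨ε, hε, hball⟩ := Metric.isOpen_iff.mp hW y hy
  -- `W` need not be star-shaped about `y`. The cut-off `χ * f` extends smoothly to all of `ℝ^N` and
  -- is covered by the global lemma; the outer radius `ε / 2` keeps the support inside `W`.
  let χ : ContDiffBump y := ⟨ε / 4, ε / 2, by positivity, by linarith⟩
  have hχ : ContDiff ℝ ∞ χ := χ.contDiff
  have hsupp : tsupport χ ⊆ W := by
    rw [χ.tsupport_eq]
    exact (Metric.closedBall_subset_ball (by change ε / 2 < ε; linarith)).trans hball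
  have hg : ContDiff ℝ ∞ fun z => χ z * f z := by
    rw [contDiff_iff_contDiffAt]
    intro z
    by_cases hz : z ∈ W
    · exact hχ.contDiffAt.mul (hf.contDiffAt (hW.mem_nhds hz))
    · have h0 : (fun z => χ z * f z) =ᶠ[nhds z] fun _ => 0 := by
        filter_upwards [(isClosed_tsupport χ).isOpen_compl.mem_nhds fun h => hz (hsupp h)] with w hw
        rw [image_eq_zero_of_notMem_tsupport hw, zero_mul]
      exact contDiffAt_const.congr_of_eventuallyEq h0
  obtain ⟨h, hh, heq⟩ := hadamard_global hg y
  -- The remainder `(1 - χ) f` vanishes near `y`. Writing it as `∑ (z i - y i) · (1 - χ) f (z i - y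
  -- i) / Q` with `Q = |z - y|²` gives smooth coefficients.
  let Q : (Fin N → ℝ) → ℝ := fun z => ∑ j, (z j - y j) ^ 2
  have hQ0 : ∀ z, z ≠ y → Q z ≠ 0 := by
    intro z hz h0
    refine hz (funext fun j => ?_)
    have := (Finset.sum_eq_zero_iff_of_nonneg fun j _ => sq_nonneg (z j - y j)).mp h0 j
      (Finset.mem_univ j)
    exact sub_eq_zero.mp (pow_eq_zero_iff two_ne_zero |>.mp this)
  refine ⟨fun i z => h i z + (1 - χ z) * f z * (z i - y i) / Q z, fun i => ?_, fun z hz => ?_⟩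
  · refine (hh i).contDiffOn.add fun z hz => ContDiffAt.contDiffWithinAt ?_
    by_cases hzy : z = y
    · subst hzy
      refine (contDiffAt_const (c := (0 : ℝ))).congr_of_eventuallyEq ?_
      filter_upwards [χ.eventuallyEq_one] with w hw
      rw [hw]
      simp
    · refine ContDiffAt.div ?_ (ContDiff.contDiffAt (by fun_prop)) (hQ0 z hzy)
      exact ((contDiffAt_const.sub hχ.contDiffAt).mul (hf.contDiffAt (hW.mem_nhds hz))).mul
        (ContDiff.contDiffAt (by fun_prop))
  · have h1 := heq z
    rw [χ.one_of_mem_closedBall (Metric.mem_closedBall_self χ.rIn_pos.le), one_mul] at h1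
    have h2 : ∑ i, (z i - y i) * ((1 - χ z) * f z * (z i - y i) / Q z) = (1 - χ z) * f z := by
      by_cases hzy : z = y
      · subst hzy
        rw [χ.one_of_mem_closedBall (Metric.mem_closedBall_self χ.rIn_pos.le)]
        simp
      · have : ∀ i, (z i - y i) * ((1 - χ z) * f z * (z i - y i) / Q z) =
            ((1 - χ z) * f z / Q z) * (z i - y i) ^ 2 := fun i => by ring
        rw [Finset.sum_congr rfl fun i _ => this i, ← Finset.mul_sum]
        exact div_mul_cancel₀ _ (hQ0 z hzy)
    simp only [mul_add, Finset.sum_add_distrib]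
    rw [h2]
    linear_combination h1

end analysis

/-! ### Signs and degrees -/

namespace Z2n

theorem sign_mul_self (e : ZMod 2) : sign e * sign e = 1 := by
  have h2 : ∀ a : ZMod 2, a + a = 0 := by decide
  rw [← sign_add, h2, sign_zero]

theorem pairing_zero_left (a : Z2n n) : pairing 0 a = 0 :=
  Finset.sum_eq_zero fun i _ => zero_mul (a i)

theorem pairing_nsmul_left (r : ℕ) (a b : Z2n n) : pairing (r • a) b = (r : ZMod 2) * pairing a b := by
  induction r with
  | zero => simp [pairing_zero_left]
  | succ r ih => rw [succ_nsmul, pairing_add_left, ih]; push_cast; ring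

theorem pairing_nsmul_right (r : ℕ) (a b : Z2n n) : pairing a (r • b) = (r : ZMod 2) * pairing a b := by
  rw [pairing_comm, pairing_nsmul_left, pairing_comm]

theorem add_self (a : Z2n n) : a + a = 0 := by
  have h2 : ∀ a : ZMod 2, a + a = 0 := by decide
  exact funext fun i => h2 (a i)

end Z2n

/-! ### Homogeneous series, the filtration by order, and monomials -/

namespace PSeries

variable {d d' : Z2n n → ℕ}

section homogeneous

theorem isHomog_zero (γ : Z2n n) : IsHomog γ (0 : PSeries d) := fun _ h => absurd (map_zero _) h

theorem isHomog_one : IsHomog 0 (1 : PSeries d) := by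
  classical
  intro α h
  rw [coeff_one] at h
  rw [by_contra fun h0 => h (if_neg h0), monoDeg_zero]

theorem IsHomog.add {γ : Z2n n} {f g : PSeries d} (hf : IsHomog γ f) (hg : IsHomog γ g) :
    IsHomog γ (f + g) := fun α h => by
  by_contra hne
  have h1 : coeff α f = 0 := by_contra fun h0 => hne (hf α h0)
  have h2 : coeff α g = 0 := by_contra fun h0 => hne (hg α h0)
  exact h (by rw [map_add, h1, h2, add_zero])

theorem IsHomog.smul {γ : Z2n n} {f : PSeries d} (c : ℝ) (hf : IsHomog γ f) : IsHomog γ (c • f) :=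
  fun α h => hf α fun h0 => h (by rw [map_smul, h0, smul_zero])

theorem IsHomog.sub {γ : Z2n n} {f g : PSeries d} (hf : IsHomog γ f) (hg : IsHomog γ g) :
    IsHomog γ (f - g) := by
  rw [sub_eq_add_neg, ← neg_one_smul ℝ g]
  exact hf.add (hg.smul _)

theorem isHomog_sum {γ : Z2n n} {ι : Type} (t : Finset ι) (f : ι → PSeries d)
    (h : ∀ i ∈ t, IsHomog γ (f i)) : IsHomog γ (∑ i ∈ t, f i) :=
  Finset.sum_induction f (IsHomog γ) (fun _ _ => IsHomog.add) (isHomog_zero γ) h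

theorem isHomog_algebraMap (c : ℝ) : IsHomog 0 (algebraMap ℝ (PSeries d) c) := by
  rw [Algebra.algebraMap_eq_smul_one]
  exact isHomog_one.smul c

theorem isHomog_pow {γ : Z2n n} {f : PSeries d} (hf : IsHomog γ f) (r : ℕ) :
    IsHomog (r • γ) (f ^ r) := by
  induction r with
  | zero => simpa using isHomog_one
  | succ r ih => rw [pow_succ, succ_nsmul]; exact isHomog_mul ih hf

theorem coeff_zero_of_isHomog {γ : Z2n n} {f : PSeries d} (hf : IsHomog γ f) (hγ : γ ≠ 0) :
    coeff 0 f = 0 := by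
  by_contra h
  exact hγ ((hf 0 h).symm.trans monoDeg_zero)

/-- The homogeneous component of degree `γ`. -/
def proj (γ : Z2n n) : PSeries d →ₗ[ℝ] PSeries d where
  toFun f := mk fun α => if monoDeg α = γ then coeff α f else 0
  map_add' f g := ext' fun α hα => by
    rw [map_add, coeff_mk _ hα, coeff_mk _ hα, coeff_mk _ hα]; split_ifs <;> simp
  map_smul' c f := ext' fun α hα => by
    rw [RingHom.id_apply, map_smul, coeff_mk _ hα, coeff_mk _ hα]; split_ifs <;> simp

theorem coeff_proj (γ : Z2n n) (f : PSeries d) (α : FormalVar d →₀ ℕ) :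
    coeff α (proj γ f) = if monoDeg α = γ then coeff α f else 0 := by
  by_cases hα : Admissible α
  · exact coeff_mk _ hα
  · rw [coeff_of_not _ hα, coeff_of_not _ hα, ite_self]

theorem isHomog_proj (γ : Z2n n) (f : PSeries d) : IsHomog γ (proj γ f) := fun α h => by
  by_contra hne
  exact h (by rw [coeff_proj, if_neg hne])

theorem sum_proj (f : PSeries d) : ∑ γ, proj γ f = f := by
  ext α
  simp [map_sum, coeff_proj]

theorem proj_of_isHomog {γ : Z2n n} {f : PSeries d} (hf : IsHomog γ f) : proj γ f = f := by
  ext α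
  rw [coeff_proj]
  split_ifs with h
  · rfl
  · exact (by_contra fun h0 => h (hf α (Ne.symm h0)))

theorem proj_of_isHomog_ne {γ δ : Z2n n} {f : PSeries d} (hf : IsHomog γ f) (h : γ ≠ δ) :
    proj δ f = 0 := by
  ext α
  rw [coeff_proj, map_zero]
  split_ifs with h1
  · exact by_contra fun h0 => h ((hf α h0).symm.trans h1)
  · rfl

/-- Multiplication by `a` shifts degrees by `γ`, so it permutes the components of `b`. This is what
lets a matrix product be projected entry by entry. -/
theorem proj_mul_left {γ : Z2n n} {a : PSeries d} (ha : IsHomog γ a) (δ : Z2n n) (b : PSeries d) :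
    proj (γ + δ) (a * b) = a * proj δ b := by
  conv_lhs => rw [← sum_proj b, Finset.mul_sum, map_sum]
  rw [Finset.sum_eq_single δ]
  · exact proj_of_isHomog (isHomog_mul ha (isHomog_proj δ b))
  · intro δ' _ hne
    exact proj_of_isHomog_ne (isHomog_mul ha (isHomog_proj δ' b)) fun h => hne (add_left_cancel h)
  · simp

/-- Elements of degree zero are central. -/
theorem commute_of_isHomog_zero {a : PSeries d} (ha : IsHomog 0 a) (b : PSeries d) :
    Commute a b := by
  change a * b = b * a
  rw [← sum_proj b, Finset.mul_sum, Finset.sum_mul]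
  refine Finset.sum_congr rfl fun γ _ => ?_
  rw [isHomog_comm ha (isHomog_proj γ b), Z2n.pairing_zero_left, Z2n.sign_zero, one_smul]

end homogeneous

section filtration

/-- The series all of whose monomials have at least `N` factors. -/
def Fil (d : Z2n n → ℕ) (N : ℕ) : Submodule ℝ (PSeries d) where
  carrier := {f | ∀ α, α.degree < N → coeff α f = 0}
  add_mem' := fun hf hg α h => by rw [map_add, hf α h, hg α h, add_zero]
  zero_mem' := fun _ _ => map_zero _
  smul_mem' := fun c f hf α h => by rw [map_smul, hf α h, smul_zero]

theorem mem_Fil_zero (f : PSeries d) : f ∈ Fil d 0 := fun _ h => absurd h (Nat.not_lt_zero _)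

theorem Fil_antitone {M N : ℕ} (h : M ≤ N) : Fil d N ≤ Fil d M :=
  fun _ hf α hα => hf α (hα.trans_le h)

theorem mul_mem_Fil {M N : ℕ} {f g : PSeries d} (hf : f ∈ Fil d M) (hg : g ∈ Fil d N) :
    f * g ∈ Fil d (M + N) := by
  classical
  intro η hη
  by_cases h : Admissible η
  · rw [coeff_mul _ _ h]
    refine Finset.sum_eq_zero fun p hp => ?_
    rw [Finset.HasAntidiagonal.mem_antidiagonal] at hp
    have h1 : p.1.degree + p.2.degree = η.degree := by rw [← hp, map_add]
    rcases lt_or_ge p.1.degree M with h2 | h2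
    · simp [hf _ h2]
    · simp [hg p.2 (by omega)]
  · exact coeff_of_not _ h

theorem mul_mem_Fil_left {N : ℕ} (f : PSeries d) {g : PSeries d} (hg : g ∈ Fil d N) :
    f * g ∈ Fil d N := by
  simpa using mul_mem_Fil (mem_Fil_zero f) hg

theorem mul_mem_Fil_right {N : ℕ} {f : PSeries d} (hf : f ∈ Fil d N) (g : PSeries d) :
    f * g ∈ Fil d N := mul_mem_Fil hf (mem_Fil_zero g)

theorem pow_mem_Fil {f : PSeries d} (hf : f ∈ Fil d 1) (r : ℕ) : f ^ r ∈ Fil d r := by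
  induction r with
  | zero => exact mem_Fil_zero _
  | succ r ih => rw [pow_succ]; exact mul_mem_Fil ih hf

theorem mem_Fil_one {f : PSeries d} : f ∈ Fil d 1 ↔ coeff 0 f = 0 := by
  refine ⟨fun h => h 0 (by simp), fun h α hα => ?_⟩
  rw [Nat.lt_one_iff, Finsupp.degree_eq_zero_iff] at hα
  rw [hα, h]

/-- The filtration is separated because the coefficient at `α` is already seen in order `α.degree +
1`. Identities between limits are proved below by checking them modulo every `Fil d N`. -/
theorem eq_zero_of_mem_Fil {f : PSeries d} (h : ∀ N, f ∈ Fil d N) : f = 0 := by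
  ext α
  rw [h (α.degree + 1) α (Nat.lt_succ_self _), map_zero]

theorem eq_of_sub_mem_Fil {f g : PSeries d} (h : ∀ N, f - g ∈ Fil d N) : f = g :=
  sub_eq_zero.mp (eq_zero_of_mem_Fil h)

theorem mul_sub_mul_mem_Fil {N : ℕ} {a a' b b' : PSeries d} (ha : a - a' ∈ Fil d N)
    (hb : b - b' ∈ Fil d N) : a * b - a' * b' ∈ Fil d N := by
  have : a * b - a' * b' = (a - a') * b + a' * (b - b') := by noncomm_ring
  rw [this]
  exact (Fil d N).add_mem (mul_mem_Fil_right ha _) (mul_mem_Fil_left _ hb)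

theorem sub_mem_Fil_trans {N : ℕ} {a b c : PSeries d} (h1 : a - b ∈ Fil d N) (h2 : b - c ∈ Fil d N) :
    a - c ∈ Fil d N := by
  simpa using (Fil d N).add_mem h1 h2

theorem sub_mem_Fil_symm {N : ℕ} {a b : PSeries d} (h : a - b ∈ Fil d N) : b - a ∈ Fil d N := by
  simpa using (Fil d N).neg_mem h

/-- The limit of a sequence of series which is Cauchy with respect to the filtration `Fil`. -/
def lim (p : ℕ → PSeries d) : PSeries d := mk fun η => coeff η (p (η.degree + 1))

theorem coeff_lim (p : ℕ → PSeries d) (η : FormalVar d →₀ ℕ) :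
    coeff η (lim p) = coeff η (p (η.degree + 1)) := by
  by_cases h : Admissible η
  · exact coeff_mk _ h
  · rw [coeff_of_not _ h, coeff_of_not _ h]

theorem lim_sub_mem_Fil {p : ℕ → PSeries d} (hp : ∀ N, p (N + 1) - p N ∈ Fil d N) (N : ℕ) :
    lim p - p N ∈ Fil d N := by
  intro η hη
  rw [map_sub, coeff_lim, sub_eq_zero]
  -- The step from `p N` to `p (N + 1)` alters only coefficients of order at least `N`, so the
  -- coefficient at `η` is stationary from index `η.degree + 1` on.
  have key : ∀ r, coeff η (p (η.degree + 1 + r)) = coeff η (p (η.degree + 1)) := by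
    intro r
    induction r with
    | zero => rfl
    | succ r ih =>
      have h := hp (η.degree + 1 + r) η (by omega)
      rw [map_sub, sub_eq_zero] at h
      exact h.trans ih
  obtain ⟨r, rfl⟩ := Nat.exists_eq_add_of_le (Nat.succ_le_of_lt hη)
  exact (key r).symm

theorem isHomog_lim {γ : Z2n n} {p : ℕ → PSeries d} (hp : ∀ N, IsHomog γ (p N)) :
    IsHomog γ (lim p) := fun α h => hp (α.degree + 1) α (by rwa [coeff_lim] at h)

end filtration

section monomials

/-- The sign exponent of the product of two monomials along a list of variables. -/
def crossingList (α β : FormalVar d →₀ ℕ) : List (FormalVar d) → ZMod 2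
  | [] => 0
  | v :: L => (L.map fun u => (α u : ZMod 2) * (β v : ZMod 2) * Z2n.pairing u.1.deg v.1.deg).sum +
      crossingList α β L

/-- The recursive exponent pairs each `v` with the variables after it. In an increasing list these
are the `u` with `v < u`, which are the pairs counted by `crossing`. -/
theorem crossingList_eq (α β : FormalVar d →₀ ℕ) (L : List (FormalVar d)) (hL : L.Pairwise (· < ·)) :
    crossingList α β L = (L.map fun u => (L.map fun v => if v < u then
      (α u : ZMod 2) * (β v : ZMod 2) * Z2n.pairing u.1.deg v.1.deg else 0).sum).sum := by
  induction L with
  | nil => rfl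
  | cons v L ih =>
    rw [List.pairwise_cons] at hL
    rw [crossingList, ih hL.2]
    simp only [List.map_cons, List.sum_cons, lt_self_iff_false, if_false, zero_add]
    have h1 : (L.map fun w => if w < v then
        (α v : ZMod 2) * (β w : ZMod 2) * Z2n.pairing v.1.deg w.1.deg else 0).sum = 0 := by
      refine List.sum_eq_zero fun x hx => ?_
      obtain ⟨w, hw, rfl⟩ := List.mem_map.mp hx
      exact if_neg (hL.1 w hw).asymm
    rw [h1, zero_add, ← List.sum_map_add]
    refine congrArg List.sum (List.map_congr_left fun u hu => ?_)
    rw [if_pos (hL.1 u hu)]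

/-- The product of the powers `s v ^ α v` along a list of variables. -/
def monoList (s : FormalVar d → PSeries d') (α : FormalVar d →₀ ℕ) (L : List (FormalVar d)) :
    PSeries d' := (L.map fun v => s v ^ α v).prod

variable {s : FormalVar d → PSeries d'}

/-- The power of `s v` is moved to the left through one factor at a time, and each exchange
contributes its own sign. -/
theorem monoList_mul_pow (hs : ∀ v, IsHomog v.1.deg (s v)) (α : FormalVar d →₀ ℕ) (v : FormalVar d)
    (r : ℕ) (L : List (FormalVar d)) : monoList s α L * s v ^ r =
      Z2n.sign (L.map fun u => (α u : ZMod 2) * (r : ZMod 2) * Z2n.pairing u.1.deg v.1.deg).sum •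
        (s v ^ r * monoList s α L) := by
  induction L with
  | nil => simp [monoList, Z2n.sign_zero]
  | cons u L ih =>
    have e : monoList s α (u :: L) = s u ^ α u * monoList s α L := by simp [monoList]
    have h1 := isHomog_comm (isHomog_pow (hs u) (α u)) (isHomog_pow (hs v) r)
    rw [Z2n.pairing_nsmul_left, Z2n.pairing_nsmul_right, ← mul_assoc] at h1
    rw [e, mul_assoc, ih, mul_smul_comm, ← mul_assoc, h1, List.map_cons, List.sum_cons,
      Z2n.sign_add, smul_mul_assoc, smul_smul,
      mul_comm (Z2n.sign _), mul_assoc (s v ^ r)]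

theorem monoList_mul (hs : ∀ v, IsHomog v.1.deg (s v)) (α β : FormalVar d →₀ ℕ)
    (L : List (FormalVar d)) : monoList s α L * monoList s β L =
      Z2n.sign (crossingList α β L) • monoList s (α + β) L := by
  induction L with
  | nil => simp [monoList, crossingList, Z2n.sign_zero]
  | cons v L ih =>
    have e : ∀ α, monoList s α (v :: L) = s v ^ α v * monoList s α L := fun α => by simp [monoList]
    rw [e, e, e, crossingList, Z2n.sign_add, mul_assoc, ← mul_assoc (monoList s α L),
      monoList_mul_pow hs, smul_mul_assoc, mul_smul_comm, mul_assoc (s v ^ β v), ih, mul_smul_comm,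
      mul_smul_comm, smul_smul, ← mul_assoc, ← pow_add, Finsupp.add_apply]

/-- The normally ordered monomial `s^α`. -/
def mono (s : FormalVar d → PSeries d') (α : FormalVar d →₀ ℕ) : PSeries d' :=
  monoList s α (Finset.univ.sort (· ≤ ·))

/-- Monomials in arbitrary homogeneous elements of the right degrees obey the rule that defines the
product of series. This is one half of the multiplicativity of substitution; the other is
`mono_eq_zero`. -/
theorem mono_mul_mono (hs : ∀ v, IsHomog v.1.deg (s v)) (α β : FormalVar d →₀ ℕ) :
    mono s α * mono s β = Z2n.sign (crossing α β) • mono s (α + β) := by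
  have hsum : ∀ f : FormalVar d → ZMod 2,
      ((Finset.univ.sort (· ≤ ·)).map f).sum = ∑ v, f v := fun f => by
    rw [← List.sum_toFinset _ (Finset.sort_nodup _ _), Finset.sort_toFinset]
  rw [mono, mono, monoList_mul hs, crossingList_eq _ _ _ (Finset.sortedLT_sort _).pairwise, hsum]
  simp only [hsum]
  rfl

/-- An element of odd degree anticommutes with itself, hence squares to zero over `ℝ`. Inadmissible
exponents can thus be included in sums without changing them. -/
theorem mono_eq_zero (hs : ∀ v, IsHomog v.1.deg (s v)) {α : FormalVar d →₀ ℕ} (h : ¬ Admissible α) :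
    mono s α = 0 := by
  simp only [Admissible, not_forall] at h
  obtain ⟨v, hv, hα⟩ := h
  have h1 : s v * s v = 0 := by
    have h2 := isHomog_comm (hs v) (hs v)
    rw [hv, Z2n.sign, if_neg one_ne_zero, neg_one_smul] at h2
    have h3 : (2 : ℝ) • (s v * s v) = 0 := by
      rw [two_smul]
      nth_rewrite 1 [h2]
      exact neg_add_cancel _
    exact (smul_eq_zero_iff_right two_ne_zero).mp h3
  refine List.prod_eq_zero (List.mem_map.mpr ⟨v, by simp, ?_⟩)
  obtain ⟨r, hr⟩ := Nat.exists_eq_add_of_le (show 2 ≤ α v by omega)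
  rw [hr, pow_add, pow_two, h1, zero_mul]

theorem mono_zero : mono s 0 = 1 := by simp [mono, monoList]

theorem mono_single (v : FormalVar d) : mono s (Finsupp.single v 1) = s v := by
  have key : ∀ L : List (FormalVar d), L.Nodup → v ∈ L →
      monoList s (Finsupp.single v 1) L = s v := by
    have h0 : ∀ L : List (FormalVar d), v ∉ L → monoList s (Finsupp.single v 1) L = 1 := by
      intro L hL
      refine List.prod_eq_one fun x hx => ?_
      obtain ⟨w, hw, rfl⟩ := List.mem_map.mp hx
      rw [Finsupp.single_eq_of_ne (by rintro rfl; exact hL hw), pow_zero]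
    intro L hL hv
    induction L with
    | nil => exact absurd hv List.not_mem_nil
    | cons u L ih =>
      have e : monoList s (Finsupp.single v 1) (u :: L) =
        s u ^ (Finsupp.single v 1 : FormalVar d →₀ ℕ) u * monoList s (Finsupp.single v 1) L := by
        simp [monoList]
      rw [List.nodup_cons] at hL
      rw [e]
      by_cases huv : u = v
      · subst huv
        rw [h0 L hL.1, Finsupp.single_eq_same, pow_one, mul_one]
      · rw [ih hL.2 ((List.mem_cons.mp hv).resolve_left (Ne.symm huv)),
          Finsupp.single_eq_of_ne huv, pow_zero, one_mul]
  exact key _ (Finset.sort_nodup _ _) (by simp)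

theorem isHomog_mono (hs : ∀ v, IsHomog v.1.deg (s v)) (α : FormalVar d →₀ ℕ) :
    IsHomog (monoDeg α) (mono s α) := by
  have key : ∀ L : List (FormalVar d), IsHomog (L.map fun v => α v • v.1.deg).sum (monoList s α L) := by
    intro L
    induction L with
    | nil => simpa [monoList] using isHomog_one
    | cons u L ih => simpa [monoList] using isHomog_mul (isHomog_pow (hs u) (α u)) ih
  have h := key (Finset.univ.sort (· ≤ ·))
  rwa [← List.sum_toFinset _ (Finset.sort_nodup _ _), Finset.sort_toFinset] at h

/-- Each `s v` has non-zero degree, so it has no constant term and lies in `Fil d' 1`. This makes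
infinite sums over exponents converge. -/
theorem mono_mem_Fil (hs : ∀ v, IsHomog v.1.deg (s v)) (α : FormalVar d →₀ ℕ) :
    mono s α ∈ Fil d' α.degree := by
  have key : ∀ L : List (FormalVar d), monoList s α L ∈ Fil d' (L.map fun v => α v).sum := by
    intro L
    induction L with
    | nil => exact mem_Fil_zero _
    | cons u L ih =>
      have hu : s u ∈ Fil d' 1 := mem_Fil_one.mpr (coeff_zero_of_isHomog (hs u) u.2)
      simpa [monoList] using mul_mem_Fil (pow_mem_Fil hu (α u)) ih
  have h := key (Finset.univ.sort (· ≤ ·))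
  rwa [← List.sum_toFinset _ (Finset.sort_nodup _ _), Finset.sort_toFinset,
    ← Finsupp.degree_eq_sum] at h

end monomials

end PSeries

/-! ### Partial derivatives -/

/-- The partial derivative in the direction of the `i`-th coordinate. -/
def partialDeriv {N : ℕ} (i : Fin N) (f : (Fin N → ℝ) → ℝ) : (Fin N → ℝ) → ℝ :=
  fun y => fderiv ℝ f y (Pi.single i 1)

section partialDeriv

variable {N : ℕ} {f g : (Fin N → ℝ) → ℝ} {y : Fin N → ℝ}

theorem contDiffAt_partialDeriv (hf : ContDiffAt ℝ ∞ f y) (i : Fin N) :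
    ContDiffAt ℝ ∞ (partialDeriv i f) y :=
  (hf.fderiv_right (m := ∞) (by simp)).clm_apply contDiffAt_const

theorem contDiffOn_partialDeriv {W : Set (Fin N → ℝ)} (hW : IsOpen W) (hf : ContDiffOn ℝ ∞ f W)
    (i : Fin N) : ContDiffOn ℝ ∞ (partialDeriv i f) W := fun _ hy =>
  (contDiffAt_partialDeriv (hf.contDiffAt (hW.mem_nhds hy)) i).contDiffWithinAt

/-- The conclusion is an equality near `y` and not only at `y`, so that it can be iterated in Taylor
expansions; the rules for sums and products have the same form. -/
theorem partialDeriv_congr (h : f =ᶠ[nhds y] g) (i : Fin N) :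
    partialDeriv i f =ᶠ[nhds y] partialDeriv i g := by
  filter_upwards [h.fderiv (𝕜 := ℝ)] with z hz
  rw [partialDeriv, partialDeriv, hz]

theorem eventually_differentiableAt (hf : ContDiffAt ℝ ∞ f y) :
    ∀ᶠ z in nhds y, DifferentiableAt ℝ f z := by
  filter_upwards [(hf.of_le (m := 1) (by simp)).eventually (by simp)] with z hz
  exact hz.differentiableAt (by simp)

theorem partialDeriv_add (hf : ContDiffAt ℝ ∞ f y) (hg : ContDiffAt ℝ ∞ g y) (i : Fin N) :
    partialDeriv i (fun z => f z + g z) =ᶠ[nhds y] fun z => partialDeriv i f z + partialDeriv i g z := by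
  filter_upwards [eventually_differentiableAt hf, eventually_differentiableAt hg] with z h1 h2
  simp only [partialDeriv]
  rw [fderiv_fun_add h1 h2]
  rfl

theorem partialDeriv_mul (hf : ContDiffAt ℝ ∞ f y) (hg : ContDiffAt ℝ ∞ g y) (i : Fin N) :
    partialDeriv i (fun z => f z * g z) =ᶠ[nhds y]
      fun z => partialDeriv i f z * g z + f z * partialDeriv i g z := by
  filter_upwards [eventually_differentiableAt hf, eventually_differentiableAt hg] with z h1 h2
  simp only [partialDeriv]
  rw [fderiv_fun_mul h1 h2]
  simp
  ring

theorem partialDeriv_const (i : Fin N) (c : ℝ) : partialDeriv i (fun _ => c) = fun _ => 0 := by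
  funext z
  simp [partialDeriv]

theorem partialDeriv_apply (i j : Fin N) :
    partialDeriv i (fun z => z j) = fun _ => if i = j then 1 else 0 := by
  funext z
  have h : HasFDerivAt (fun z : Fin N → ℝ => z j) (ContinuousLinearMap.proj (R := ℝ) j) z :=
    hasFDerivAt_apply j z
  simp [partialDeriv, h.fderiv, Pi.single_apply, eq_comm]

end partialDeriv

/-! ### Taylor expansion and substitution of series for coordinates -/

namespace PSeries

variable {d d' : Z2n n → ℕ}

/-- A family of series to be substituted for the coordinates of `ℝ^d` has the right degrees. -/
def HasDegrees (s : Idx d → PSeries d') : Prop := ∀ a, IsHomog a.deg (s a)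

/-- The point with the coordinates `s`. -/
def body (s : Idx d → PSeries d') : Fin (d 0) → ℝ := fun i => coeff 0 (s ⟨0, i⟩)

/-- The formal part of the coordinate of degree zero with index `i`. -/
def formalPart (s : Idx d → PSeries d') (i : Fin (d 0)) : PSeries d' :=
  s ⟨0, i⟩ - algebraMap ℝ _ (body s i)

theorem coeff_zero_algebraMap (c : ℝ) : coeff 0 (algebraMap ℝ (PSeries d) c) = c := by
  classical
  rw [Algebra.algebraMap_eq_smul_one, map_smul, coeff_one, if_pos rfl, smul_eq_mul, mul_one]

variable {s : Idx d → PSeries d'}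

theorem isHomog_formalPart (hs : HasDegrees s) (i : Fin (d 0)) : IsHomog 0 (formalPart s i) :=
  (hs ⟨0, i⟩).sub (isHomog_algebraMap _)

theorem formalPart_mem_Fil (s : Idx d → PSeries d') (i : Fin (d 0)) : formalPart s i ∈ Fil d' 1 := by
  rw [mem_Fil_one, formalPart, map_sub, coeff_zero_algebraMap]
  exact sub_self _

/-- The term of order `r` of the Taylor expansion of `f` at the point `s`. -/
def taylorTerm (s : Idx d → PSeries d') : ℕ → ((Fin (d 0) → ℝ) → ℝ) → PSeries d'
  | 0, f => algebraMap ℝ _ (f (body s))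
  | r + 1, f => ((r + 1 : ℝ)⁻¹) • ∑ i, formalPart s i * taylorTerm s r (partialDeriv i f)

/-- Euler's identity for the homogeneous part of degree `r + 1`. Defining the terms by this
recursion avoids multi-indices and factorials. -/
theorem succ_smul_taylorTerm (r : ℕ) (f : (Fin (d 0) → ℝ) → ℝ) :
    (r + 1 : ℝ) • taylorTerm s (r + 1) f =
      ∑ i, formalPart s i * taylorTerm s r (partialDeriv i f) := by
  rw [taylorTerm, smul_smul, mul_inv_cancel₀ (by positivity), one_smul]

theorem taylorTerm_congr (r : ℕ) : ∀ {f g : (Fin (d 0) → ℝ) → ℝ}, f =ᶠ[nhds (body s)] g →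
    taylorTerm s r f = taylorTerm s r g := by
  induction r with
  | zero => intro f g h; rw [taylorTerm, taylorTerm, h.eq_of_nhds]
  | succ r ih =>
    intro f g h
    rw [taylorTerm, taylorTerm, Finset.sum_congr rfl fun i _ => by rw [ih (partialDeriv_congr h i)]]

theorem taylorTerm_add (r : ℕ) : ∀ {f g : (Fin (d 0) → ℝ) → ℝ}, ContDiffAt ℝ ∞ f (body s) →
    ContDiffAt ℝ ∞ g (body s) →
    taylorTerm s r (fun z => f z + g z) = taylorTerm s r f + taylorTerm s r g := by
  induction r with
  | zero => intro f g _ _; simp only [taylorTerm, map_add]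
  | succ r ih =>
    intro f g hf hg
    simp only [taylorTerm]
    rw [← smul_add, ← Finset.sum_add_distrib]
    refine congrArg _ (Finset.sum_congr rfl fun i _ => ?_)
    rw [taylorTerm_congr r (partialDeriv_add hf hg i),
      ih (contDiffAt_partialDeriv hf i) (contDiffAt_partialDeriv hg i), mul_add]

theorem taylorTerm_mem_Fil (r : ℕ) (f : (Fin (d 0) → ℝ) → ℝ) : taylorTerm s r f ∈ Fil d' r := by
  induction r generalizing f with
  | zero => exact mem_Fil_zero _
  | succ r ih =>
    refine (Fil d' _).smul_mem _ ((Fil d' _).sum_mem fun i _ => ?_)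
    rw [add_comm]
    exact mul_mem_Fil (formalPart_mem_Fil s i) (ih _)

theorem isHomog_taylorTerm (hs : HasDegrees s) (r : ℕ) (f : (Fin (d 0) → ℝ) → ℝ) :
    IsHomog 0 (taylorTerm s r f) := by
  induction r generalizing f with
  | zero => exact isHomog_algebraMap _
  | succ r ih =>
    refine IsHomog.smul _ (isHomog_sum _ _ fun i _ => ?_)
    simpa using isHomog_mul (isHomog_formalPart hs i) (ih (partialDeriv i f))

/-- Leibniz's rule for Taylor terms. Euler's identity reduces order `r + 1` to order `r` for the
products in `∂ᵢ(f g)`; the formal parts have degree zero, so they are central and can be moved to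
the factor they belong to. -/
theorem taylorTerm_mul (hs : HasDegrees s) (r : ℕ) : ∀ {f g : (Fin (d 0) → ℝ) → ℝ},
    ContDiffAt ℝ ∞ f (body s) → ContDiffAt ℝ ∞ g (body s) → taylorTerm s r (fun z => f z * g z) =
      ∑ p ∈ Finset.HasAntidiagonal.antidiagonal r, taylorTerm s p.1 f * taylorTerm s p.2 g := by
  induction r with
  | zero => intro f g _ _; simp [taylorTerm]
  | succ r ih =>
    intro f g hf hg
    have h0 : (r + 1 : ℝ) ≠ 0 := by positivity
    refine smul_right_injective _ h0 ?_
    change (r + 1 : ℝ) • _ = (r + 1 : ℝ) • _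
    have h1 : (r + 1 : ℝ) • taylorTerm s (r + 1) (fun z => f z * g z) =
        ∑ p ∈ Finset.HasAntidiagonal.antidiagonal r, ((p.1 + 1 : ℝ) • taylorTerm s (p.1 + 1) f * taylorTerm s p.2 g +
          taylorTerm s p.1 f * (p.2 + 1 : ℝ) • taylorTerm s (p.2 + 1) g) := by
      rw [succ_smul_taylorTerm]
      simp only [succ_smul_taylorTerm, Finset.sum_mul, Finset.mul_sum]
      simp only [← Finset.sum_add_distrib]
      rw [Finset.sum_comm]
      refine Finset.sum_congr rfl fun i _ => ?_
      have hf' := contDiffAt_partialDeriv hf i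
      have hg' := contDiffAt_partialDeriv hg i
      rw [taylorTerm_congr r (partialDeriv_mul hf hg i), taylorTerm_add r (hf'.mul hg) (hf.mul hg'),
        ih hf' hg, ih hf hg', ← Finset.sum_add_distrib, Finset.mul_sum]
      refine Finset.sum_congr rfl fun p _ => ?_
      have hc := commute_of_isHomog_zero (isHomog_formalPart hs i) (taylorTerm s p.1 f)
      rw [mul_add, ← mul_assoc, ← mul_assoc, hc.eq, mul_assoc (taylorTerm s p.1 f)]
    -- On the antidiagonal the factor `r + 1` is `p.1 + p.2`. In each of the two sums the term with
    -- weight zero drops out, and a shift of the index gives the corresponding half of `h1`.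
    have h2 : (r + 1 : ℝ) • ∑ p ∈ Finset.HasAntidiagonal.antidiagonal (r + 1), taylorTerm s p.1 f * taylorTerm s p.2 g =
        ∑ p ∈ Finset.HasAntidiagonal.antidiagonal (r + 1), (p.1 : ℝ) • (taylorTerm s p.1 f * taylorTerm s p.2 g) +
        ∑ p ∈ Finset.HasAntidiagonal.antidiagonal (r + 1), (p.2 : ℝ) • (taylorTerm s p.1 f * taylorTerm s p.2 g) := by
      rw [Finset.smul_sum, ← Finset.sum_add_distrib]
      refine Finset.sum_congr rfl fun p hp => ?_
      rw [Finset.HasAntidiagonal.mem_antidiagonal] at hp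
      rw [← add_smul]
      congr 1
      exact_mod_cast hp.symm
    rw [h1, h2, Finset.Nat.sum_antidiagonal_succ, Finset.Nat.sum_antidiagonal_succ',
      Finset.sum_add_distrib]
    simp

theorem taylorTerm_succ_const (r : ℕ) (c : ℝ) : taylorTerm s (r + 1) (fun _ => c) = 0 := by
  induction r generalizing c with
  | zero => simp [taylorTerm, partialDeriv_const]
  | succ r ih => rw [taylorTerm]; simp [partialDeriv_const, ih]

/-- The value of the smooth function `f` at the point `s`, given by Taylor expansion. -/
def evalSmooth (s : Idx d → PSeries d') (f : (Fin (d 0) → ℝ) → ℝ) : PSeries d' :=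
  lim fun N => ∑ r ∈ Finset.range N, taylorTerm s r f

theorem evalSmooth_sub_mem_Fil (f : (Fin (d 0) → ℝ) → ℝ) (N : ℕ) :
    evalSmooth s f - ∑ r ∈ Finset.range N, taylorTerm s r f ∈ Fil d' N := by
  refine lim_sub_mem_Fil (p := fun N => ∑ r ∈ Finset.range N, taylorTerm s r f) (fun N => ?_) N
  simpa [Finset.sum_range_succ] using taylorTerm_mem_Fil N f

theorem evalSmooth_congr {f g : (Fin (d 0) → ℝ) → ℝ} (h : f =ᶠ[nhds (body s)] g) :
    evalSmooth s f = evalSmooth s g := by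
  simp only [evalSmooth, taylorTerm_congr _ h]

theorem evalSmooth_const (c : ℝ) : evalSmooth s (fun _ => c) = algebraMap ℝ _ c := by
  refine eq_of_sub_mem_Fil fun N => ?_
  -- The truncation at `0` is empty; with `N + 1` the term of order zero is present for every `N`.
  have h := evalSmooth_sub_mem_Fil (s := s) (fun _ => c) (N + 1)
  rw [Finset.sum_range_succ'] at h
  simp only [taylorTerm_succ_const, Finset.sum_const_zero, zero_add] at h
  exact Fil_antitone N.le_succ h

theorem evalSmooth_add {f g : (Fin (d 0) → ℝ) → ℝ} (hf : ContDiffAt ℝ ∞ f (body s))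
    (hg : ContDiffAt ℝ ∞ g (body s)) :
    evalSmooth s (fun z => f z + g z) = evalSmooth s f + evalSmooth s g := by
  ext η
  simp only [evalSmooth, coeff_lim, map_add, taylorTerm_add _ hf hg, Finset.sum_add_distrib]

/-- Modulo `Fil d' N` all values may be replaced by Taylor sums of order below `N`. The product of
the two sums exceeds the sum for the product by terms whose orders add up to at least `N`. -/
theorem evalSmooth_mul (hs : HasDegrees s) {f g : (Fin (d 0) → ℝ) → ℝ}
    (hf : ContDiffAt ℝ ∞ f (body s)) (hg : ContDiffAt ℝ ∞ g (body s)) :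
    evalSmooth s (fun z => f z * g z) = evalSmooth s f * evalSmooth s g := by
  refine eq_of_sub_mem_Fil fun N => ?_
  refine sub_mem_Fil_trans (evalSmooth_sub_mem_Fil _ N) (sub_mem_Fil_symm ?_)
  refine sub_mem_Fil_trans (mul_sub_mul_mem_Fil (evalSmooth_sub_mem_Fil f N)
    (evalSmooth_sub_mem_Fil g N)) ?_
  have h1 : ∑ r ∈ Finset.range N, taylorTerm s r (fun z => f z * g z) =
      ∑ a ∈ Finset.range N, ∑ b ∈ Finset.range (N - a), taylorTerm s a f * taylorTerm s b g := by
    rw [← Finset.sum_range_diag_flip N fun a b => taylorTerm s a f * taylorTerm s b g]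
    refine Finset.sum_congr rfl fun r _ => ?_
    rw [taylorTerm_mul hs r hf hg, Finset.Nat.sum_antidiagonal_eq_sum_range_succ
      fun a b => taylorTerm s a f * taylorTerm s b g]
  rw [h1, Finset.sum_mul, ← Finset.sum_sub_distrib]
  refine (Fil d' N).sum_mem fun a ha => ?_
  rw [Finset.mem_range] at ha
  rw [← Finset.mul_sum, ← mul_sub]
  have h2 : ∑ b ∈ Finset.range N, taylorTerm s b g - ∑ b ∈ Finset.range (N - a), taylorTerm s b g ∈
      Fil d' (N - a) := by
    rw [← Finset.sum_range_add_sum_Ico _ (Nat.sub_le N a), add_sub_cancel_left]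
    exact (Fil d' _).sum_mem fun b hb =>
      Fil_antitone (Finset.mem_Ico.mp hb).1 (taylorTerm_mem_Fil b g)
  have h3 := mul_mem_Fil (taylorTerm_mem_Fil (s := s) a f) h2
  rwa [Nat.add_sub_cancel' ha.le] at h3

theorem isHomog_evalSmooth (hs : HasDegrees s) (f : (Fin (d 0) → ℝ) → ℝ) :
    IsHomog 0 (evalSmooth s f) :=
  isHomog_lim fun _ => isHomog_sum _ _ fun r _ => isHomog_taylorTerm hs r f

theorem evalSmooth_apply (i : Fin (d 0)) : evalSmooth s (fun z => z i) = s ⟨0, i⟩ := by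
  refine eq_of_sub_mem_Fil fun N => ?_
  -- A coordinate function has Taylor terms in orders `0` and `1` only, and `N + 2` ensures that
  -- both are present.
  have h := evalSmooth_sub_mem_Fil (s := s) (fun z => z i) (N + 2)
  have h1 : taylorTerm s (0 + 1) (fun z => z i) = formalPart s i := by
    rw [taylorTerm]
    simp only [partialDeriv_apply, taylorTerm]
    simp
  have h2 : ∀ r, taylorTerm s (r + 1 + 1) (fun z => z i) = 0 := by
    intro r
    rw [taylorTerm]
    simp only [partialDeriv_apply, taylorTerm_succ_const]
    simp
  rw [Finset.sum_range_succ', Finset.sum_range_succ'] at h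
  simp only [h1, h2] at h
  simp only [taylorTerm, formalPart, Finset.sum_const_zero, zero_add, sub_add_cancel] at h
  exact Fil_antitone (by omega) h

theorem coeff_zero_evalSmooth (f : (Fin (d 0) → ℝ) → ℝ) :
    coeff 0 (evalSmooth s f) = f (body s) := by
  rw [evalSmooth, coeff_lim]
  simp [taylorTerm, coeff_zero_algebraMap]

theorem evalSmooth_const_mul (hs : HasDegrees s) (c : ℝ) {f : (Fin (d 0) → ℝ) → ℝ}
    (hf : ContDiffAt ℝ ∞ f (body s)) :
    evalSmooth s (fun z => c * f z) = c • evalSmooth s f := by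
  rw [evalSmooth_mul hs contDiffAt_const hf, evalSmooth_const, Algebra.smul_def]

theorem evalSmooth_sum {ι : Type} (t : Finset ι) (f : ι → (Fin (d 0) → ℝ) → ℝ)
    (hf : ∀ i ∈ t, ContDiffAt ℝ ∞ (f i) (body s)) :
    evalSmooth s (fun z => ∑ i ∈ t, f i z) = ∑ i ∈ t, evalSmooth s (f i) := by
  classical
  induction t using Finset.induction_on with
  | empty => simp only [Finset.sum_empty]; rw [evalSmooth_const, map_zero]
  | insert i t hi ih =>
    simp only [Finset.sum_insert hi]
    rw [evalSmooth_add (hf i (Finset.mem_insert_self i t)), ih fun j hj =>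
      hf j (Finset.mem_insert_of_mem hj)]
    exact ContDiffAt.sum fun j hj => hf j (Finset.mem_insert_of_mem hj)

/-- The exponents of degree less than `N`. -/
def degLT (d : Z2n n → ℕ) (N : ℕ) : Finset (FormalVar d →₀ ℕ) :=
  (Finsupp.finite_of_degree_lt N).toFinset

theorem mem_degLT {N : ℕ} {α : FormalVar d →₀ ℕ} : α ∈ degLT d N ↔ α.degree < N := by
  simp [degLT]

/-- The part of order less than `N` of the value of `F` at the point `s`. -/
def substTrunc (s : Idx d → PSeries d') (F : (Fin (d 0) → ℝ) → PSeries d) (N : ℕ) : PSeries d' :=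
  ∑ α ∈ degLT d N, evalSmooth s (fun z => coeff α (F z)) * mono (fun v => s v.1) α

/-- The value at the point `s` of a function `F` with values in formal series, i.e. the result of
substituting `s` for the coordinates. -/
def subst (s : Idx d → PSeries d') (F : (Fin (d 0) → ℝ) → PSeries d) : PSeries d' :=
  lim (substTrunc s F)

/-- All coefficients of `F` are smooth near `y`. -/
def SmoothAt (F : (Fin (d 0) → ℝ) → PSeries d) (y : Fin (d 0) → ℝ) : Prop :=
  ∀ α, ContDiffAt ℝ ∞ (fun z => coeff α (F z)) y

/-- Raising `N` by one adds only terms with `α.degree = N`, and these have order at least `N`; so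
the truncations form a Cauchy sequence. -/
theorem subst_sub_mem_Fil (hs : HasDegrees s) (F : (Fin (d 0) → ℝ) → PSeries d) (N : ℕ) :
    subst s F - substTrunc s F N ∈ Fil d' N := by
  classical
  refine lim_sub_mem_Fil (fun N => ?_) N
  have hsub : degLT d N ⊆ degLT d (N + 1) := fun α h =>
    mem_degLT.mpr ((mem_degLT.mp h).trans (Nat.lt_succ_self N))
  rw [substTrunc, substTrunc, ← Finset.sum_sdiff hsub, add_sub_cancel_right]
  refine (Fil d' N).sum_mem fun α hα => mul_mem_Fil_left _ ?_
  rw [Finset.mem_sdiff, mem_degLT, mem_degLT, not_lt] at hα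
  exact Fil_antitone hα.2 (mono_mem_Fil (fun v => hs v.1) α)

theorem subst_congr {F G : (Fin (d 0) → ℝ) → PSeries d} (h : F =ᶠ[nhds (body s)] G) :
    subst s F = subst s G := by
  have : substTrunc s F = substTrunc s G := funext fun N => Finset.sum_congr rfl fun α _ => by
    rw [evalSmooth_congr (h.mono fun z hz => congrArg (coeff α) hz)]
  rw [subst, this, subst]

theorem subst_add {F G : (Fin (d 0) → ℝ) → PSeries d} (hF : SmoothAt F (body s))
    (hG : SmoothAt G (body s)) : subst s (fun z => F z + G z) = subst s F + subst s G := by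
  have h1 : ∀ N, substTrunc s (fun z => F z + G z) N = substTrunc s F N + substTrunc s G N := by
    intro N
    rw [substTrunc, substTrunc, substTrunc, ← Finset.sum_add_distrib]
    refine Finset.sum_congr rfl fun α _ => ?_
    simp only [map_add]
    rw [evalSmooth_add (hF α) (hG α), add_mul]
  ext η
  simp only [subst, coeff_lim, map_add, h1]

/-- Modulo `Fil d' N` both sides are sums of the same terms `c p` over pairs of exponents of degree
below `N`. The left side keeps the pairs of total degree below `N`; the remaining ones lie in `Fil
d' N`. Values of smooth functions are central, so they can be moved past monomials. -/
theorem subst_mul (hs : HasDegrees s) {F G : (Fin (d 0) → ℝ) → PSeries d}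
    (hF : SmoothAt F (body s)) (hG : SmoothAt G (body s)) :
    subst s (fun z => F z * G z) = subst s F * subst s G := by
  classical
  have hm : ∀ v : FormalVar d, IsHomog v.1.deg (s v.1) := fun v => hs v.1
  refine eq_of_sub_mem_Fil fun N => ?_
  refine sub_mem_Fil_trans (subst_sub_mem_Fil hs _ N) (sub_mem_Fil_symm ?_)
  refine sub_mem_Fil_trans (mul_sub_mul_mem_Fil (subst_sub_mem_Fil hs F N)
    (subst_sub_mem_Fil hs G N)) ?_
  let c : (FormalVar d →₀ ℕ) × (FormalVar d →₀ ℕ) → PSeries d' := fun p =>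
    Z2n.sign (crossing p.1 p.2) • (evalSmooth s (fun z => coeff p.1 (F z)) *
      evalSmooth s (fun z => coeff p.2 (G z)) * mono (fun v => s v.1) (p.1 + p.2))
  have h1 : substTrunc s F N * substTrunc s G N = ∑ p ∈ degLT d N ×ˢ degLT d N, c p := by
    rw [substTrunc, substTrunc, Finset.sum_mul_sum, ← Finset.sum_product']
    refine Finset.sum_congr rfl fun p _ => ?_
    have hc := commute_of_isHomog_zero (isHomog_evalSmooth hs fun z => coeff p.2 (G z))
      (mono (fun v => s v.1) p.1)
    simp only [c]
    rw [← mul_smul_comm, ← mono_mul_mono hm, mul_assoc, ← mul_assoc (mono _ _), ← hc.eq]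
    simp only [mul_assoc]
  have h2 : substTrunc s (fun z => F z * G z) N =
      ∑ p ∈ (degLT d N ×ˢ degLT d N).filter fun p => (p.1 + p.2).degree < N, c p := by
    rw [← Finset.sum_fiberwise_of_maps_to (g := fun p : (FormalVar d →₀ ℕ) × (FormalVar d →₀ ℕ) => p.1 + p.2)
      (t := degLT d N) fun p hp => mem_degLT.mpr (Finset.mem_filter.mp hp).2]
    refine Finset.sum_congr rfl fun η hη => ?_
    rw [mem_degLT] at hη
    have h3 : (((degLT d N ×ˢ degLT d N).filter fun p => (p.1 + p.2).degree < N).filter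
        fun p => p.1 + p.2 = η) = Finset.HasAntidiagonal.antidiagonal η := by
      ext p
      simp only [Finset.mem_filter, Finset.mem_product, mem_degLT,
        Finset.HasAntidiagonal.mem_antidiagonal]
      refine ⟨fun h => h.2, fun h => ⟨?_, h⟩⟩
      rw [h]
      rw [← h, map_add] at hη
      exact ⟨⟨by omega, by omega⟩, by rw [← h, map_add]; exact hη⟩
    rw [h3]
    -- The product formula for coefficients holds at admissible `η` only. At the other exponents
    -- both sides vanish because `s^η = 0`.
    by_cases h : Admissible η
    · simp only [coeff_mul _ _ h]
      rw [evalSmooth_sum _ _ fun p _ => contDiffAt_const.mul ((hF p.1).mul (hG p.2)), Finset.sum_mul]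
      refine Finset.sum_congr rfl fun p hp => ?_
      rw [Finset.HasAntidiagonal.mem_antidiagonal] at hp
      simp only [c]
      rw [evalSmooth_const_mul hs _ ((hF p.1).mul (hG p.2)), evalSmooth_mul hs (hF p.1) (hG p.2),
        smul_mul_assoc, hp]
    · rw [mono_eq_zero hm h, mul_zero]
      refine (Finset.sum_eq_zero fun p hp => ?_).symm
      rw [Finset.HasAntidiagonal.mem_antidiagonal] at hp
      simp only [c]
      rw [hp, mono_eq_zero hm h, mul_zero, smul_zero]
  rw [h1, h2, ← Finset.sum_filter_add_sum_filter_not _ fun p => (p.1 + p.2).degree < N,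
    add_sub_cancel_left]
  refine (Fil d' N).sum_mem fun p hp => (Fil d' N).smul_mem _ (mul_mem_Fil_left _ ?_)
  exact Fil_antitone (not_lt.mp (Finset.mem_filter.mp hp).2) (mono_mem_Fil hm _)

theorem subst_algebraMap (hs : HasDegrees s) (f : (Fin (d 0) → ℝ) → ℝ) :
    subst s (fun z => algebraMap ℝ _ (f z)) = evalSmooth s f := by
  classical
  refine eq_of_sub_mem_Fil fun N => ?_
  refine Fil_antitone N.le_succ (sub_mem_Fil_trans (subst_sub_mem_Fil hs _ (N + 1)) ?_)
  rw [substTrunc, Finset.sum_eq_single 0]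
  · simp [coeff_zero_algebraMap, mono_zero]
  · intro α _ hα
    have : (fun z => coeff α (algebraMap ℝ (PSeries d) (f z))) = fun _ => 0 := by
      funext z
      rw [Algebra.algebraMap_eq_smul_one, map_smul, coeff_one, if_neg hα, smul_zero]
    rw [this, evalSmooth_const, map_zero, zero_mul]
  · intro h
    exact absurd (mem_degLT.mpr (by simp)) h

theorem admissible_single (v : FormalVar d) : Admissible (Finsupp.single v 1) := by
  classical
  intro w _
  rw [Finsupp.single_apply]
  split_ifs <;> simp

theorem coeff_X [DecidableEq (FormalVar d →₀ ℕ)] (v : FormalVar d) (α : FormalVar d →₀ ℕ) :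
    coeff α (X v) = if α = Finsupp.single v 1 then 1 else 0 := by
  by_cases h : Admissible α
  · rw [X, coeff_mk _ h]
    congr
  · rw [coeff_of_not _ h, if_neg]
    rintro rfl
    exact h (admissible_single v)

theorem subst_X (hs : HasDegrees s) (v : FormalVar d) : subst s (fun _ => X v) = s v.1 := by
  classical
  refine eq_of_sub_mem_Fil fun N => ?_
  -- The only monomial has degree one, and `N + 2` puts it into the truncation even for `N = 0`.
  refine Fil_antitone (show N ≤ N + 2 by omega)
    (sub_mem_Fil_trans (subst_sub_mem_Fil hs _ (N + 2)) ?_)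
  rw [substTrunc, Finset.sum_eq_single (Finsupp.single v 1)]
  · simp [coeff_X, evalSmooth_const, mono_single (s := fun v : FormalVar d => s v.1)]
  · intro α _ hα
    simp [coeff_X, hα, evalSmooth_const]
  · intro h
    exact absurd (mem_degLT.mpr (by simp)) h

theorem subst_coordAt (hs : HasDegrees s) (a : Idx d) : subst s (coordAt a) = s a := by
  obtain ⟨γ, j⟩ := a
  by_cases h : γ = 0
  · subst h
    have : coordAt (⟨0, j⟩ : Idx d) = fun x => algebraMap ℝ _ (x j) := by
      funext x
      simp [coordAt]
    rw [this, subst_algebraMap hs fun x => x j, evalSmooth_apply]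
  · have : coordAt (⟨γ, j⟩ : Idx d) = fun _ => X ⟨⟨γ, j⟩, h⟩ := by
      funext x
      simp [coordAt, h]
    rw [this, subst_X hs]

/-- Only the zero exponent and the Taylor term of order zero contribute to the constant coefficient,
so bodies of substituted series are computed by evaluation at a point. -/
theorem coeff_zero_subst (F : (Fin (d 0) → ℝ) → PSeries d) :
    coeff 0 (subst s F) = coeff 0 (F (body s)) := by
  have h : degLT d 1 = {0} := by
    ext α
    simp [mem_degLT, Finsupp.degree_eq_zero_iff]
  rw [subst, coeff_lim]
  simp [substTrunc, h, mono_zero, coeff_zero_evalSmooth]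

theorem isHomog_subst (hs : HasDegrees s) {γ : Z2n n} {F : (Fin (d 0) → ℝ) → PSeries d}
    (hF : ∀ᶠ z in nhds (body s), IsHomog γ (F z)) : IsHomog γ (subst s F) := by
  refine isHomog_lim fun N => isHomog_sum _ _ fun α _ => ?_
  by_cases h : monoDeg α = γ
  · simpa [h] using isHomog_mul (isHomog_evalSmooth hs fun z => coeff α (F z))
      (isHomog_mono (fun v : FormalVar d => hs v.1) α)
  · have h1 : (fun z => coeff α (F z)) =ᶠ[nhds (body s)] fun _ => 0 := by
      filter_upwards [hF] with z hz
      exact by_contra fun h0 => h (hz α h0)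
    rw [evalSmooth_congr h1, evalSmooth_const, map_zero, zero_mul]
    exact isHomog_zero γ

/-! ### Smooth dependence of substitution on parameters -/

section smoothness

variable {U : Opens (Fin (d' 0) → ℝ)} {W : Opens (Fin (d 0) → ℝ)} {s : U → Idx d → PSeries d'}

theorem smoothOn_comp {c : U → Fin (d 0) → ℝ} (hc : ∀ i, SmoothOn fun x => c x i)
    (hW : ∀ x, c x ∈ W) {f : (Fin (d 0) → ℝ) → ℝ} (hf : ContDiffOn ℝ ∞ f W) :
    SmoothOn fun x => f (c x) := by
  have he : ∀ x : U, (fun i => Function.extend Subtype.val (fun x => c x i) 0 (x : Fin (d' 0) → ℝ)) =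
      c x := fun x => funext fun i => SmoothOn.extend_apply (fun x => c x i) x
  refine SmoothOn.of_eq (fun x => f fun i => Function.extend Subtype.val (fun x => c x i) 0 x) ?_
    fun x => by rw [he]
  exact hf.comp (contDiffOn_pi.mpr fun i => hc i) fun x hx => by
    have h := hW ⟨x, hx⟩
    rwa [← he ⟨x, hx⟩] at h

theorem algebraMap_mem_smoothSeries {c : U → ℝ} (hc : SmoothOn c) :
    (fun x => algebraMap ℝ (PSeries d') (c x)) ∈ smoothSeries d' U := fun α => by
  simp only [Algebra.algebraMap_eq_smul_one, map_smul, smul_eq_mul]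
  exact hc.mul (SmoothOn.const _)

theorem taylorTerm_mem_smoothSeries (hs : ∀ a, (fun x => s x a) ∈ smoothSeries d' U)
    (hW : ∀ x, body (s x) ∈ W) (r : ℕ) {f : (Fin (d 0) → ℝ) → ℝ} (hf : ContDiffOn ℝ ∞ f W) :
    (fun x => taylorTerm (s x) r f) ∈ smoothSeries d' U := by
  have hb : ∀ i, SmoothOn fun x => body (s x) i := fun i => hs ⟨0, i⟩ 0
  induction r generalizing f with
  | zero => exact algebraMap_mem_smoothSeries (smoothOn_comp hb hW hf)
  | succ r ih =>
    have h : (∑ i, (fun x => formalPart (s x) i) * fun x => taylorTerm (s x) r (partialDeriv i f)) ∈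
        smoothSeries d' U := (smoothSeries d' U).sum_mem fun i _ => (smoothSeries d' U).mul_mem
      ((smoothSeries d' U).sub_mem (hs ⟨0, i⟩) (algebraMap_mem_smoothSeries (hb i)))
      (ih (contDiffOn_partialDeriv W.isOpen hf i))
    have h2 := (smoothSeries d' U).smul_mem h ((r + 1 : ℝ)⁻¹)
    convert h2 using 1
    funext x
    simp [taylorTerm]

theorem lim_mem_smoothSeries {p : U → ℕ → PSeries d'}
    (hp : ∀ N, (fun x => p x N) ∈ smoothSeries d' U) : (fun x => lim (p x)) ∈ smoothSeries d' U :=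
  fun α => by simpa only [coeff_lim] using hp (α.degree + 1) α

theorem sum_mem_smoothSeries {ι : Type} (t : Finset ι) {p : ι → U → PSeries d'}
    (hp : ∀ i ∈ t, p i ∈ smoothSeries d' U) : (fun x => ∑ i ∈ t, p i x) ∈ smoothSeries d' U := by
  have := (smoothSeries d' U).sum_mem hp
  convert this using 1
  funext x
  simp

theorem monoList_mem_smoothSeries (hs : ∀ a, (fun x => s x a) ∈ smoothSeries d' U)
    (α : FormalVar d →₀ ℕ) (L : List (FormalVar d)) :
    (fun x => monoList (fun v => s x v.1) α L) ∈ smoothSeries d' U := by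
  induction L with
  | nil => exact (smoothSeries d' U).one_mem
  | cons v L ih =>
    have h := (smoothSeries d' U).mul_mem ((smoothSeries d' U).pow_mem (hs v.1) (α v)) ih
    convert h using 1
    funext x
    simp [monoList]

/-- The result of substitution depends smoothly on parameters. -/
theorem subst_mem_smoothSeries (hs : ∀ a, (fun x => s x a) ∈ smoothSeries d' U)
    (hW : ∀ x, body (s x) ∈ W) {F : (Fin (d 0) → ℝ) → PSeries d}
    (hF : ∀ α, ContDiffOn ℝ ∞ (fun z => coeff α (F z)) W) :
    (fun x => subst (s x) F) ∈ smoothSeries d' U :=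
  lim_mem_smoothSeries fun _ => sum_mem_smoothSeries _ fun α _ => (smoothSeries d' U).mul_mem
    (lim_mem_smoothSeries fun _ => sum_mem_smoothSeries _ fun r _ =>
      taylorTerm_mem_smoothSeries hs hW r (hF α)) (monoList_mem_smoothSeries hs α _)

end smoothness

end PSeries

/-! ### Division by coordinates, and homomorphisms determined on coordinates -/

namespace PSeries

variable {d d' : Z2n n → ℕ}

theorem coeff_X_mul (v : FormalVar d) (g : PSeries d) {η : FormalVar d →₀ ℕ} (h : Admissible η) :
    coeff η (X v * g) = if Finsupp.single v 1 ≤ η then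
      Z2n.sign (crossing (Finsupp.single v 1) (η - Finsupp.single v 1)) *
        coeff (η - Finsupp.single v 1) g else 0 := by
  classical
  rw [coeff_mul _ _ h]
  split_ifs with hv
  · rw [Finset.sum_eq_single (Finsupp.single v 1, η - Finsupp.single v 1)]
    · simp [coeff_X]
    · rintro ⟨a, b⟩ hp hne
      rw [Finset.HasAntidiagonal.mem_antidiagonal] at hp
      have : a ≠ Finsupp.single v 1 := by
        rintro rfl
        exact hne (by rw [← hp, add_tsub_cancel_left])
      simp [coeff_X, this]
    · intro hn
      exact absurd (Finset.HasAntidiagonal.mem_antidiagonal.mpr (add_tsub_cancel_of_le hv)) hn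
  · refine Finset.sum_eq_zero fun p hp => ?_
    rw [Finset.HasAntidiagonal.mem_antidiagonal] at hp
    have : p.1 ≠ Finsupp.single v 1 := fun h0 => hv (by rw [← h0, ← hp]; exact le_self_add)
    simp [coeff_X, this]

open Classical in
/-- The left quotient by `X v` of the part of a series which consists of the monomials whose first
variable is `v`. -/
def leftQuot (v : FormalVar d) (f : PSeries d) : PSeries d := mk fun β =>
  if (β + Finsupp.single v 1).support.min = (v : WithTop (FormalVar d)) then
    Z2n.sign (crossing (Finsupp.single v 1) β) * coeff (β + Finsupp.single v 1) f else 0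

/-- Every non-constant monomial is assigned to its smallest variable, so it is counted once. The
sign in `leftQuot` cancels the sign created by multiplying with `X v` again. -/
theorem eq_sum_X_mul_leftQuot {f : PSeries d} (hf : coeff 0 f = 0) :
    f = ∑ v, X v * leftQuot v f := by
  classical
  refine ext' fun η hη => ?_
  rw [map_sum]
  have h1 : ∀ v, coeff η (X v * leftQuot v f) =
      if η.support.min = (v : WithTop (FormalVar d)) then coeff η f else 0 := by
    intro v
    rw [coeff_X_mul v _ hη]
    by_cases hv : Finsupp.single v 1 ≤ η
    · rw [if_pos hv, leftQuot, coeff_mk _ (hη.mono tsub_le_self), tsub_add_cancel_of_le hv]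
      split_ifs
      · rw [← mul_assoc, Z2n.sign_mul_self, one_mul]
      · rw [mul_zero]
    · rw [if_neg hv, if_neg]
      intro hm
      refine hv ?_
      rw [Finsupp.single_le_iff, Nat.one_le_iff_ne_zero]
      exact Finsupp.mem_support_iff.mp (Finset.mem_of_min hm)
  rw [Finset.sum_congr rfl fun v _ => h1 v]
  by_cases h0 : η = 0
  · subst h0
    simp [hf]
  · obtain ⟨v, hv⟩ := Finset.min_of_nonempty (Finsupp.support_nonempty_iff.mpr h0)
    rw [Finset.sum_eq_single v, if_pos hv]
    · intro w _ hw
      rw [if_neg]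
      rw [hv]
      exact fun h => hw (WithTop.coe_injective h).symm
    · simp

end PSeries

section sections

open PSeries

variable {d d' : Z2n n → ℕ} {W : Opens (Fin (d 0) → ℝ)}

/-- The extension of a section by zero. -/
def extendSec (f : smoothSeries d W) : (Fin (d 0) → ℝ) → PSeries d :=
  Function.extend Subtype.val f.1 0

theorem extendSec_apply (f : smoothSeries d W) (x : W) : extendSec f x = f.1 x :=
  Subtype.val_injective.extend_apply f.1 0 x

theorem extendSec_apply' (f : smoothSeries d W) {x : Fin (d 0) → ℝ} (hx : x ∈ W) :
    extendSec f x = f.1 ⟨x, hx⟩ := extendSec_apply f ⟨x, hx⟩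

theorem contDiffOn_extendSec (f : smoothSeries d W) (α : FormalVar d →₀ ℕ) :
    ContDiffOn ℝ ∞ (fun z => coeff α (extendSec f z)) W :=
  ContDiffOn.congr (f.2 α) fun x hx => by
    rw [extendSec_apply' f hx]
    exact (SmoothOn.extend_apply (fun x => coeff α (f.1 x)) ⟨x, hx⟩).symm

theorem smoothAt_extendSec (f : smoothSeries d W) {y : Fin (d 0) → ℝ} (hy : y ∈ W) :
    SmoothAt (extendSec f) y := fun α =>
  (contDiffOn_extendSec f α).contDiffAt (W.isOpen.mem_nhds hy)

theorem eventuallyEq_extendSec {F : (Fin (d 0) → ℝ) → PSeries d} (f : smoothSeries d W)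
    {y : Fin (d 0) → ℝ} (hy : y ∈ W) (h : ∀ x : W, f.1 x = F x) : extendSec f =ᶠ[nhds y] F := by
  filter_upwards [W.isOpen.mem_nhds hy] with z hz
  rw [extendSec_apply' f hz, h]

/-- Substitution as a homomorphism on sections defined near the body of `s`. -/
def substHom (s : Idx d → PSeries d') (hs : HasDegrees s) (hW : body s ∈ W) :
    smoothSeries d W →ₐ[ℝ] PSeries d' where
  toFun f := subst s (extendSec f)
  map_one' := by
    rw [subst_congr (eventuallyEq_extendSec (F := fun _ => algebraMap ℝ _ 1) 1 hW
      fun x => (map_one _).symm), subst_algebraMap hs fun _ => 1, evalSmooth_const, map_one]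
  map_zero' := by
    rw [subst_congr (eventuallyEq_extendSec (F := fun _ => algebraMap ℝ _ 0) 0 hW
      fun x => (map_zero _).symm), subst_algebraMap hs fun _ => 0, evalSmooth_const, map_zero]
  map_mul' f g := by
    rw [← subst_mul hs (smoothAt_extendSec f hW) (smoothAt_extendSec g hW)]
    refine subst_congr (eventuallyEq_extendSec _ hW fun x => ?_)
    rw [extendSec_apply, extendSec_apply]
    rfl
  map_add' f g := by
    rw [← subst_add (smoothAt_extendSec f hW) (smoothAt_extendSec g hW)]
    refine subst_congr (eventuallyEq_extendSec _ hW fun x => ?_)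
    rw [extendSec_apply, extendSec_apply]
    rfl
  commutes' c := by
    rw [subst_congr (eventuallyEq_extendSec (F := fun _ => algebraMap ℝ _ c) _ hW fun x => rfl),
      subst_algebraMap hs fun _ => c, evalSmooth_const]

/-- The coordinates as sections. -/
def coordSec (a : Idx d) (W : Opens (Fin (d 0) → ℝ)) : smoothSeries d W :=
  ⟨fun x => coordAt a x.1, smoothOn_coordAt a W⟩

theorem substHom_coordSec (s : Idx d → PSeries d') (hs : HasDegrees s) (hW : body s ∈ W) (a : Idx d) :
    substHom s hs hW (coordSec a W) = s a :=
  (subst_congr (eventuallyEq_extendSec _ hW fun _ => rfl)).trans (subst_coordAt hs a)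

theorem coordAt_zero (i : Fin (d 0)) (x : Fin (d 0) → ℝ) :
    coordAt (⟨0, i⟩ : Idx d) x = algebraMap ℝ _ (x i) := by
  simp [coordAt]

theorem coordAt_formal (v : FormalVar d) (x : Fin (d 0) → ℝ) : coordAt v.1 x = X v := by
  simp [coordAt, v.2]

/-- Every section is a constant plus a combination of the coordinates, centred at a given point. -/
theorem exists_coord_decomposition {y : Fin (d 0) → ℝ} (hy : y ∈ W) (f : smoothSeries d W) :
    ∃ (c : ℝ) (h : Fin (d 0) → smoothSeries d W) (k : FormalVar d → smoothSeries d W),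
      f = algebraMap ℝ _ c + ∑ i, (coordSec ⟨0, i⟩ W - algebraMap ℝ _ (y i)) * h i +
        ∑ v : FormalVar d, coordSec v.1 W * k v := by
  obtain ⟨h, hh, heq⟩ := hadamard W.isOpen (contDiffOn_extendSec f 0) hy
  -- Hadamard's lemma treats the body of `f`; the rest of `f` has no constant term and is divided by
  -- the formal variables.
  have hk : ∀ v : FormalVar d, (fun x : W => leftQuot v (f.1 x - algebraMap ℝ _ (coeff 0 (f.1 x)))) ∈
      smoothSeries d W := by
    intro v
    have hg : (fun x : W => f.1 x - algebraMap ℝ _ (coeff 0 (f.1 x))) ∈ smoothSeries d W :=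
      (smoothSeries d W).sub_mem f.2 (algebraMap_mem_smoothSeries (f.2 0))
    intro β
    by_cases hβ : Admissible β
    · simp only [leftQuot, coeff_mk _ hβ]
      split_ifs
      · exact (SmoothOn.const _).mul (hg _)
      · exact SmoothOn.const 0
    · simp only [coeff_of_not _ hβ]
      exact SmoothOn.const 0
  refine ⟨coeff 0 (f.1 ⟨y, hy⟩), fun i => ⟨fun x => algebraMap ℝ _ (h i x),
    algebraMap_mem_smoothSeries (SmoothOn.of_eq _ (hh i) fun _ => rfl)⟩, fun v => ⟨_, hk v⟩,
    Subtype.ext (funext fun x => ?_)⟩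
  have h1 := heq x x.2
  rw [extendSec_apply, extendSec_apply' f hy] at h1
  have h2 : f.1 x - algebraMap ℝ _ (coeff 0 (f.1 x)) =
      ∑ v, X v * leftQuot v (f.1 x - algebraMap ℝ _ (coeff 0 (f.1 x))) :=
    eq_sum_X_mul_leftQuot (by rw [map_sub, coeff_zero_algebraMap, sub_self])
  have h3 : algebraMap ℝ (PSeries d) (coeff 0 (f.1 x)) =
      algebraMap ℝ (PSeries d) (coeff 0 (f.1 ⟨y, hy⟩)) +
        ∑ i, (coordAt (⟨0, i⟩ : Idx d) x - algebraMap ℝ _ (y i)) * algebraMap ℝ _ (h i x) := by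
    rw [h1, map_add, map_sum]
    simp only [coordAt_zero, map_mul, map_sub]
  rw [sub_eq_iff_eq_add'] at h2
  rw [h3] at h2
  refine h2.trans ?_
  simp only [Subalgebra.coe_add, Pi.add_apply, AddSubmonoidClass.coe_finsetSum, Finset.sum_apply]
  refine congrArg₂ _ (congrArg₂ _ rfl (Finset.sum_congr rfl fun i _ => rfl))
    (Finset.sum_congr rfl fun v _ => ?_)
  change _ = coordAt v.1 x.1 * leftQuot v (f.1 x - algebraMap ℝ _ (coeff 0 (f.1 x)))
  rw [coordAt_formal, h3]

/-- A homomorphism on sections is determined by the images of the coordinates. -/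
theorem algHom_ext_of_coordSec {y : Fin (d 0) → ℝ} (hy : y ∈ W)
    {φ ψ : smoothSeries d W →ₐ[ℝ] PSeries d'} (h : ∀ a, φ (coordSec a W) = ψ (coordSec a W))
    (hbody : ∀ i, coeff 0 (φ (coordSec ⟨0, i⟩ W)) = y i)
    (hformal : ∀ v : FormalVar d, coeff 0 (φ (coordSec v.1 W)) = 0) : φ = ψ := by
  -- In the decomposition of `f` the centred coordinates are taken into `Fil d' 1`, where `φ` and
  -- `ψ` agree. Agreement modulo `Fil d' N` on the cofactors thus gives agreement modulo `Fil d' (N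
  -- + 1)` on `f`.
  have key : ∀ N f, φ f - ψ f ∈ Fil d' N := by
    intro N
    induction N with
    | zero => exact fun f => mem_Fil_zero _
    | succ N ih =>
      intro f
      obtain ⟨c, g, k, rfl⟩ := exists_coord_decomposition hy f
      have e : φ (algebraMap ℝ _ c + ∑ i, (coordSec ⟨0, i⟩ W - algebraMap ℝ _ (y i)) * g i +
            ∑ v : FormalVar d, coordSec v.1 W * k v) -
          ψ (algebraMap ℝ _ c + ∑ i, (coordSec ⟨0, i⟩ W - algebraMap ℝ _ (y i)) * g i +
            ∑ v : FormalVar d, coordSec v.1 W * k v) =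
          ∑ i, (φ (coordSec ⟨0, i⟩ W) - algebraMap ℝ _ (y i)) * (φ (g i) - ψ (g i)) +
            ∑ v : FormalVar d, φ (coordSec v.1 W) * (φ (k v) - ψ (k v)) := by
        simp only [map_add, map_sum, map_mul, map_sub, AlgHom.commutes, h, mul_sub,
          Finset.sum_sub_distrib]
        abel
      rw [e, add_comm N]
      refine (Fil d' _).add_mem ((Fil d' _).sum_mem fun i _ => mul_mem_Fil ?_ (ih _))
        ((Fil d' _).sum_mem fun v _ => mul_mem_Fil (mem_Fil_one.mpr (hformal v)) (ih _))
      rw [mem_Fil_one, map_sub, hbody, coeff_zero_algebraMap, sub_self]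
  exact AlgHom.ext fun f => eq_of_sub_mem_Fil fun N => key N f

/-- A homomorphism on sections which takes the coordinates to `s` is substitution of `s`. -/
theorem eq_substHom {s : Idx d → PSeries d'} (hs : HasDegrees s) (hW : body s ∈ W)
    {φ : smoothSeries d W →ₐ[ℝ] PSeries d'} (h : ∀ a, φ (coordSec a W) = s a) :
    φ = substHom s hs hW := by
  refine algHom_ext_of_coordSec hW (fun a => by rw [h, substHom_coordSec]) (fun i => by rw [h]; rfl)
    fun v => ?_
  rw [h]
  exact coeff_zero_of_isHomog (hs v.1) v.2

end sections

/-! ### Invertible sections and matrices of sections -/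

namespace PSeries

variable {d : Z2n n → ℕ}

/-- The value of a series, i.e. its constant coefficient. -/
def value (d : Z2n n → ℕ) : PSeries d →ₐ[ℝ] ℝ :=
  AlgHom.ofLinearMap (coeff 0) (by rw [← map_one (algebraMap ℝ (PSeries d)), coeff_zero_algebraMap])
    fun f g => by
      classical
      rw [coeff_mul _ _ admissible_zero, Finset.HasAntidiagonal.antidiagonal_zero]
      simp [crossing_zero_left, Z2n.sign_zero]

end PSeries

open PSeries

section smoothFunctions

variable {d : Z2n n → ℕ} {N : ℕ}

/-- The algebra of smooth real functions on `U`. -/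
def smoothFun (U : Opens (Fin N → ℝ)) : Subalgebra ℝ (U → ℝ) where
  carrier := {c | SmoothOn c}
  mul_mem' := SmoothOn.mul
  add_mem' := SmoothOn.add
  algebraMap_mem' := SmoothOn.const

theorem isUnit_smoothFun {U : Opens (Fin N → ℝ)} (c : smoothFun U) (h : ∀ x, c.1 x ≠ 0) : IsUnit c := by
  have hs : SmoothOn fun x => (c.1 x)⁻¹ :=
    SmoothOn.of_eq _ (ContDiffOn.inv c.2 fun x hx => by
      rw [SmoothOn.extend_apply c.1 ⟨x, hx⟩]; exact h _) fun x => by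
      rw [Pi.inv_apply, SmoothOn.extend_apply]
  exact ⟨⟨c, ⟨_, hs⟩, Subtype.ext (funext fun x => mul_inv_cancel₀ (h x)),
    Subtype.ext (funext fun x => inv_mul_cancel₀ (h x))⟩, rfl⟩

/-- Smooth functions as sections. -/
def ofSmoothFun (d : Z2n n → ℕ) (U : Opens (Fin (d 0) → ℝ)) : smoothFun U →+* smoothSeries d U where
  toFun c := ⟨fun x => algebraMap ℝ _ (c.1 x), algebraMap_mem_smoothSeries c.2⟩
  map_one' := Subtype.ext (funext fun _ => map_one _)
  map_mul' _ _ := Subtype.ext (funext fun _ => map_mul _ _ _)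
  map_zero' := Subtype.ext (funext fun _ => map_zero _)
  map_add' _ _ := Subtype.ext (funext fun _ => map_add _ _ _)

/-- The underlying smooth function of a section. -/
def toSmoothFun (d : Z2n n → ℕ) (U : Opens (Fin (d 0) → ℝ)) : smoothSeries d U →+* smoothFun U where
  toFun f := ⟨fun x => value d (f.1 x), f.2 0⟩
  map_one' := Subtype.ext (funext fun _ => map_one (value d))
  map_mul' _ _ := Subtype.ext (funext fun _ => map_mul (value d) _ _)
  map_zero' := Subtype.ext (funext fun _ => map_zero (value d))
  map_add' _ _ := Subtype.ext (funext fun _ => map_add (value d) _ _)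

end smoothFunctions

section evaluation

variable {d : Z2n n → ℕ} {U : Opens (Fin (d 0) → ℝ)}

/-- Evaluation of sections at a point. -/
def evalSec (x : U) : smoothSeries d U →ₐ[ℝ] PSeries d :=
  (Pi.evalAlgHom ℝ (fun _ => PSeries d) x).comp (smoothSeries d U).val

theorem evalSec_apply (x : U) (f : smoothSeries d U) : evalSec x f = f.1 x := rfl

variable {ι : Type} [Fintype ι]

theorem mul_entries_mem_Fil {M N : ℕ} {A B : Matrix ι ι (smoothSeries d U)}
    (hA : ∀ r c x, (A r c).1 x ∈ Fil d M) (hB : ∀ r c x, (B r c).1 x ∈ Fil d N) (r c : ι) (x : U) :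
    ((A * B) r c).1 x ∈ Fil d (M + N) := by
  rw [← evalSec_apply, Matrix.mul_apply, map_sum]
  refine (Fil d _).sum_mem fun i _ => ?_
  rw [map_mul]
  exact mul_mem_Fil (hA _ _ _) (hB _ _ _)

variable [DecidableEq ι]

/-- The geometric series. -/
theorem isUnit_one_sub_of_entries_mem_Fil (A : Matrix ι ι (smoothSeries d U))
    (hA : ∀ r c x, (A r c).1 x ∈ Fil d 1) : IsUnit (1 - A) := by
  have hpow : ∀ N r c x, ((A ^ N) r c).1 x ∈ Fil d N := by
    intro N
    induction N with
    | zero => exact fun _ _ _ => mem_Fil_zero _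
    | succ N ih => rw [pow_succ]; exact mul_entries_mem_Fil ih hA
  let S : ℕ → Matrix ι ι (smoothSeries d U) := fun N => ∑ i ∈ Finset.range N, A ^ i
  -- The inverse is the entrywise limit of the partial sums `S N`. It agrees with `S N` modulo `Fil
  -- d N`, where `S N` inverts `1 - A` up to `A ^ N`.
  let Y : Matrix ι ι (smoothSeries d U) := fun r c =>
    ⟨fun x => lim fun N => (S N r c).1 x, lim_mem_smoothSeries fun N => (S N r c).2⟩
  have hY : ∀ N r c x, ((Y - S N) r c).1 x ∈ Fil d N := by
    intro N r c x
    refine lim_sub_mem_Fil (p := fun N => (S N r c).1 x) (fun N => ?_) N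
    have : S (N + 1) r c - S N r c = (A ^ N) r c := by
      simp only [S, Finset.sum_range_succ, Matrix.add_apply, add_sub_cancel_left]
    have h2 := congrArg (evalSec x) this
    rw [map_sub] at h2
    change (S (N + 1) r c).1 x - (S N r c).1 x = _ at h2
    rw [h2]
    exact hpow N r c x
  have hzero : ∀ B : Matrix ι ι (smoothSeries d U), (∀ N r c x, (B r c).1 x ∈ Fil d N) → B = 0 :=
    fun B h => Matrix.ext fun r c => Subtype.ext (funext fun x => eq_zero_of_mem_Fil fun N => h N r c x)
  have h1 : (1 - A) * Y - 1 = 0 := by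
    refine hzero _ fun N r c x => ?_
    have e : (1 - A) * Y - 1 = (1 - A) * (Y - S N) - A ^ N := by
      rw [mul_sub, mul_neg_geom_sum]; abel
    rw [e]
    refine (Fil d N).sub_mem ?_ (hpow N r c x)
    simpa using mul_entries_mem_Fil (M := 0) (fun _ _ _ => mem_Fil_zero _) (hY N) r c x
  have h2 : Y * (1 - A) - 1 = 0 := by
    refine hzero _ fun N r c x => ?_
    have e : Y * (1 - A) - 1 = (Y - S N) * (1 - A) - A ^ N := by
      rw [sub_mul, geom_sum_mul_neg]; abel
    rw [e]
    refine (Fil d N).sub_mem ?_ (hpow N r c x)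
    simpa using mul_entries_mem_Fil (N := 0) (hY N) (fun _ _ _ => mem_Fil_zero _) r c x
  exact ⟨⟨1 - A, Y, sub_eq_zero.mp h1, sub_eq_zero.mp h2⟩, rfl⟩

/-- A matrix of sections is invertible if its values are invertible. -/
theorem isUnit_matrix_smoothSeries (M : Matrix ι ι (smoothSeries d U))
    (h : ∀ x, IsUnit (M.map fun f => coeff 0 (f.1 x))) : IsUnit M := by
  -- Smooth functions form a commutative ring, where the determinant decides invertibility; over the
  -- noncommutative ring of sections it is not available.
  let M0 : Matrix ι ι (smoothFun U) := (toSmoothFun d U).mapMatrix M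
  have hM0 : IsUnit M0 := by
    rw [Matrix.isUnit_iff_isUnit_det]
    refine isUnit_smoothFun _ fun x => ?_
    let ev : smoothFun U →+* ℝ := (Pi.evalRingHom (fun _ => ℝ) x).comp (smoothFun U).val
    have h1 : ev M0.det = (M.map fun f => coeff 0 (f.1 x)).det := by
      rw [RingHom.map_det]
      rfl
    change ev M0.det ≠ 0
    rw [h1]
    exact ((Matrix.isUnit_iff_isUnit_det _).mp (h x)).ne_zero
  obtain ⟨u, hu⟩ := hM0.map (ofSmoothFun d U).mapMatrix
  -- With `u` the lift of the matrix of values, `1 - u⁻¹ (u - M) = u⁻¹ M`, and the entries of `u -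
  -- M` have no constant term.
  have h2 : IsUnit (1 - (u⁻¹).val * (u.val - M)) := by
    refine isUnit_one_sub_of_entries_mem_Fil _ fun r c x => ?_
    refine mul_entries_mem_Fil (M := 0) (N := 1) (fun _ _ _ => mem_Fil_zero _) (fun r c x => ?_) r c x
    rw [hu, mem_Fil_one]
    change coeff 0 (algebraMap ℝ _ (coeff 0 ((M r c).1 x)) - (M r c).1 x) = 0
    rw [map_sub, coeff_zero_algebraMap, sub_self]
  rw [mul_sub, Units.inv_mul, sub_sub_cancel] at h2
  exact (Units.isUnit_units_mul u⁻¹ M).mp h2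

theorem isUnit_smoothSeries (f : smoothSeries d U) (h : ∀ x, coeff 0 (f.1 x) ≠ 0) : IsUnit f := by
  have h1 : IsUnit (Matrix.of fun _ _ : Unit => f) := by
    refine isUnit_matrix_smoothSeries _ fun x => ?_
    rw [Matrix.isUnit_iff_isUnit_det, Matrix.det_unique]
    exact (h x).isUnit
  exact h1.map (Matrix.uniqueRingEquiv (m := Unit) (A := smoothSeries d U))

end evaluation

theorem Ring.map_inverse_of_isUnit {R S : Type} [Ring R] [Ring S] (φ : R →+* S) {a : R} (h : IsUnit a) :
    φ (Ring.inverse a) = Ring.inverse (φ a) := by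
  obtain ⟨u, rfl⟩ := h
  have : φ u = (Units.map (φ : R →* S) u : Sˣ) := rfl
  rw [Ring.inverse_unit, this, Ring.inverse_unit]
  rfl

section homogeneousMatrices

variable {d k m l : Z2n n → ℕ}

/-- A block matrix of degree zero: the entries in the block `(γ', γ'')` have degree `γ' + γ''`. -/
def IsHomogMatrix (A : Matrix (Idx k) (Idx m) (PSeries d)) : Prop :=
  ∀ r c, IsHomog (r.deg + c.deg) (A r c)

theorem degree_add_cancel (a b c : Z2n n) : (a + b) + (b + c) = a + c := by
  rw [add_assoc, ← add_assoc b, Z2n.add_self, zero_add]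

theorem IsHomogMatrix.mul {A : Matrix (Idx k) (Idx m) (PSeries d)}
    {B : Matrix (Idx m) (Idx l) (PSeries d)} (hA : IsHomogMatrix A) (hB : IsHomogMatrix B) :
    IsHomogMatrix (A * B) := fun r c => isHomog_sum _ _ fun i _ => by
  simpa only [degree_add_cancel] using isHomog_mul (hA r i) (hB i c)

/-- As `A` is homogeneous, projecting the entries of its inverse to their prescribed degrees gives a
right inverse again. Inverses are unique, so the projection changes nothing. -/
theorem IsHomogMatrix.inverse {A : Matrix (Idx k) (Idx k) (PSeries d)} (hA : IsHomogMatrix A)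
    (h : IsUnit A) : IsHomogMatrix (Ring.inverse A) := by
  let π : Matrix (Idx k) (Idx k) (PSeries d) → Matrix (Idx k) (Idx k) (PSeries d) :=
    fun B r c => proj (r.deg + c.deg) (B r c)
  have h1 : A * π (Ring.inverse A) = π (A * Ring.inverse A) := by
    refine Matrix.ext fun r c => ?_
    simp only [π, Matrix.mul_apply, map_sum]
    refine Finset.sum_congr rfl fun i _ => ?_
    rw [← proj_mul_left (hA r i), degree_add_cancel]
  have h2 : π 1 = 1 := by
    refine Matrix.ext fun r c => ?_
    refine proj_of_isHomog ?_
    by_cases hrc : r = c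
    · subst hrc
      rw [Matrix.one_apply_eq, Z2n.add_self]
      exact isHomog_one
    · rw [Matrix.one_apply_ne hrc]
      exact isHomog_zero _
  rw [Ring.mul_inverse_cancel A h, h2] at h1
  have h3 : π (Ring.inverse A) = Ring.inverse A := by
    rw [← one_mul (π _), ← Ring.inverse_mul_cancel A h, mul_assoc, h1, mul_one]
  intro r c
  rw [← h3]
  exact isHomog_proj _ _

end homogeneousMatrices

/-! ### Morphisms of ringed spaces and open subspaces -/

namespace Z2nRingedSpace

variable {X Y Z : Z2nRingedSpace n}

theorem res_self {U : Opens X} (h : U ≤ U) (s : X.Sec U) : X.res h s = s := by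
  have : (homOfLE h).op = 𝟙 (op U) := Subsingleton.elim _ _
  rw [res, this, X.presheaf.map_id]
  rfl

theorem res_res {U V W : Opens X} (h : V ≤ U) (h' : W ≤ V) (s : X.Sec U) :
    X.res h' (X.res h s) = X.res (h'.trans h) s := map_map X _ _ _ s

theorem preimage_mono (f : X.toSheafedSpace ⟶ Y.toSheafedSpace) {U V : Opens Y} (h : V ≤ U) :
    (Opens.map f.hom.base).obj V ≤ (Opens.map f.hom.base).obj U := fun _ hx => h hx

theorem pull_res (f : X.toSheafedSpace ⟶ Y.toSheafedSpace) {U V : Opens Y} (h : V ≤ U) (s : Y.Sec U) :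
    pull f V (Y.res h s) = X.res (preimage_mono f h) (pull f U s) := by
  have := congrArg (fun φ => φ.hom s) (f.hom.c.naturality (homOfLE h).op)
  exact this

theorem preimage_le_of_eq {f g : X.toSheafedSpace ⟶ Y.toSheafedSpace}
    (h : ∀ x, f.hom.base x = g.hom.base x) (V : Opens Y) :
    (Opens.map f.hom.base).obj V ≤ (Opens.map g.hom.base).obj V := fun x hx => by
  have hx' : f.hom.base x ∈ V := hx
  rw [h x] at hx'
  exact hx'

/-- The two pullbacks are sections over preimages that are equal only propositionally; comparing
them through a restriction map avoids transport along that equality. -/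
theorem hom_ext' (f g : X ⟶ Y) (hb : ∀ x, f.toHom.hom.base x = g.toHom.hom.base x)
    (h : ∀ V (s : Y.Sec V), pull f.toHom V s = X.res (preimage_le_of_eq hb V) (pull g.toHom V s)) :
    f = g := by
  obtain ⟨⟨⟨fb, fc⟩⟩, _, _⟩ := f
  obtain ⟨⟨⟨gb, gc⟩⟩, _, _⟩ := g
  have hbase : fb = gb := TopCat.hom_ext (ContinuousMap.ext hb)
  subst hbase
  have hc : fc = gc := by
    refine NatTrans.ext (funext fun V => AlgCat.Hom.ext (AlgHom.ext fun s => ?_))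
    exact (h V.unop s).trans (res_self _ _)
  subst hc
  rfl

theorem pull_congr {f g : X ⟶ Y} (h : f = g) (V : Opens Y) (s : Y.Sec V) :
    pull f.toHom V s = X.res (preimage_le_of_eq (fun x => by rw [h]) V) (pull g.toHom V s) := by
  subst h
  exact (res_self _ _).symm

theorem base_congr {f g : X ⟶ Y} (h : f = g) (x : X) : f.toHom.hom.base x = g.toHom.hom.base x := by
  rw [h]

/-- A unit near a point stays a unit near that point under restriction. -/
theorem unitNear_res {U V : Opens X} (h : V ≤ U) {x : X} (hx : x ∈ V) (s : X.Sec U) :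
    X.UnitNear (X.res h s) x ↔ X.UnitNear s x := by
  constructor
  · rintro ⟨W, hW, hxW, hu⟩
    exact ⟨W, hW.trans h, hxW, by rwa [res_res] at hu⟩
  · rintro ⟨W, hW, hxW, hu⟩
    refine ⟨W ⊓ V, inf_le_right, ⟨hxW, hx⟩, ?_⟩
    rw [res_res]
    have := hu.map (X.res (inf_le_left : W ⊓ V ≤ W))
    rwa [res_res] at this

/-- The open subset of `X` which corresponds to an open subset of the open subspace `U`. -/
abbrev img (X : Z2nRingedSpace n) (U : Opens X) (W : Opens (X.restrict U)) : Opens X :=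
  U.isOpenEmbedding.functor.obj W

theorem mem_img {U : Opens X} {W : Opens (X.restrict U)} {x : X.restrict U} :
    (x.1 : X) ∈ X.img U W ↔ x ∈ W :=
  ⟨by rintro ⟨y, hy, h⟩; rwa [← Subtype.ext h], fun h => ⟨x, h, rfl⟩⟩

/-- A morphism whose image lies in an open subspace, as a morphism to the subspace. -/
def lift (f : X ⟶ Y) (U : Opens Y) (h : ∀ x, f.toHom.hom.base x ∈ U) : X ⟶ Y.restrict U where
  toHom := InducedCategory.homMk
    { base := TopCat.ofHom ⟨fun x => ⟨f.toHom.hom.base x, h x⟩,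
        (f.toHom.hom.base.hom.continuous).subtype_mk _⟩
      c :=
      { app := fun W => AlgCat.ofHom ((X.res (fun x hx => (mem_img (x := ⟨_, h x⟩)).mpr hx)).comp
          (pull f.toHom (Y.img U W.unop)))
        naturality := fun A B i => by
          refine AlgCat.Hom.ext (AlgHom.ext fun s => ?_)
          have h1 := pull_res f.toHom (U.isOpenEmbedding.functor.map i.unop).le s
          have hB : (Opens.map (TopCat.ofHom ⟨fun x => (⟨f.toHom.hom.base x, h x⟩ : U),
            (f.toHom.hom.base.hom.continuous).subtype_mk _⟩)).obj B.unop ≤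
              (Opens.map f.toHom.hom.base).obj (Y.img U B.unop) :=
            fun x hx => (mem_img (x := ⟨_, h x⟩)).mpr hx
          exact (congrArg (X.res hB) h1).trans ((res_res _ _ _).trans (res_res _ _ _).symm) } }
  weight_zero W γ s hs := X.res_mem _ _ _ γ _ (f.weight_zero _ γ s hs)
  isLocal W s x hu := by
    -- A germ that is a unit at `x` is defined on a neighbourhood of `x` inside the domain of the
    -- section, so the second case is contradictory.
    by_cases hx : x ∈ (Opens.map f.toHom.hom.base).obj (Y.img U W)
    · have hxW : (⟨f.toHom.hom.base x, h x⟩ : Y.restrict U) ∈ W := mem_img.mp hx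
      have hW : (Opens.map (TopCat.ofHom ⟨fun x => (⟨f.toHom.hom.base x, h x⟩ : U),
          (f.toHom.hom.base.hom.continuous).subtype_mk _⟩)).obj W ≤
          (Opens.map f.toHom.hom.base).obj (Y.img U W) :=
        fun x hx => (mem_img (x := ⟨_, h x⟩)).mpr hx
      have h1 := f.isLocal (Y.img U W) s x
        ((unitNear_res (X := X) hW hxW (pull f.toHom (Y.img U W) s)).mp hu)
      obtain ⟨V, hV, hxV, hu⟩ := h1
      have hle : Y.img U ((Opens.map U.inclusion').obj V) ≤ V := by
        rintro _ ⟨y, hy, rfl⟩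
        exact hy
      refine ⟨(Opens.map U.inclusion').obj V, fun y hy => mem_img.mp (hV hy), hxV, ?_⟩
      exact (congrArg IsUnit (res_res hV hle s)).mp (hu.map (Y.res hle))
    · obtain ⟨V, hV, hxV, -⟩ := hu
      exact absurd (mem_img.mpr (hV hxV)) hx

theorem lift_incl (f : X ⟶ Y) (U : Opens Y) (h : ∀ x, f.toHom.hom.base x ∈ U) :
    lift f U h ≫ Y.incl U = f := by
  refine hom_ext' _ _ (fun _ => rfl) fun V s => ?_
  have hle : Y.img U ((Opens.map U.inclusion').obj V) ≤ V := by
    rintro _ ⟨y, hy, rfl⟩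
    exact hy
  have hV : (Opens.map (lift f U h ≫ Y.incl U).toHom.hom.base).obj V ≤
      (Opens.map f.toHom.hom.base).obj (Y.img U ((Opens.map U.inclusion').obj V)) :=
    fun x hx => (mem_img (x := ⟨_, h x⟩)).mpr hx
  exact (congrArg (X.res hV) (pull_res f.toHom hle s)).trans (res_res _ _ _)

/-- Open inclusions are monomorphisms, because every open subset of the subspace is the trace of an
open subset of `Y`. Equalities of morphisms into a subspace of a chart can thus be tested in the
chart. -/
theorem incl_mono {U : Opens Y} {f g : X ⟶ Y.restrict U} (h : f ≫ Y.incl U = g ≫ Y.incl U) : f = g := by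
  have hb : ∀ x, f.toHom.hom.base x = g.toHom.hom.base x := fun x => Subtype.ext (base_congr h x)
  refine hom_ext' f g hb fun W s => ?_
  -- `W'` and `W` have the same points but differ in form; sections are carried between them by the
  -- two inclusions.
  let W' : Opens (Y.restrict U) := (Opens.map U.inclusion').obj (Y.img U W)
  have hle : W' ≤ W := fun y hy => mem_img.mp hy
  have hle' : W ≤ W' := fun y hy => mem_img.mpr hy
  have h1 : pull f.toHom W' ((Y.restrict U).res hle s) =
      X.res (preimage_le_of_eq hb W') (pull g.toHom W' ((Y.restrict U).res hle s)) :=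
    pull_congr h (Y.img U W) s
  have hf : (Opens.map f.toHom.hom.base).obj W ≤ (Opens.map f.toHom.hom.base).obj W' :=
    preimage_mono f.toHom hle'
  have h2 := congrArg (X.res hf) h1
  rwa [pull_res, pull_res, res_res, res_res, res_res, res_self] at h2

theorem inclLE_incl {U V : Opens X} (h : U ≤ V) : X.inclLE h ≫ X.incl V = X.incl U := by
  refine hom_ext' _ _ (fun _ => rfl) fun W s => ?_
  have h1 : X.img V ((Opens.map V.inclusion').obj W) ≤ W := by
    rintro _ ⟨y, hy, rfl⟩
    exact hy
  have h2 : X.img U ((Opens.map U.inclusion').obj W) ≤ W := by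
    rintro _ ⟨y, hy, rfl⟩
    exact hy
  exact (res_res h1 (X.image_le h _) s).trans (res_res h2 le_rfl s).symm

/-- A ringed space is isomorphic to its largest open subspace. -/
def isoRestrictTop (X : Z2nRingedSpace n) : X ≅ X.restrict ⊤ where
  hom := lift (𝟙 X) ⊤ fun _ => Opens.mem_top _
  inv := X.incl ⊤
  hom_inv_id := lift_incl _ _ _
  inv_hom_id := incl_mono (by rw [Category.assoc, lift_incl, Category.comp_id, Category.id_comp])

end Z2nRingedSpace

open PSeries Z2nRingedSpace

theorem Z2nRingedSpace.unitNear_restrict {X : Z2nRingedSpace n} {U : Opens X} {A : Opens (X.restrict U)}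
    (s : (X.restrict U).Sec A) (x : X.restrict U) :
    (X.restrict U).UnitNear s x ↔ X.UnitNear (U := X.img U A) s x.1 := by
  constructor
  · rintro ⟨W, hW, hx, hu⟩
    exact ⟨X.img U W, U.isOpenEmbedding.functor.map (homOfLE hW) |>.le, mem_img.mpr hx, hu⟩
  · rintro ⟨W, hW, hx, hu⟩
    have hle : X.img U ((Opens.map U.inclusion').obj W) ≤ W := by
      rintro _ ⟨y, hy, rfl⟩
      exact hy
    exact ⟨(Opens.map U.inclusion').obj W, fun y hy => mem_img.mp (hW hy), hx,
      (congrArg IsUnit (res_res hW hle s)).mp (hu.map (X.res hle))⟩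

/-! ### Morphisms from open subspaces of superdomains to superdomains -/

section morphisms

variable {d d' : Z2n n → ℕ}

theorem isHomog_coordAt (a : Idx d) (x : Fin (d 0) → ℝ) : IsHomog a.deg (coordAt a x) := by
  classical
  obtain ⟨γ, j⟩ := a
  by_cases h : γ = 0
  · subst h
    rw [coordAt_zero]
    exact isHomog_algebraMap _
  · have e : coordAt (⟨γ, j⟩ : Idx d) x = X ⟨⟨γ, j⟩, h⟩ := coordAt_formal ⟨⟨γ, j⟩, h⟩ x
    rw [e]
    intro α hα
    rw [coeff_X] at hα
    have : α = Finsupp.single ⟨⟨γ, j⟩, h⟩ 1 := by_contra fun h0 => hα (if_neg h0)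
    rw [this, monoDeg, Finset.sum_eq_single (⟨⟨γ, j⟩, h⟩ : FormalVar d)]
    · simp
    · intro v _ hv
      rw [Finsupp.single_eq_of_ne hv, zero_smul]
    · simp

theorem body_coordAt (x : Fin (d 0) → ℝ) : body (fun a : Idx d => coordAt a x) = x :=
  funext fun i => by rw [body, coordAt_zero, coeff_zero_algebraMap]

/-- A section of a superdomain is invertible near a point if and only if its value there is not
zero. -/
theorem unitNear_superdomain_iff {V : Opens (superdomain d)} (f : smoothSeries d V)
    {y : superdomain d} (hy : y ∈ V) :
    (superdomain d).UnitNear (U := V) f y ↔ coeff 0 (f.1 ⟨y, hy⟩) ≠ 0 := by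
  constructor
  · rintro ⟨W, hW, hyW, hu⟩
    have hu' : IsUnit (smoothSeriesRes d hW f) := hu
    exact ((hu'.map (evalSec (⟨y, hyW⟩ : W))).map (value d)).ne_zero
  · intro h
    -- A non-zero value persists on this open set, and there the section is invertible.
    have ho : IsOpen ((V.1 : Set (Fin (d 0) → ℝ)) ∩ (fun z => coeff 0 (extendSec f z)) ⁻¹' {0}ᶜ) :=
      (contDiffOn_extendSec f 0).continuousOn.isOpen_inter_preimage V.isOpen
        isOpen_compl_singleton
    have hle : (⟨_, ho⟩ : Opens (Fin (d 0) → ℝ)) ≤ V := fun z hz => hz.1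
    refine ⟨⟨_, ho⟩, hle, ⟨hy, ?_⟩, ?_⟩
    · change coeff 0 (extendSec f y) ≠ 0
      rwa [extendSec_apply' f hy]
    · refine isUnit_smoothSeries (smoothSeriesRes d hle f) fun x => ?_
      have h1 : coeff 0 (extendSec f x.1) ≠ 0 := x.2.2
      rwa [extendSec_apply' f x.2.1] at h1

section evaluation

variable {U : Opens (superdomain d')}

/-- Evaluation of the sections over an open subspace of a superdomain at a point. -/
def valAt {A : Opens ((superdomain d').restrict U)} (x : (superdomain d').restrict U) (hx : x ∈ A) :
    ((superdomain d').restrict U).Sec A →ₐ[ℝ] PSeries d' :=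
  evalSec (U := (superdomain d').img U A) ⟨x.1, mem_img.mpr hx⟩

theorem valAt_res {A B : Opens ((superdomain d').restrict U)} (h : B ≤ A)
    (x : (superdomain d').restrict U) (hx : x ∈ B) (s : ((superdomain d').restrict U).Sec A) :
    valAt x hx (res _ h s) = valAt x (h hx) s := rfl

theorem valAt_ext {A : Opens ((superdomain d').restrict U)} {s t : ((superdomain d').restrict U).Sec A}
    (h : ∀ x hx, valAt x hx s = valAt x hx t) : s = t := by
  refine Subtype.ext (funext fun x => ?_)
  obtain ⟨_, ⟨y, hy, rfl⟩⟩ := x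
  exact h y hy

theorem isHomog_valAt {A : Opens ((superdomain d').restrict U)} {γ : Z2n n}
    {s : ((superdomain d').restrict U).Sec A} (hs : s ∈ ((superdomain d').restrict U).gr A γ)
    (x : (superdomain d').restrict U) (hx : x ∈ A) : IsHomog γ (valAt x hx s) := hs _

theorem unitNear_iff_valAt {A : Opens ((superdomain d').restrict U)}
    (s : ((superdomain d').restrict U).Sec A) (x : (superdomain d').restrict U) (hx : x ∈ A) :
    ((superdomain d').restrict U).UnitNear s x ↔ coeff 0 (valAt x hx s) ≠ 0 :=
  (unitNear_restrict s x).trans (unitNear_superdomain_iff _ (mem_img.mpr hx))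

variable (g : (superdomain d').restrict U ⟶ superdomain d)

/-- Morphisms to a superdomain are compatible with values. -/
theorem coeff_zero_valAt_pull {V : Opens (superdomain d)} (f : smoothSeries d V)
    (x : (superdomain d').restrict U) (hx : g.toHom.hom.base x ∈ V) :
    coeff 0 (valAt (A := (Opens.map g.toHom.hom.base).obj V) x hx (pull g.toHom V f)) =
      coeff 0 (f.1 ⟨g.toHom.hom.base x, hx⟩) := by
  -- Let `c` be the value of `f` at the image point. If the pullback had another value at `x`, then
  -- the pullback of `f - c` would be a unit near `x`. Locality would make `f - c` a unit near the
  -- image point, where it vanishes.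
  by_contra hne
  let c : ℝ := coeff 0 (f.1 ⟨g.toHom.hom.base x, hx⟩)
  let f' : smoothSeries d V := f - algebraMap ℝ _ c
  have h1 : ((superdomain d').restrict U).UnitNear (pull g.toHom V f') x := by
    refine (unitNear_iff_valAt _ x hx).mpr ?_
    have e : pull g.toHom V f' = pull g.toHom V f - algebraMap ℝ _ c := by
      refine (map_sub (pull g.toHom V) _ _).trans (congrArg₂ _ rfl ?_)
      exact (pull g.toHom V).commutes c
    rw [e, map_sub, map_sub, AlgHom.commutes, coeff_zero_algebraMap]
    exact sub_ne_zero.mpr hne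
  have h2 := (unitNear_superdomain_iff f' hx).mp (g.isLocal V f' x h1)
  refine h2 ?_
  change coeff 0 (f.1 ⟨g.toHom.hom.base x, hx⟩ - algebraMap ℝ _ c) = 0
  rw [map_sub, coeff_zero_algebraMap, sub_self]

/-- The pullbacks of the coordinates, evaluated at a point. -/
def coordsAt (x : (superdomain d').restrict U) (a : Idx d) : PSeries d' :=
  valAt (A := (Opens.map g.toHom.hom.base).obj ⊤) x (Opens.mem_top _)
    (pull g.toHom ⊤ (coordSec a ⊤ : smoothSeries d ⊤))

theorem coordsAt_hasDegrees (x : (superdomain d').restrict U) : HasDegrees (coordsAt g x) := fun a =>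
  isHomog_valAt (g.weight_zero ⊤ a.deg _ fun y => isHomog_coordAt a y.1) x _

/-- Consequently the continuous map is determined by the pullbacks of the coordinates, and no
separate condition on it is needed for uniqueness. -/
theorem body_coordsAt (x : (superdomain d').restrict U) : body (coordsAt g x) = g.toHom.hom.base x :=
  funext fun i => by
    refine (coeff_zero_valAt_pull g (coordSec ⟨0, i⟩ ⊤) x (Opens.mem_top _)).trans ?_
    change coeff 0 (coordAt _ _) = _
    rw [coordAt_zero, coeff_zero_algebraMap]

/-- A morphism to a superdomain is given by substitution of the pullbacks of the coordinates. -/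
theorem valAt_pull {V : Opens (superdomain d)} (f : smoothSeries d V)
    (x : (superdomain d').restrict U) (hx : g.toHom.hom.base x ∈ V) :
    valAt (A := (Opens.map g.toHom.hom.base).obj V) x hx (pull g.toHom V f) =
      subst (coordsAt g x) (extendSec f) := by
  let φ : smoothSeries d V →ₐ[ℝ] PSeries d' :=
    (valAt (A := (Opens.map g.toHom.hom.base).obj V) x hx).comp (pull g.toHom V)
  have hW : body (coordsAt g x) ∈ V := by rw [body_coordsAt]; exact hx
  have h : φ = substHom (coordsAt g x) (coordsAt_hasDegrees g x) hW := by
    refine eq_substHom _ hW fun a => ?_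
    have h1 := pull_res g.toHom (le_top : V ≤ ⊤) (coordSec a ⊤ : smoothSeries d ⊤)
    exact congrArg (valAt (A := (Opens.map g.toHom.hom.base).obj V) x hx) h1
  exact congrArg (fun ψ => ψ f) h

variable {g} in
/-- A morphism to a superdomain is determined by the pullbacks of the coordinates. -/
theorem hom_superdomain_ext {g' : (superdomain d').restrict U ⟶ superdomain d}
    (h : ∀ x a, coordsAt g x a = coordsAt g' x a) : g = g' := by
  have hc : ∀ x, coordsAt g x = coordsAt g' x := fun x => funext (h x)
  have hb : ∀ x, g.toHom.hom.base x = g'.toHom.hom.base x := fun x => by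
    rw [← body_coordsAt, ← body_coordsAt, hc]
  refine hom_ext' g g' hb fun V f => valAt_ext fun x hx => ?_
  rw [valAt_res]
  refine (valAt_pull g f x hx).trans (Eq.trans ?_ (valAt_pull g' f x _).symm)
  rw [hc]

end evaluation

section existence

/-- The pullback of sections by substitution. -/
def substPull {B : Opens (Fin (d' 0) → ℝ)} {V : Opens (Fin (d 0) → ℝ)} (t : B → Idx d → PSeries d')
    (ht : ∀ a, (fun z => t z a) ∈ smoothSeries d' B) (hdeg : ∀ z, HasDegrees (t z))
    (hV : ∀ z, body (t z) ∈ V) : smoothSeries d V →ₐ[ℝ] smoothSeries d' B where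
  toFun f := ⟨fun z => subst (t z) (extendSec f),
    subst_mem_smoothSeries ht hV (contDiffOn_extendSec f)⟩
  map_one' := Subtype.ext (funext fun z => map_one (substHom (t z) (hdeg z) (hV z)))
  map_mul' _ _ := Subtype.ext (funext fun z => map_mul (substHom (t z) (hdeg z) (hV z)) _ _)
  map_zero' := Subtype.ext (funext fun z => map_zero (substHom (t z) (hdeg z) (hV z)))
  map_add' _ _ := Subtype.ext (funext fun z => map_add (substHom (t z) (hdeg z) (hV z)) _ _)
  commutes' c := Subtype.ext (funext fun z => (substHom (t z) (hdeg z) (hV z)).commutes c)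

theorem continuous_body {U : Opens (Fin (d' 0) → ℝ)} {s : U → Idx d → PSeries d'}
    (hs : ∀ a, (fun x => s x a) ∈ smoothSeries d' U) : Continuous fun x => body (s x) := by
  refine continuous_pi fun i => ?_
  have h := continuousOn_iff_continuous_domRestrict.mp (ContDiffOn.continuousOn (hs ⟨0, i⟩ 0))
  refine h.congr fun x => ?_
  exact SmoothOn.extend_apply (fun x => coeff 0 (s x ⟨0, i⟩)) x

variable {U : Opens (superdomain d')} (s : U → Idx d → PSeries d')
  (hs : ∀ a, (fun x => s x a) ∈ smoothSeries d' U) (hdeg : ∀ x, HasDegrees (s x))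

theorem mem_of_mem_img {A : Opens ((superdomain d').restrict U)} (z : (superdomain d').img U A) :
    z.1 ∈ U := by
  obtain ⟨_, ⟨y, -, rfl⟩⟩ := z
  exact y.2

/-- The morphism to `ℝ^d` with given pullbacks of the coordinates. -/
def homSuperdomain : (superdomain d').restrict U ⟶ superdomain d where
  toHom := InducedCategory.homMk
    { base := TopCat.ofHom ⟨fun x => body (s x), continuous_body hs⟩
      c :=
      { app := fun V => AlgCat.ofHom (substPull (B := (superdomain d').img U ((Opens.map (TopCat.ofHom
            ⟨fun x => body (s x), continuous_body hs⟩)).obj V.unop)) (V := V.unop)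
          (fun z => s ⟨z.1, mem_of_mem_img z⟩) (fun a α => (hs a α).res fun z hz =>
            mem_of_mem_img ⟨z, hz⟩) (fun z => hdeg _) fun z => by
              obtain ⟨_, ⟨y, hy, rfl⟩⟩ := z
              exact hy)
        naturality := fun A B i => by
          refine AlgCat.Hom.ext (AlgHom.ext fun f => Subtype.ext (funext fun z => ?_))
          obtain ⟨_, ⟨y, hy, rfl⟩⟩ := z
          refine subst_congr (eventuallyEq_extendSec (W := B.unop) _ hy fun x => ?_)
          exact (extendSec_apply' (W := A.unop) f (i.unop.le x.2)).symm } }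
  weight_zero V γ f hf z := by
    obtain ⟨_, ⟨y, hy, rfl⟩⟩ := z
    refine isHomog_subst (hdeg y) ?_
    filter_upwards [V.isOpen.mem_nhds hy] with w hw
    exact (congrArg (IsHomog γ) (extendSec_apply' (W := V) f hw)).mpr (hf ⟨w, hw⟩)
  isLocal V f x hu := by
    by_cases hx : body (s x) ∈ V
    · refine (unitNear_superdomain_iff f hx).mpr ?_
      have h1 := (unitNear_iff_valAt _ x hx).mp hu
      have h2 : coeff 0 (subst (s x) (extendSec (W := V) f)) ≠ 0 := h1
      rw [coeff_zero_subst] at h2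
      exact (congrArg (fun t => coeff 0 t ≠ 0) (extendSec_apply' (W := V) f hx)).mp h2
    · obtain ⟨W, hW, hxW, -⟩ := hu
      exact absurd (hW hxW) hx

theorem coordsAt_homSuperdomain (x : (superdomain d').restrict U) (a : Idx d) :
    coordsAt (homSuperdomain s hs hdeg) x a = s x a :=
  substHom_coordSec (W := ⊤) (s x) (hdeg x) trivial a

end existence

end morphisms

open PSeries Z2nRingedSpace

/-! ### Labels of charts, their minors and the places of coordinates -/

namespace KIndex

variable {k m d : Z2n n → ℕ}

section places

variable (I : KIndex k m)

/-- The place, as a pair (column, row), of the coordinate with index `a` in the matrix `A_I`. -/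
def place (a : Idx (grDim k m)) : I.freePos a.deg :=
  (I.freePos a.deg).orderIsoOfFin (I.card_freePos _) a.pos

def placeRow (a : Idx (grDim k m)) : Idx k := (ofLex (I.place a).1).2

def placeCol (a : Idx (grDim k m)) : Idx m := (ofLex (I.place a).1).1

theorem mem_freePos_iff {γ : Z2n n} {p : Idx m ×ₗ Idx k} :
    p ∈ I.freePos γ ↔ ¬ I.Mem (ofLex p).1 ∧ (ofLex p).2.deg + (ofLex p).1.deg = γ := by
  rw [freePos, Finset.mem_map]
  constructor
  · rintro ⟨q, hq, rfl⟩
    exact (Finset.mem_filter.mp hq).2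
  · intro h
    exact ⟨ofLex p, Finset.mem_filter.mpr ⟨Finset.mem_univ _, h⟩, rfl⟩

theorem not_mem_placeCol (a : Idx (grDim k m)) : ¬ I.Mem (I.placeCol a) :=
  ((I.mem_freePos_iff).mp (I.place a).2).1

theorem deg_place (a : Idx (grDim k m)) : (I.placeRow a).deg + (I.placeCol a).deg = a.deg :=
  ((I.mem_freePos_iff).mp (I.place a).2).2

/-- The degree is generalised to `γ` because the degree of a given coordinate is the sum of its row
and column degrees only propositionally. -/
theorem coordIdx_eq {γ : Z2n n} {r : Idx k} {c : Idx m} (h : ¬ I.Mem c) (hγ : r.deg + c.deg = γ)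
    (hp : toLex (c, r) ∈ I.freePos γ) :
    I.coordIdx r c h = ⟨γ, ((I.freePos γ).orderIsoOfFin (I.card_freePos _)).symm ⟨_, hp⟩⟩ := by
  subst hγ
  rfl

theorem coordIdx_place (a : Idx (grDim k m)) :
    I.coordIdx (I.placeRow a) (I.placeCol a) (I.not_mem_placeCol a) = a := by
  rw [I.coordIdx_eq (I.not_mem_placeCol a) (I.deg_place a) (I.place a).2]
  have h : ((I.freePos a.deg).orderIsoOfFin (I.card_freePos _)).symm
      ⟨toLex (I.placeCol a, I.placeRow a), (I.place a).2⟩ = a.pos :=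
    OrderIso.symm_apply_apply _ _
  rw [h]

theorem place_coordIdx (r : Idx k) (c : Idx m) (h : ¬ I.Mem c) :
    I.placeRow (I.coordIdx r c h) = r ∧ I.placeCol (I.coordIdx r c h) = c := by
  have : I.place (I.coordIdx r c h) = ⟨toLex (c, r), I.mem_freePos h⟩ := OrderIso.apply_symm_apply _ _
  rw [placeRow, placeCol, this]
  exact ⟨rfl, rfl⟩

theorem mem_col (r : Idx k) : I.Mem (I.col r) := Finset.orderEmbOfFin_mem _ _ _

theorem col_injective : Function.Injective I.col := by
  rintro ⟨a, i⟩ ⟨b, j⟩ h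
  have h1 : a = b := congrArg Idx.deg h
  subst h1
  have h2 : (I.cols a).orderEmbOfFin (I.card_cols a) i = (I.cols a).orderEmbOfFin (I.card_cols a) j := by
    simpa [col] using h
  exact Idx.ext rfl (heq_of_eq (((I.cols a).orderEmbOfFin (I.card_cols a)).injective h2))

theorem exists_col_eq {c : Idx m} (h : I.Mem c) : ∃ r, I.col r = c := by
  have : c.pos ∈ Set.range ((I.cols c.deg).orderEmbOfFin (I.card_cols c.deg)) := by
    rw [Finset.range_orderEmbOfFin]
    exact h
  obtain ⟨i, hi⟩ := this
  exact ⟨⟨c.deg, i⟩, Idx.ext rfl (heq_of_eq hi)⟩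

theorem minor_mul {R : Type} [Ring R] (B : Matrix (Idx k) (Idx k) R) (A : Matrix (Idx k) (Idx m) R) :
    I.minor (B * A) = B * I.minor A := by
  ext r c
  rfl

theorem minor_map {R S : Type} (f : R → S) (A : Matrix (Idx k) (Idx m) R) :
    I.minor (A.map f) = (I.minor A).map f := rfl

theorem minor_labelAt (x : Fin (grDim k m 0) → ℝ) : I.minor (I.labelAt x) = 1 := by
  refine Matrix.ext fun r c => ?_
  change I.labelAt x r (I.col c) = _
  rw [labelAt, dif_pos (I.mem_col c), Matrix.one_apply]
  simp only [I.col_injective.eq_iff, eq_comm]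

theorem isHomogMatrix_labelAt (x : Fin (grDim k m 0) → ℝ) : IsHomogMatrix (I.labelAt x) := by
  intro r c
  rw [labelAt]
  split_ifs with h h1
  · rw [h1]
    change IsHomog (r.deg + r.deg) _
    rw [Z2n.add_self]
    exact isHomog_one
  · exact isHomog_zero _
  · exact isHomog_coordAt _ x

/-- The entries of a matrix at the places of the coordinates of the chart with index `I`. -/
def entries {R : Type} (A : Matrix (Idx k) (Idx m) R) (a : Idx (grDim k m)) : R :=
  A (I.placeRow a) (I.placeCol a)

theorem entries_labelAt (x : Fin (grDim k m 0) → ℝ) (a : Idx (grDim k m)) :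
    I.entries (I.labelAt x) a = coordAt a x := by
  rw [entries, labelAt, dif_neg (I.not_mem_placeCol a), coordIdx_place]

theorem entries_hasDegrees {A : Matrix (Idx k) (Idx m) (PSeries d)} (hA : IsHomogMatrix A) :
    HasDegrees (I.entries A) := fun a => by
  rw [← I.deg_place a]
  exact hA _ _

/-- Substitution of the entries of `A` for the coordinates takes the label `A_I` to `A`, if the
columns of `A` with indices in `I` form the identity matrix. -/
theorem subst_labelAt {A : Matrix (Idx k) (Idx m) (PSeries d)} (hA : IsHomogMatrix A)
    (h1 : I.minor A = 1) (r : Idx k) (c : Idx m) :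
    subst (I.entries A) (fun x => I.labelAt x r c) = A r c := by
  have hd := I.entries_hasDegrees hA
  by_cases h : I.Mem c
  · obtain ⟨r', rfl⟩ := I.exists_col_eq h
    -- In the columns of `I` both matrices have constant entries, those of the identity, and
    -- substitution fixes constants.
    have h2 : (fun x => I.labelAt x r (I.col r')) =
        fun _ => algebraMap ℝ (PSeries (grDim k m)) ((1 : Matrix (Idx k) (Idx k) ℝ) r r') := by
      funext x
      have := congrFun (congrFun (I.minor_labelAt x) r) r'
      refine this.trans ?_
      rw [Matrix.one_apply, Matrix.one_apply]
      split_ifs <;> simp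
    have h3 : A r (I.col r') = (1 : Matrix (Idx k) (Idx k) (PSeries d)) r r' :=
      congrFun (congrFun h1 r) r'
    rw [h2, subst_algebraMap hd fun _ => _, evalSmooth_const, h3, Matrix.one_apply, Matrix.one_apply]
    split_ifs <;> simp
  · have h2 : (fun x => I.labelAt x r c) = coordAt (I.coordIdx r c h) := by
      funext x
      rw [labelAt, dif_neg h]
    rw [h2, subst_coordAt hd, entries, (I.place_coordIdx r c h).1, (I.place_coordIdx r c h).2]

/-- Constant coefficients in `subst_labelAt`: at the point whose coordinates are the bodies of the
entries of `A`, the label has the real values of `A`. -/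
theorem labelAt_body {A : Matrix (Idx k) (Idx m) (PSeries d)} (hA : IsHomogMatrix A)
    (h1 : I.minor A = 1) : (I.labelAt (body (I.entries A))).map (coeff 0) = A.map (coeff 0) := by
  refine Matrix.ext fun r c => ?_
  rw [Matrix.map_apply, Matrix.map_apply, ← I.subst_labelAt hA h1 r c, coeff_zero_subst]

end places

/-! ### Coordinate changes and their composition law -/

section transitions

variable (I J K : KIndex k m)

/-- The label as a matrix of sections. -/
def labelSec (U : Opens (Fin (grDim k m 0) → ℝ)) :
    Matrix (Idx k) (Idx m) (smoothSeries (grDim k m) U) := fun r c =>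
  ⟨fun x => I.labelAt x.1 r c, I.smoothOn_labelAt U r c⟩

theorem isUnit_minor_labelSec {U : Opens (Fin (grDim k m 0) → ℝ)} (h : U ≤ overlap I J) :
    IsUnit (J.minor (I.labelSec U)) :=
  isUnit_matrix_smoothSeries _ fun x => h x.2

variable {I J K}

theorem isUnit_minor_labelAt {x : Fin (grDim k m 0) → ℝ} (hx : x ∈ overlap I J) :
    IsUnit (J.minor (I.labelAt x)) :=
  (I.isUnit_minor_labelSec J le_rfl).map (evalSec (⟨x, hx⟩ : overlap I J)).toRingHom.mapMatrix

variable (I J K)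

/-- The matrix `(M_J A_I)⁻¹ A_I` at a point. -/
def transAt (x : Fin (grDim k m 0) → ℝ) : Matrix (Idx k) (Idx m) (PSeries (grDim k m)) :=
  Ring.inverse (J.minor (I.labelAt x)) * I.labelAt x

/-- The coordinates of `U_J` as functions on `U_I`. -/
def trans (x : Fin (grDim k m 0) → ℝ) (a : Idx (grDim k m)) : PSeries (grDim k m) :=
  J.entries (I.transAt J x) a

theorem trans_self (x : Fin (grDim k m 0) → ℝ) (a : Idx (grDim k m)) : I.trans I x a = coordAt a x := by
  rw [trans, transAt, minor_labelAt, Ring.inverse_one, Matrix.one_mul, entries_labelAt]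

variable {I J K}

theorem isHomogMatrix_transAt {x : Fin (grDim k m 0) → ℝ} (hx : x ∈ overlap I J) :
    IsHomogMatrix (I.transAt J x) := by
  have h1 : IsHomogMatrix (J.minor (I.labelAt x)) := fun r c => I.isHomogMatrix_labelAt x r (J.col c)
  exact (h1.inverse (isUnit_minor_labelAt hx)).mul (I.isHomogMatrix_labelAt x)

theorem minor_transAt {x : Fin (grDim k m 0) → ℝ} (hx : x ∈ overlap I J) :
    J.minor (I.transAt J x) = 1 := by
  rw [transAt, minor_mul, Ring.inverse_mul_cancel _ (isUnit_minor_labelAt hx)]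

theorem trans_hasDegrees {x : Fin (grDim k m 0) → ℝ} (hx : x ∈ overlap I J) :
    HasDegrees (I.trans J x) := J.entries_hasDegrees (isHomogMatrix_transAt hx)

theorem map_inverse_mul {R S : Type} [Ring R] [Ring S] (φ : R →+* S) {M : Matrix (Idx k) (Idx k) R}
    (hM : IsUnit M) (A : Matrix (Idx k) (Idx m) R) :
    (Ring.inverse M * A).map φ = Ring.inverse (M.map φ) * A.map φ := by
  rw [Matrix.map_mul]
  exact congrArg (· * _) (Ring.map_inverse_of_isUnit φ.mapMatrix hM)

/-- Ring homomorphisms preserve inverses of units, so the inverse taken among sections may be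
computed pointwise. This links the pasting equation to `transAt`. -/
theorem evalSec_inverse_mul {U : Opens (Fin (grDim k m 0) → ℝ)} (h : U ≤ overlap I J) (x : U) :
    (Ring.inverse (J.minor (I.labelSec U)) * I.labelSec U).map (evalSec x) = I.transAt J x :=
  map_inverse_mul (evalSec x).toRingHom (I.isUnit_minor_labelSec J h) (I.labelSec U)

theorem trans_mem_smoothSeries (a : Idx (grDim k m)) :
    (fun x : overlap I J => I.trans J x.1 a) ∈ smoothSeries (grDim k m) (overlap I J) := by
  have : (fun x : overlap I J => I.trans J x.1 a) =
      (J.entries (Ring.inverse (J.minor (I.labelSec (overlap I J))) * I.labelSec (overlap I J)) a).1 := by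
    funext x
    exact (congrArg (fun A => J.entries A a) (evalSec_inverse_mul le_rfl x)).symm
  rw [this]
  exact Subtype.property _

/-- The algebra behind the cocycle condition, used with `a = M_J A_I` and `b = M_K A_I`;
commutativity plays no role. -/
theorem mul_inverse_mul_inverse {R : Type} [Ring R] {a b : R} (ha : IsUnit a) (hb : IsUnit b) :
    Ring.inverse (Ring.inverse a * b) * Ring.inverse a = Ring.inverse b := by
  obtain ⟨u, rfl⟩ := ha
  obtain ⟨v, rfl⟩ := hb
  rw [Ring.inverse_unit, Ring.inverse_unit, ← Units.val_mul, Ring.inverse_unit, ← Units.val_mul]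
  congr 1
  group

theorem minor_transAt_eq {x : Fin (grDim k m 0) → ℝ} :
    K.minor (I.transAt J x) = Ring.inverse (J.minor (I.labelAt x)) * K.minor (I.labelAt x) :=
  K.minor_mul _ _

theorem isUnit_inverse {R : Type} [Ring R] {a : R} (ha : IsUnit a) : IsUnit (Ring.inverse a) := by
  obtain ⟨u, rfl⟩ := ha
  rw [Ring.inverse_unit]
  exact Units.isUnit _

theorem isUnit_minor_transAt {x : Fin (grDim k m 0) → ℝ} (hJ : x ∈ overlap I J)
    (hK : x ∈ overlap I K) : IsUnit (K.minor (I.transAt J x)) := by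
  rw [minor_transAt_eq]
  exact (isUnit_inverse (isUnit_minor_labelAt hJ)).mul (isUnit_minor_labelAt hK)

/-- The image point has a label with the values of `(M_J A_I)⁻¹ A_I`, whose `K`-minor is the product
of the invertible matrices `(M_J A_I)⁻¹` and `M_K A_I`. -/
theorem body_trans_mem {x : Fin (grDim k m 0) → ℝ} (hJ : x ∈ overlap I J) (hK : x ∈ overlap I K) :
    body (I.trans J x) ∈ overlap J K := by
  change IsUnit ((K.minor (J.labelAt (body (I.trans J x)))).map (coeff 0))
  have h := J.labelAt_body (isHomogMatrix_transAt hJ) (minor_transAt hJ)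
  rw [← minor_map]
  change IsUnit (K.minor ((J.labelAt (body (J.entries (I.transAt J x)))).map (coeff 0)))
  rw [h, minor_map]
  exact (isUnit_minor_transAt hJ hK).map (value (grDim k m)).toRingHom.mapMatrix

/-- The composition law of the coordinate changes. -/
theorem subst_trans {x : Fin (grDim k m 0) → ℝ} (hJ : x ∈ overlap I J) (hK : x ∈ overlap I K)
    (a : Idx (grDim k m)) : subst (I.trans J x) (fun y => J.trans K y a) = I.trans K x a := by
  have hb := body_trans_mem hJ hK
  let Φ := substHom (I.trans J x) (trans_hasDegrees hJ) hb
  -- Substitution turns `A_J` into `(M_J A_I)⁻¹ A_I`, because the `J`-columns of the latter form the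
  -- identity.
  have h1 : (J.labelSec (overlap J K)).map Φ = I.transAt J x := by
    refine Matrix.ext fun r c => ?_
    refine (subst_congr (eventuallyEq_extendSec (F := fun y => J.labelAt y r c) _ hb
      fun _ => rfl)).trans ?_
    exact J.subst_labelAt (isHomogMatrix_transAt hJ) (minor_transAt hJ) r c
  -- `Φ` commutes with the inverse of the invertible minor, and the factors `M_J A_I` cancel.
  have h2 : (Ring.inverse (K.minor (J.labelSec (overlap J K))) * J.labelSec (overlap J K)).map Φ =
      I.transAt K x := by
    refine (map_inverse_mul Φ.toRingHom (J.isUnit_minor_labelSec K le_rfl) _).trans ?_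
    change Ring.inverse (K.minor ((J.labelSec (overlap J K)).map Φ)) *
      (J.labelSec (overlap J K)).map Φ = _
    rw [h1, minor_transAt_eq, transAt, transAt, ← Matrix.mul_assoc,
      mul_inverse_mul_inverse (isUnit_minor_labelAt hJ) (isUnit_minor_labelAt hK)]
  rw [trans, ← h2]
  refine subst_congr ?_
  refine (eventuallyEq_extendSec (K.entries (Ring.inverse (K.minor (J.labelSec (overlap J K))) *
    J.labelSec (overlap J K)) a) hb fun y => ?_).symm
  exact congrArg (fun A => K.entries A a) (evalSec_inverse_mul le_rfl y)

theorem overlap_self (I : KIndex k m) : overlap I I = ⊤ := by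
  refine eq_top_iff.mpr fun x _ => ?_
  have h : IsUnit (I.minor (I.labelAt x)) := by
    rw [I.minor_labelAt x]
    exact isUnit_one
  exact h.map (value (grDim k m)).toRingHom.mapMatrix

end transitions

end KIndex

open PSeries Z2nRingedSpace

theorem Z2nRingedSpace.img_le {X : Z2nRingedSpace n} {U : Opens X} (A : Opens (X.restrict U)) :
    X.img U A ≤ U := by
  rintro _ ⟨y, -, rfl⟩
  exact y.2

/-! ### Composition in coordinates -/

section composition

variable {d d' d'' : Z2n n → ℕ} {U : Opens (superdomain d')} {V : Opens (superdomain d)}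

/-- A morphism to an open subspace of a superdomain is given by substitution. -/
theorem valAt_pull_restrict (f : (superdomain d').restrict U ⟶ (superdomain d).restrict V)
    {A : Opens ((superdomain d).restrict V)} (t : smoothSeries d ((superdomain d).img V A))
    (x : (superdomain d').restrict U) (hx : f.toHom.hom.base x ∈ A) :
    valAt (A := (Opens.map f.toHom.hom.base).obj A) x hx (pull f.toHom A t) =
      subst (coordsAt (f ≫ (superdomain d).incl V) x) (extendSec t) := by
  let A' : Opens ((superdomain d).restrict V) :=
    (Opens.map V.inclusion').obj ((superdomain d).img V A)
  have hle : A' ≤ A := fun y hy => mem_img.mp hy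
  have hx' : f.toHom.hom.base x ∈ A' := (mem_img (W := A)).mpr hx
  have h1 := valAt_pull (f ≫ (superdomain d).incl V) (V := (superdomain d).img V A) t x hx'
  have h2 := pull_res f.toHom hle t
  exact (congrArg (valAt (A := (Opens.map f.toHom.hom.base).obj A') x hx') h2).symm.trans h1

/-- The coordinates of a composite. -/
theorem coordsAt_comp (f : (superdomain d').restrict U ⟶ (superdomain d).restrict V)
    (h : (superdomain d).restrict V ⟶ superdomain d'') (F : (Fin (d 0) → ℝ) → PSeries d) (a : Idx d'')
    (hF : ∀ y : (superdomain d).restrict V, coordsAt h y a = F y.1)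
    (x : (superdomain d').restrict U) :
    coordsAt (f ≫ h) x a = subst (coordsAt (f ≫ (superdomain d).incl V) x) F := by
  refine (valAt_pull_restrict f (A := (Opens.map h.toHom.hom.base).obj ⊤)
    (pull h.toHom ⊤ (coordSec a ⊤ : smoothSeries d'' ⊤)) x (Opens.mem_top _)).trans
    (subst_congr (eventuallyEq_extendSec (W := (superdomain d).img V
      ((Opens.map h.toHom.hom.base).obj ⊤)) _ ?_ fun y => ?_))
  · rw [body_coordsAt]
    exact mem_img.mpr (Opens.mem_top _)
  · obtain ⟨_, ⟨y, hy, rfl⟩⟩ := y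
    exact hF y

end composition

/-! ### The pasting equation, inverses and the cocycle condition -/

section pasting

variable {k m : Z2n n → ℕ} {I J K : KIndex k m}

theorem label_apply_of_not_mem (U : Opens (chart k m)) {r : Idx k} {c : Idx m} (h : ¬ I.Mem c) :
    I.labelSec U r c = coordSec (I.coordIdx r c h) U :=
  Subtype.ext (funext fun x => by
    change I.labelAt x.1 r c = coordAt _ _
    rw [KIndex.labelAt, dif_neg h])

/-- The pasting equation determines the pullbacks of the coordinates. -/
theorem isPasting_iff (g : (chart k m).restrict (overlap J I) ⟶ (chart k m).restrict (overlap I J)) :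
    IsPasting I J g ↔ ∀ x a, coordsAt (g ≫ (chart k m).incl (overlap I J)) x a = J.trans I x.1 a := by
  have hleft : ∀ x r c (h : ¬ I.Mem c), valAt (A := (⊤ : Opens ((chart k m).restrict (overlap J I)))) x
      (Opens.mem_top _) (pull g.toHom ⊤ (labelOn I (overlap I J) r c)) =
      coordsAt (g ≫ (chart k m).incl (overlap I J)) x (I.coordIdx r c h) := by
    intro x r c h
    have h1 := label_apply_of_not_mem ((chart k m).img (overlap I J) ⊤) (r := r) h
    exact congrArg (fun t => valAt (A := (⊤ : Opens ((chart k m).restrict (overlap J I)))) x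
      (Opens.mem_top _) (pull g.toHom ⊤ t)) h1
  have hright : ∀ x r c, valAt (A := (⊤ : Opens ((chart k m).restrict (overlap J I)))) x
      (Opens.mem_top _) ((Ring.inverse (I.minor (labelOn J (overlap J I))) *
        labelOn J (overlap J I)) r c) = J.transAt I x.1 r c := by
    intro x r c
    exact congrFun (congrFun (KIndex.evalSec_inverse_mul (I := J) (J := I)
      (U := (chart k m).img (overlap J I) ⊤) (img_le _)
        ⟨x.1, mem_img.mpr (Opens.mem_top _)⟩) r) c
  constructor
  · intro h x a
    have h1 := congrFun (congrFun h (I.placeRow a)) ⟨I.placeCol a, I.not_mem_placeCol a⟩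
    have h2 := congrArg (valAt (A := (⊤ : Opens ((chart k m).restrict (overlap J I)))) x
      (Opens.mem_top _)) h1
    have h3 := (hleft x _ _ (I.not_mem_placeCol a)).symm.trans (h2.trans (hright x _ _))
    exact (congrArg (coordsAt (g ≫ (chart k m).incl (overlap I J)) x) (I.coordIdx_place a)).symm.trans h3
  · intro h
    refine Matrix.ext fun r c => valAt_ext (A := ⊤) fun x _ => ?_
    refine (hleft x r c.1 c.2).trans (Eq.trans ?_ (hright x r c.1).symm)
    refine (h x _).trans ?_
    exact congrArg₂ (J.transAt I x.1) (I.place_coordIdx r c.1 c.2).1 (I.place_coordIdx r c.1 c.2).2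

/-- The coordinate change from `U_J` to `U_I` as a morphism to `U_I`. -/
def transHom (I J : KIndex k m) : (chart k m).restrict (overlap J I) ⟶ chart k m :=
  homSuperdomain (fun x : overlap J I => J.trans I x.1) (fun a => KIndex.trans_mem_smoothSeries a)
    fun x => KIndex.trans_hasDegrees x.2

theorem coordsAt_transHom (x : (chart k m).restrict (overlap J I)) (a : Idx (grDim k m)) :
    coordsAt (transHom I J) x a = J.trans I x.1 a := coordsAt_homSuperdomain _ _ _ x a

/-- A morphism to a superdomain is known from its coordinates, so the pasting equation says that `g`
factors a fixed morphism through an open inclusion. Existence and uniqueness follow from `lift_incl`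
and `incl_mono`. -/
theorem isPasting_iff_eq_transHom
    (g : (chart k m).restrict (overlap J I) ⟶ (chart k m).restrict (overlap I J)) :
    IsPasting I J g ↔ g ≫ (chart k m).incl (overlap I J) = transHom I J := by
  rw [isPasting_iff]
  constructor
  · exact fun h => hom_superdomain_ext fun x a => by rw [h, coordsAt_transHom]
  · intro h x a
    rw [h, coordsAt_transHom]

theorem mem_overlap_self (I : KIndex k m) (x : Fin (grDim k m 0) → ℝ) : x ∈ overlap I I := by
  rw [KIndex.overlap_self]
  exact Opens.mem_top _

theorem mem_overlap_swap {x : Fin (grDim k m 0) → ℝ} (h : x ∈ overlap J I) :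
    body (J.trans I x) ∈ overlap I J := KIndex.body_trans_mem h (mem_overlap_self J x)

theorem existsUnique_isPasting (I J : KIndex k m) : ∃! g, IsPasting I J g := by
  refine ⟨lift (transHom I J) (overlap I J) fun x => mem_overlap_swap x.2, ?_, fun g hg => ?_⟩
  · exact (isPasting_iff_eq_transHom _).mpr (lift_incl _ _ _)
  · exact incl_mono (((isPasting_iff_eq_transHom g).mp hg).trans (lift_incl _ _ _).symm)

theorem eq_id_of_isPasting {g : (chart k m).restrict (overlap I I) ⟶ (chart k m).restrict (overlap I I)}
    (h : IsPasting I I g) : g = 𝟙 _ := by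
  refine incl_mono (hom_superdomain_ext fun x a => ?_)
  rw [Category.id_comp]
  exact ((isPasting_iff g).mp h x a).trans (KIndex.trans_self I x.1 a)

theorem comp_eq_id_of_isPasting
    {g : (chart k m).restrict (overlap J I) ⟶ (chart k m).restrict (overlap I J)}
    {g' : (chart k m).restrict (overlap I J) ⟶ (chart k m).restrict (overlap J I)}
    (h : IsPasting I J g) (h' : IsPasting J I g') : g' ≫ g = 𝟙 _ := by
  refine incl_mono (hom_superdomain_ext fun x a => ?_)
  rw [Category.id_comp, Category.assoc, coordsAt_comp g' (g ≫ (chart k m).incl (overlap I J))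
    (fun y => J.trans I y a) a fun y => (isPasting_iff g).mp h y a]
  have h1 : coordsAt (g' ≫ (chart k m).incl (overlap J I)) x = I.trans J x.1 :=
    funext ((isPasting_iff g').mp h' x)
  rw [h1]
  exact (KIndex.subst_trans x.2 (mem_overlap_self I x.1) a).trans (KIndex.trans_self I x.1 a)

/-- The restriction is built by lifting the coordinate change itself, so its coordinates are known
without further computation. -/
theorem exists_isRestriction {U V : Opens (chart k m)}
    {g : (chart k m).restrict (overlap J I) ⟶ (chart k m).restrict (overlap I J)}
    (h : IsPasting I J g) (hU : U ≤ overlap J I) (hV : V ≤ overlap I J)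
    (hUV : ∀ x ∈ U, body (J.trans I x) ∈ V) :
    ∃ g' : (chart k m).restrict U ⟶ (chart k m).restrict V, IsRestriction g g' ∧
      ∀ x a, coordsAt (g' ≫ (chart k m).incl _) x a = J.trans I x.1 a := by
  let p : (chart k m).restrict U ⟶ chart k m := (chart k m).inclLE hU ≫ transHom I J
  have hp : ∀ x, p.toHom.hom.base x ∈ V := fun x => hUV x.1 x.2
  refine ⟨lift p _ hp, ⟨hU, hV, incl_mono ?_⟩, fun x a => ?_⟩
  · rw [Category.assoc, Category.assoc, inclLE_incl, lift_incl, (isPasting_iff_eq_transHom g).mp h]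
  · rw [lift_incl]
    exact coordsAt_transHom (I := I) (J := J) ⟨x.1, hU x.2⟩ a

theorem cocycle_of_isPasting {g : Transitions k m} (hg : ∀ I J, IsPasting I J (g I J))
    (I J S : KIndex k m) : Cocycle g I J S := by
  obtain ⟨gIJ, h1, hIJ⟩ := exists_isRestriction (U := overlap J I ⊓ overlap J S)
    (V := overlap I J ⊓ overlap I S) (hg I J) inf_le_left inf_le_left
    fun x hx => ⟨mem_overlap_swap hx.1, KIndex.body_trans_mem hx.1 hx.2⟩
  obtain ⟨gJS, h2, hJS⟩ := exists_isRestriction (U := overlap S I ⊓ overlap S J)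
    (V := overlap J I ⊓ overlap J S) (hg J S) inf_le_right inf_le_right
    fun x hx => ⟨KIndex.body_trans_mem hx.2 hx.1, mem_overlap_swap hx.2⟩
  obtain ⟨gSI, h3, hSI⟩ := exists_isRestriction (U := overlap I J ⊓ overlap I S)
    (V := overlap S I ⊓ overlap S J) (hg S I) inf_le_right inf_le_left
    fun x hx => ⟨mem_overlap_swap hx.2, KIndex.body_trans_mem hx.2 hx.1⟩
  refine ⟨gIJ, gJS, gSI, h1, h2, h3, incl_mono (hom_superdomain_ext fun x a => ?_)⟩
  have hSI' : ∀ y, coordsAt (gSI ≫ (chart k m).incl _) y = I.trans S y.1 := fun y => funext (hSI y)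
  have hJS' : ∀ y, coordsAt (gJS ≫ (chart k m).incl _) y = S.trans J y.1 := fun y => funext (hJS y)
  -- The composition law is applied twice: here from `S` through `J` to `I`, and below from `I`
  -- through `S` back to `I`, where the coordinate change is the identity.
  have h4 : ∀ y, coordsAt (gJS ≫ gIJ ≫ (chart k m).incl _) y a = S.trans I y.1 a := fun y => by
    rw [coordsAt_comp gJS _ (fun z => J.trans I z a) a fun z => hIJ z a, hJS']
    exact KIndex.subst_trans y.2.2 y.2.1 a
  rw [Category.id_comp, Category.assoc, Category.assoc,
    coordsAt_comp gSI _ (fun y => S.trans I y a) a h4, hSI']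
  exact (KIndex.subst_trans x.2.2 (mem_overlap_self I x.1) a).trans (KIndex.trans_self I x.1 a)

end pasting

/-! ### The topological space obtained by gluing -/

open PSeries Z2nRingedSpace

/-- Data for gluing copies of `ℝ^d`: open subsets `V i j` of the `i`-th copy, and on them the
coordinates of the `j`-th copy as functions of those of the `i`-th copy. -/
structure GluingDatum (d : Z2n n → ℕ) (ι : Type) where
  V : ι → ι → Opens (Fin (d 0) → ℝ)
  s : ι → ι → (Fin (d 0) → ℝ) → Idx d → PSeries d
  smooth : ∀ i j a, (fun x : V i j => s i j x.1 a) ∈ smoothSeries d (V i j)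
  hasDegrees : ∀ i j x, x ∈ V i j → HasDegrees (s i j x)
  mem_self : ∀ i x, x ∈ V i i
  s_self : ∀ i x a, s i i x a = coordAt a x
  body_mem : ∀ i j k x, x ∈ V i j → x ∈ V i k → body (s i j x) ∈ V j k
  subst_s : ∀ i j k x, x ∈ V i j → x ∈ V i k → ∀ a, subst (s i j x) (fun y => s j k y a) = s i k x a

namespace GluingDatum

variable {d : Z2n n → ℕ} {ι : Type} (D : GluingDatum d ι)

theorem body_self (i : ι) (x : Fin (d 0) → ℝ) : body (D.s i i x) = x := by
  have : D.s i i x = fun a => coordAt a x := funext (D.s_self i x)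
  rw [this, body_coordAt]

theorem body_comp {i j k : ι} {x : Fin (d 0) → ℝ} (hj : x ∈ D.V i j) (hk : x ∈ D.V i k) :
    body (D.s j k (body (D.s i j x))) = body (D.s i k x) := by
  funext l
  change coeff 0 _ = coeff 0 _
  rw [← D.subst_s i j k x hj hk, coeff_zero_subst]

theorem body_mem_swap {i j : ι} {x : Fin (d 0) → ℝ} (h : x ∈ D.V i j) :
    body (D.s i j x) ∈ D.V j i := D.body_mem i j i x h (D.mem_self i x)

theorem body_body {i j : ι} {x : Fin (d 0) → ℝ} (h : x ∈ D.V i j) :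
    body (D.s j i (body (D.s i j x))) = x := by
  rw [D.body_comp h (D.mem_self i x), body_self]

/-- The disjoint union of the copies of `ℝ^d`. -/
abbrev Pts (_ : GluingDatum d ι) : Type := Σ _ : ι, (Fin (d 0) → ℝ)

/-- Points are identified by the coordinate changes. -/
def rel : Setoid D.Pts where
  r p q := p.2 ∈ D.V p.1 q.1 ∧ body (D.s p.1 q.1 p.2) = q.2
  iseqv :=
    { refl := fun p => ⟨D.mem_self _ _, D.body_self _ _⟩
      symm := by
        rintro ⟨i, x⟩ ⟨j, y⟩ h
        obtain ⟨h, rfl⟩ : x ∈ D.V i j ∧ body (D.s i j x) = y := h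
        exact ⟨D.body_mem_swap h, D.body_body h⟩
      trans := by
        rintro ⟨i, x⟩ ⟨j, y⟩ ⟨k, z⟩ h h'
        obtain ⟨h, rfl⟩ : x ∈ D.V i j ∧ body (D.s i j x) = y := h
        obtain ⟨h', rfl⟩ : body (D.s i j x) ∈ D.V j k ∧ body (D.s j k (body (D.s i j x))) = z := h'
        -- Moving back from the `j`-th copy to the `i`-th shows that the starting point `x` belongs
        -- to `V i k`.
        have h1 := D.body_mem j i k _ (D.body_mem_swap h) h'
        rw [D.body_body h] at h1
        exact ⟨h1, (D.body_comp h h1).symm⟩ }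

/-- The space obtained by gluing. -/
def Carrier : Type := Quotient D.rel

instance : TopologicalSpace D.Carrier := inferInstanceAs (TopologicalSpace (Quotient D.rel))

def mkPt (p : D.Pts) : D.Carrier := Quotient.mk D.rel p

/-- The `i`-th copy of `ℝ^d` as a subspace of the glued space. -/
def π (i : ι) (x : Fin (d 0) → ℝ) : D.Carrier := D.mkPt ⟨i, x⟩

variable {D}

theorem π_eq_iff {i j : ι} {x y : Fin (d 0) → ℝ} :
    D.π i x = D.π j y ↔ x ∈ D.V i j ∧ body (D.s i j x) = y := Quotient.eq (r := D.rel)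

theorem π_body {i j : ι} {x : Fin (d 0) → ℝ} (h : x ∈ D.V i j) : D.π j (body (D.s i j x)) = D.π i x :=
  (π_eq_iff.mpr ⟨h, rfl⟩).symm

theorem exists_π_eq (p : D.Carrier) : ∃ i x, D.π i x = p := by
  obtain ⟨⟨i, x⟩, h⟩ := Quotient.exists_rep p
  exact ⟨i, x, h⟩

theorem continuous_π (i : ι) : Continuous (D.π i) := by
  have h : Continuous (D.mkPt) := continuous_quotient_mk'
  exact h.comp (continuous_sigmaMk (σ := fun _ : ι => Fin (d 0) → ℝ))

theorem isOpen_carrier_iff {W : Set D.Carrier} : IsOpen W ↔ ∀ i, IsOpen (D.π i ⁻¹' W) := by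
  refine ⟨fun h i => h.preimage (continuous_π i), fun h => ?_⟩
  have h1 : IsOpen (D.mkPt ⁻¹' W) := isOpen_sigma_iff.mpr h
  exact h1

theorem continuousOn_body (i j : ι) : ContinuousOn (fun x => body (D.s i j x)) (D.V i j) :=
  continuousOn_iff_continuous_domRestrict.mpr
    (continuous_body (s := fun x : D.V i j => D.s i j x.1) (D.smooth i j))

theorem isOpenMap_π (i : ι) : IsOpenMap (D.π i) := by
  intro B hB
  rw [isOpen_carrier_iff]
  intro j
  -- The trace of the image on the `j`-th copy is the preimage of `B` under the coordinate change,
  -- which is continuous on the open set `V j i`.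
  have h : D.π j ⁻¹' (D.π i '' B) = (D.V j i : Set _) ∩ (fun x => body (D.s j i x)) ⁻¹' B := by
    ext y
    constructor
    · rintro ⟨x, hx, h⟩
      obtain ⟨h1, h2⟩ := π_eq_iff.mp h.symm
      exact ⟨h1, by rw [Set.mem_preimage, h2]; exact hx⟩
    · rintro ⟨h1, h2⟩
      exact ⟨_, h2, π_body h1⟩
  rw [h]
  exact (continuousOn_body j i).isOpen_inter_preimage (D.V j i).isOpen hB

theorem π_injective (i : ι) : Function.Injective (D.π i) := fun x y h => by
  rw [← (π_eq_iff.mp h).2, D.body_self]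

theorem isOpenEmbedding_π (i : ι) : Topology.IsOpenEmbedding (D.π i) :=
  .of_continuous_injective_isOpenMap (continuous_π i) (π_injective i) (isOpenMap_π i)

theorem secondCountableTopology_carrier [Countable ι] : SecondCountableTopology D.Carrier := by
  have h : ∀ i : ι, SecondCountableTopology (Set.range (D.π i)) := fun i =>
    (isOpenEmbedding_π i).toIsEmbedding.toHomeomorph.symm.secondCountableTopology
  refine secondCountableTopology_of_countable_cover (fun i => (isOpenEmbedding_π i).isOpen_range) ?_
  refine Set.eq_univ_of_forall fun p => ?_
  obtain ⟨i, x, rfl⟩ := exists_π_eq p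
  exact Set.mem_iUnion.mpr ⟨i, x, rfl⟩

/-- A pair of points outside a closed graph has a product neighbourhood that misses it; its two
factors have open images, which are disjoint because no point of one is glued to a point of the
other. -/
theorem t2Space_carrier (h : ∀ i j, IsClosed {p : (Fin (d 0) → ℝ) × (Fin (d 0) → ℝ) |
    p.1 ∈ D.V i j ∧ body (D.s i j p.1) = p.2}) : T2Space D.Carrier := by
  refine ⟨fun p q hpq => ?_⟩
  obtain ⟨i, x, rfl⟩ := exists_π_eq p
  obtain ⟨j, y, rfl⟩ := exists_π_eq q
  have h1 : (x, y) ∈ {p : (Fin (d 0) → ℝ) × (Fin (d 0) → ℝ) |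
    p.1 ∈ D.V i j ∧ body (D.s i j p.1) = p.2}ᶜ := fun h2 => hpq (π_eq_iff.mpr h2)
  obtain ⟨A, B, hA, hB, hx, hy, hAB⟩ := isOpen_prod_iff.mp (h i j).isOpen_compl x y h1
  refine ⟨_, _, isOpenMap_π i A hA, isOpenMap_π j B hB, ⟨x, hx, rfl⟩, ⟨y, hy, rfl⟩, ?_⟩
  rw [Set.disjoint_left]
  rintro _ ⟨a, ha, rfl⟩ ⟨b, hb, hab⟩
  exact hAB (Set.mk_mem_prod ha hb) (π_eq_iff.mp hab.symm)

end GluingDatum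

/-! ### The structure sheaf of the glued space -/

open PSeries Z2nRingedSpace

/-- The homogeneous component of a section. -/
def projSec {d : Z2n n → ℕ} {U : Opens (Fin (d 0) → ℝ)} (γ : Z2n n) (f : smoothSeries d U) :
    smoothSeries d U := (smoothSeriesProj d U γ f).1

theorem sum_projSec {d : Z2n n → ℕ} {U : Opens (Fin (d 0) → ℝ)} (f : smoothSeries d U) :
    ∑ γ, projSec γ f = f := by
  refine Subtype.ext (funext fun x => ?_)
  change evalSec x (∑ γ, projSec γ f) = evalSec x f
  rw [map_sum]
  exact sum_proj (f.1 x)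

/-- Substitution of a family with the right degrees preserves degrees, so it commutes with taking
components. Hence the components of a compatible family are compatible. -/
theorem substHom_projSec {d d' : Z2n n → ℕ} {U : Opens (Fin (d 0) → ℝ)} {s : Idx d → PSeries d'}
    (hs : HasDegrees s) (hU : body s ∈ U) (γ : Z2n n) (f : smoothSeries d U) :
    substHom s hs hU (projSec γ f) = proj γ (substHom s hs hU f) := by
  have h : ∀ δ, IsHomog δ (substHom s hs hU (projSec δ f)) := fun δ => by
    refine isHomog_subst hs ?_
    filter_upwards [U.isOpen.mem_nhds hU] with z hz
    rw [extendSec_apply' _ hz]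
    exact isHomog_proj δ _
  conv_rhs => rw [← sum_projSec f, map_sum, map_sum]
  rw [Finset.sum_eq_single γ]
  · exact (proj_of_isHomog (h γ)).symm
  · exact fun δ _ hδ => proj_of_isHomog_ne (h δ) hδ
  · simp

/-- A module with enough maps to formal series is the direct sum of its homogeneous parts, if
homogeneous components exist. -/
theorem isInternal_of_eval {d : Z2n n → ℕ} {M Q : Type} [AddCommGroup M] [Module ℝ M]
    (ev : Q → M →ₗ[ℝ] PSeries d) (hext : ∀ f g, (∀ q, ev q f = ev q g) → f = g)
    (gr : Z2n n → Submodule ℝ M) (hgr : ∀ γ f, f ∈ gr γ ↔ ∀ q, IsHomog γ (ev q f))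
    (P : Z2n n → M → M) (hP : ∀ γ f q, ev q (P γ f) = proj γ (ev q f)) : DirectSum.IsInternal gr := by
  classical
  have hev : ∀ (v : DirectSum (Z2n n) fun γ => gr γ) (q : Q) (δ : Z2n n),
      proj δ (ev q (DirectSum.coeAddMonoidHom gr v)) = ev q (v δ).1 := by
    intro v q δ
    rw [DirectSum.coeAddMonoidHom_eq_dfinsuppSum, DFinsupp.sum_eq_sum_fintype _ (fun _ => rfl),
      map_sum, map_sum, Finset.sum_eq_single δ]
    · exact proj_of_isHomog ((hgr δ _).mp (v δ).2 q)
    · exact fun γ _ hγ => proj_of_isHomog_ne ((hgr γ _).mp (v γ).2 q) hγ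
    · simp
  constructor
  · intro v w hvw
    exact DFinsupp.ext fun γ => Subtype.ext (hext _ _ fun q => by rw [← hev v, ← hev w, hvw])
  · intro f
    have hmem : ∀ γ, P γ f ∈ gr γ := fun γ => (hgr γ _).mpr fun q => by
      rw [hP]
      exact isHomog_proj γ _
    refine ⟨DirectSum.mk _ Finset.univ fun γ => ⟨P γ f, hmem γ⟩, hext _ _ fun q => ?_⟩
    rw [← sum_proj (ev q (DirectSum.coeAddMonoidHom gr _)), ← sum_proj (ev q f)]
    refine Finset.sum_congr rfl fun γ _ => ?_
    rw [hev, DirectSum.mk_apply_of_mem (Finset.mem_univ _)]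
    exact hP γ f q

namespace GluingDatum

variable {d : Z2n n → ℕ} {ι : Type} (D : GluingDatum d ι)

/-- The part of the `i`-th copy of `ℝ^d` which lies in `W`. -/
def pre (i : ι) (W : Opens D.Carrier) : Opens (Fin (d 0) → ℝ) :=
  ⟨D.π i ⁻¹' W, W.isOpen.preimage (continuous_π i)⟩

/-- The values at `p` of a section of the structure sheaf: one in each copy of `ℝ^d` to which `p`
belongs. -/
abbrev Fib (p : D.Carrier) : Type := {q : D.Pts // D.mkPt q = p} → PSeries d

variable {D} {W W' : Opens D.Carrier}

/-- The part of a section on the `i`-th copy of `ℝ^d`. -/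
def loc (F : ∀ p : W, D.Fib p) (i : ι) : D.pre i W → PSeries d :=
  fun x => F ⟨D.π i x.1, x.2⟩ ⟨⟨i, x.1⟩, rfl⟩

/-- The sections of the structure sheaf: their parts on the copies of `ℝ^d` are smooth and are
compatible with the coordinate changes. -/
def IsGlued (F : ∀ p : W, D.Fib p) : Prop :=
  (∀ i, loc F i ∈ smoothSeries d (D.pre i W)) ∧
    ∀ i j (x : Fin (d 0) → ℝ) (hx : x ∈ D.pre i W), x ∈ D.V i j →
      loc F i ⟨x, hx⟩ = subst (D.s i j x) (Function.extend Subtype.val (loc F j) 0)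

theorem body_mem_pre {i j : ι} {x : Fin (d 0) → ℝ} (hx : x ∈ D.pre i W) (h : x ∈ D.V i j) :
    body (D.s i j x) ∈ D.pre j W := by
  change D.π j _ ∈ W
  rw [π_body h]
  exact hx

theorem extend_loc_restrict (hle : W' ≤ W) (F : ∀ p : W, D.Fib p) (j : ι) {y : Fin (d 0) → ℝ}
    (hy : y ∈ D.pre j W') :
    Function.extend Subtype.val (loc (W := W') (fun p => F ⟨p.1, hle p.2⟩) j) 0 =ᶠ[nhds y]
      Function.extend Subtype.val (loc F j) 0 := by
  filter_upwards [(D.pre j W').isOpen.mem_nhds hy] with z hz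
  have h1 := Subtype.val_injective.extend_apply (loc (W := W') (fun p => F ⟨p.1, hle p.2⟩) j) 0
    (⟨z, hz⟩ : D.pre j W')
  have h2 := Subtype.val_injective.extend_apply (loc F j) 0 (⟨z, hle hz⟩ : D.pre j W)
  exact h1.trans h2.symm

theorem IsGlued.restrict (hle : W' ≤ W) {F : ∀ p : W, D.Fib p} (hF : IsGlued F) :
    IsGlued (W := W') fun p => F ⟨p.1, hle p.2⟩ := by
  refine ⟨fun i α => (hF.1 i α).res fun x hx => hle hx, fun i j x hx hV => ?_⟩
  refine (hF.2 i j x (hle hx) hV).trans (subst_congr ?_).symm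
  exact extend_loc_restrict hle F j (body_mem_pre hx hV)

/-- The condition on sections is local. -/
def localPredicate (D : GluingDatum d ι) :
    TopCat.LocalPredicate fun p : TopCat.of D.Carrier => D.Fib p where
  pred {_} F := IsGlued F
  res := fun i _ hF => hF.restrict i.le
  locality := fun {W} F hF => by
    refine ⟨fun i α => SmoothOn.of_locally fun x => ?_, fun i j x hx hV => ?_⟩
    · obtain ⟨W', hx, k, h⟩ := hF ⟨D.π i x.1, x.2⟩
      exact ⟨D.pre i W', hx, fun y hy => k.le hy, h.1 i α⟩
    · obtain ⟨W', hx', k, h⟩ := hF ⟨D.π i x, hx⟩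
      refine (h.2 i j x hx' hV).trans (subst_congr ?_)
      exact extend_loc_restrict k.le F j (body_mem_pre hx' hV)

/-- Compatibility in terms of homomorphisms. -/
theorem substHom_loc {F : ∀ p : W, D.Fib p} (hF : IsGlued F) {i j : ι} {x : Fin (d 0) → ℝ}
    (hx : x ∈ D.pre i W) (hV : x ∈ D.V i j) : substHom (D.s i j x) (D.hasDegrees i j x hV)
      (body_mem_pre hx hV) ⟨loc F j, hF.1 j⟩ = loc F i ⟨x, hx⟩ := (hF.2 i j x hx hV).symm

/-- The algebra of sections of the structure sheaf. -/
def sections (D : GluingDatum d ι) (W : Opens D.Carrier) : Subalgebra ℝ (∀ p : W, D.Fib p) where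
  carrier := {F | IsGlued F}
  mul_mem' := fun {F G} hF hG => by
    refine ⟨fun i => (smoothSeries d _).mul_mem (hF.1 i) (hG.1 i), fun i j x hx hV => ?_⟩
    change loc F i ⟨x, hx⟩ * loc G i ⟨x, hx⟩ = _
    rw [← substHom_loc hF hx hV, ← substHom_loc hG hx hV, ← map_mul]
    rfl
  add_mem' := fun {F G} hF hG => by
    refine ⟨fun i => (smoothSeries d _).add_mem (hF.1 i) (hG.1 i), fun i j x hx hV => ?_⟩
    change loc F i ⟨x, hx⟩ + loc G i ⟨x, hx⟩ = _
    rw [← substHom_loc hF hx hV, ← substHom_loc hG hx hV, ← map_add]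
    rfl
  algebraMap_mem' := fun c => by
    refine ⟨fun i => (smoothSeries d _).algebraMap_mem c, fun i j x hx hV => ?_⟩
    exact ((substHom (D.s i j x) (D.hasDegrees i j x hV) (body_mem_pre hx hV)).commutes c).symm

/-- Restriction of sections. -/
def sectionsRes (hle : W' ≤ W) : D.sections W →ₐ[ℝ] D.sections W' where
  toFun F := ⟨fun p => F.1 ⟨p.1, hle p.2⟩, IsGlued.restrict hle F.2⟩
  map_one' := rfl
  map_mul' _ _ := rfl
  map_zero' := rfl
  map_add' _ _ := rfl
  commutes' _ := rfl

/-- The structure presheaf. -/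
def presheaf (D : GluingDatum d ι) : TopCat.Presheaf (AlgCat.{0} ℝ) (TopCat.of D.Carrier) where
  obj W := AlgCat.of ℝ (D.sections W.unop)
  map i := AlgCat.ofHom (sectionsRes i.unop.le)
  map_id _ := rfl
  map_comp _ _ := rfl

theorem presheaf_isSheaf (D : GluingDatum d ι) : D.presheaf.IsSheaf := by
  rw [TopCat.Presheaf.isSheaf_iff_isSheaf_comp (CategoryTheory.forget (AlgCat.{0} ℝ))]
  exact TopCat.subpresheafToTypes.isSheaf D.localPredicate

/-- The part of a section on the `i`-th copy of `ℝ^d`, as a homomorphism. -/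
def locHom (i : ι) (W : Opens D.Carrier) : D.sections W →ₐ[ℝ] smoothSeries d (D.pre i W) where
  toFun F := ⟨loc F.1 i, F.2.1 i⟩
  map_one' := rfl
  map_mul' _ _ := rfl
  map_zero' := rfl
  map_add' _ _ := rfl
  commutes' _ := rfl

theorem subst_locHom (F : D.sections W) {i j : ι} {x : Fin (d 0) → ℝ} (hx : x ∈ D.pre i W)
    (hV : x ∈ D.V i j) : subst (D.s i j x) (extendSec (locHom j W F)) = (locHom i W F).1 ⟨x, hx⟩ :=
  substHom_loc F.2 hx hV

theorem sections_ext {F G : D.sections W} (h : ∀ i x, (locHom i W F).1 x = (locHom i W G).1 x) :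
    F = G := by
  have key : ∀ (p : D.Carrier) (hp : p ∈ W) (q : D.Pts) (hq : D.mkPt q = p),
      F.1 ⟨p, hp⟩ ⟨q, hq⟩ = G.1 ⟨p, hp⟩ ⟨q, hq⟩ := by
    rintro _ hp ⟨i, x⟩ rfl
    exact h i ⟨x, hp⟩
  exact Subtype.ext (funext fun p => funext fun q => key p.1 p.2 q.1 q.2)

/-- The homogeneous sections. -/
def sectionsGr (D : GluingDatum d ι) (W : Opens D.Carrier) (γ : Z2n n) :
    Submodule ℝ (D.sections W) where
  carrier := {F | ∀ i x, IsHomog γ ((locHom i W F).1 x)}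
  add_mem' := fun hF hG i x => (hF i x).add (hG i x)
  zero_mem' := fun _ _ => isHomog_zero γ
  smul_mem' := fun c _ hF i x => (hF i x).smul c

theorem sections_isInternal (D : GluingDatum d ι) (W : Opens D.Carrier) :
    DirectSum.IsInternal (D.sectionsGr W) := by
  refine isInternal_of_eval (Q := Σ i, D.pre i W)
    (fun q => ((evalSec q.2).comp (locHom q.1 W)).toLinearMap)
    (fun F G h => sections_ext fun i x => h ⟨i, x⟩) _ (fun γ F => ?_)
    (fun γ F => ⟨fun p q => proj γ (F.1 p q), fun i => (projSec γ (locHom i W F)).2,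
      fun i j x hx hV => ?_⟩) fun γ F q => rfl
  · exact ⟨fun h q => h q.1 q.2, fun h i x => h ⟨i, x⟩⟩
  · refine (congrArg (proj γ) (substHom_loc F.2 hx hV)).symm.trans ?_
    exact (substHom_projSec (D.hasDegrees i j x hV) (body_mem_pre hx hV) γ (locHom j W F)).symm

/-- The `ℤ₂ⁿ`-ringed space obtained by gluing. -/
def glued (D : GluingDatum d ι) : Z2nRingedSpace n where
  carrier := TopCat.of D.Carrier
  presheaf := D.presheaf
  IsSheaf := D.presheaf_isSheaf
  gr W γ := D.sectionsGr W γ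
  isInternal W := D.sections_isInternal W
  one_mem _ := fun _ _ => isHomog_one
  mul_mem _ _ _ _ _ ha hb := fun i x => isHomog_mul (ha i x) (hb i x)
  comm _ _ _ _ _ ha hb := sections_ext fun i x => isHomog_comm (ha i x) (hb i x)
  res_mem _ _ h _ _ ha := fun i x => ha i ⟨x.1, h x.2⟩

end GluingDatum

/-! ### Charts of the glued space -/

open PSeries Z2nRingedSpace

namespace GluingDatum

variable {d : Z2n n → ℕ} {ι : Type} {D : GluingDatum d ι}

section spread

variable {i : ι} {A : Opens D.Carrier} {B : Opens (Fin (d 0) → ℝ)}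

theorem mem_of_pre (hAB : ∀ p ∈ A, ∃ x ∈ B, D.π i x = p) {j : ι} {y : Fin (d 0) → ℝ}
    (hy : y ∈ D.pre j A) : y ∈ D.V j i ∧ body (D.s j i y) ∈ B := by
  obtain ⟨x, hx, h⟩ := hAB _ hy
  obtain ⟨h1, h2⟩ := π_eq_iff.mp h.symm
  exact ⟨h1, h2 ▸ hx⟩

/-- The section on `A ⊆ π_i(B)` with prescribed part on the `i`-th copy of `ℝ^d`. -/
def spread (hAB : ∀ p ∈ A, ∃ x ∈ B, D.π i x = p) : smoothSeries d B →ₐ[ℝ] D.sections A :=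
  let Φ (q : Σ j, D.pre j A) := substHom (D.s q.1 i q.2.1)
    (D.hasDegrees q.1 i _ (mem_of_pre hAB q.2.2).1) (mem_of_pre hAB q.2.2).2
  { toFun := fun f => ⟨fun _ q => subst (D.s q.1.1 i q.1.2) (extendSec f), by
      have hs : ∀ j a, (fun y : D.pre j A => D.s j i y.1 a) ∈ smoothSeries d (D.pre j A) :=
        fun j a α => (D.smooth j i a α).res fun y hy => (mem_of_pre hAB hy).1
      refine ⟨fun j => subst_mem_smoothSeries (hs j) (fun y => (mem_of_pre hAB y.2).2)
        (contDiffOn_extendSec f), fun j k y hy hV => ?_⟩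
      let Ψ : smoothSeries d B →ₐ[ℝ] smoothSeries d (D.pre k A) :=
        substPull (fun z : D.pre k A => D.s k i z.1) (hs k)
          (fun z => D.hasDegrees k i _ (mem_of_pre hAB z.2).1) fun z => (mem_of_pre hAB z.2).2
      have hd := D.hasDegrees j k y hV
      have hb : body (D.s j k y) ∈ D.pre k A := body_mem_pre hy hV
      -- Substituting first along `k → i` and then along `j → k` agrees with substituting along `j →
      -- i`: both are homomorphisms with the same values on coordinates, by the composition law.
      have key : (substHom (D.s j k y) hd hb).comp Ψ = Φ ⟨j, ⟨y, hy⟩⟩ := by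
        refine eq_substHom _ _ fun a => ?_
        refine Eq.trans ?_ (D.subst_s j k i y hV (mem_of_pre hAB hy).1 a)
        refine subst_congr (eventuallyEq_extendSec (W := D.pre k A) _ hb fun z => ?_)
        exact substHom_coordSec (D.s k i z.1) (D.hasDegrees k i _ (mem_of_pre hAB z.2).1)
          (mem_of_pre hAB z.2).2 a
      exact (DFunLike.congr_fun key f).symm⟩
    map_one' := sections_ext fun j y => map_one (Φ ⟨j, y⟩)
    map_mul' := fun f g => sections_ext fun j y => map_mul (Φ ⟨j, y⟩) f g
    map_zero' := sections_ext fun j y => map_zero (Φ ⟨j, y⟩)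
    map_add' := fun f g => sections_ext fun j y => map_add (Φ ⟨j, y⟩) f g
    commutes' := fun c => sections_ext fun j y => (Φ ⟨j, y⟩).commutes c }

variable (hAB : ∀ p ∈ A, ∃ x ∈ B, D.π i x = p)

theorem mem_of_pre_self (hAB : ∀ p ∈ A, ∃ x ∈ B, D.π i x = p) {x : Fin (d 0) → ℝ} (hx : x ∈ D.pre i A) : x ∈ B := by
  have := (mem_of_pre hAB hx).2
  rwa [body_self] at this

theorem locHom_spread (f : smoothSeries d B) (x : D.pre i A) :
    (locHom i A (spread hAB f)).1 x = f.1 ⟨x.1, mem_of_pre_self hAB x.2⟩ := by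
  have hx := mem_of_pre hAB x.2
  have key : evalSec ⟨x.1, mem_of_pre_self hAB x.2⟩ =
      substHom (D.s i i x.1) (D.hasDegrees i i _ hx.1) hx.2 :=
    eq_substHom _ _ fun a => (D.s_self i x.1 a).symm
  exact (DFunLike.congr_fun key f).symm

/-- A section over a set inside one chart is determined by its part on that chart. Together with
`locHom_spread` this makes the charts isomorphisms. -/
theorem spread_locHom {W : Opens D.Carrier} (hW : A ≤ W) (F : D.sections W) (hB : B ≤ D.pre i W) :
    spread hAB (smoothSeriesRes d hB (locHom i W F)) = sectionsRes hW F := by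
  refine sections_ext fun j y => ?_
  have hy := mem_of_pre hAB y.2
  refine Eq.trans ?_ (subst_locHom F (i := j) (j := i) (hW y.2) hy.1)
  refine subst_congr (eventuallyEq_extendSec _ hy.2 fun z => ?_)
  exact (extendSec_apply' (locHom i W F) (hB z.2)).symm

end spread

variable (D)

/-- The open embedding of the `i`-th copy of `ℝ^d`. -/
def chartHom (i : ι) : superdomain d ⟶ D.glued where
  toHom := InducedCategory.homMk
    { base := TopCat.ofHom ⟨D.π i, continuous_π i⟩
      c :=
      { app := fun W => AlgCat.ofHom (locHom i W.unop)
        naturality := fun _ _ _ => rfl } }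
  weight_zero _ _ _ hF := hF i
  isLocal W F x := by
    rintro ⟨B, hB, hxB, hu⟩
    have hB' : B ≤ D.pre i W := hB
    let B' : Opens (Fin (d 0) → ℝ) := B
    -- The part on the chart is a unit over `B`. Spreading it over the open set `π_i(B)` recovers
    -- the restriction of `F`, which is therefore a unit there.
    let A : Opens D.Carrier := ⟨D.π i '' B', isOpenMap_π i _ B'.isOpen⟩
    have hAB : ∀ p ∈ A, ∃ x ∈ B', D.π i x = p := fun p hp => hp
    have hA : A ≤ W := by
      rintro _ ⟨y, hy, rfl⟩
      exact hB hy
    refine ⟨A, hA, ⟨x, hxB, rfl⟩, ?_⟩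
    have hu' : IsUnit (smoothSeriesRes d hB' (locHom i W F)) := hu
    exact (congrArg IsUnit (spread_locHom hAB hA F hB')).mp (hu'.map (spread hAB))

/-- The part of the glued space which is covered by the `i`-th copy of `ℝ^d`. -/
def chartRange (i : ι) : Opens D.Carrier := ⟨Set.range (D.π i), (isOpenEmbedding_π i).isOpen_range⟩

/-- The coordinates on the `i`-th part of the glued space. -/
def chartInv (i : ι) (w : D.chartRange i) : Fin (d 0) → ℝ := Classical.choose w.2

variable {D}

theorem π_chartInv {i : ι} (w : D.chartRange i) : D.π i (D.chartInv i w) = w.1 :=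
  Classical.choose_spec w.2

theorem chartInv_π {i : ι} (x : Fin (d 0) → ℝ) (h : D.π i x ∈ D.chartRange i) :
    D.chartInv i ⟨D.π i x, h⟩ = x := π_injective i (π_chartInv _)

theorem continuous_chartInv (i : ι) : Continuous (D.chartInv i) := by
  rw [(isOpenEmbedding_π i).continuous_iff]
  exact continuous_subtype_val.congr fun w => (π_chartInv w).symm

variable (D)

/-- The inverse of the `i`-th chart. -/
def chartInvHom (i : ι) : D.glued.restrict (D.chartRange i) ⟶ superdomain d :=
  let b : TopCat.of (D.chartRange i) ⟶ TopCat.of (Fin (d 0) → ℝ) :=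
    TopCat.ofHom ⟨D.chartInv i, continuous_chartInv i⟩
  have hAB : ∀ V : Opens (Fin (d 0) → ℝ), ∀ p ∈ D.glued.img (D.chartRange i) ((Opens.map b).obj V),
      ∃ x ∈ V, D.π i x = p := by
    rintro V _ ⟨w, hw, rfl⟩
    exact ⟨_, hw, π_chartInv w⟩
  { toHom := InducedCategory.homMk
      { base := b
        c :=
        { app := fun V => AlgCat.ofHom (spread (hAB V.unop))
          naturality := fun V V' h => by
            refine AlgCat.Hom.ext (AlgHom.ext fun f => sections_ext fun j y => ?_)
            refine subst_congr (eventuallyEq_extendSec (W := V'.unop) _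
              (mem_of_pre (hAB V'.unop) y.2).2 fun z => ?_)
            exact (extendSec_apply' (W := V.unop) f (h.unop.le z.2)).symm } }
    weight_zero := fun V γ f hf j y => by
      have hy := mem_of_pre (hAB V) y.2
      refine isHomog_subst (D.hasDegrees j i _ hy.1) ?_
      filter_upwards [V.isOpen.mem_nhds hy.2] with z hz
      exact (congrArg (IsHomog γ) (extendSec_apply' (W := V) f hz)).mpr (hf ⟨z, hz⟩)
    isLocal := fun V f w hu => by
      obtain ⟨W, hW, hw, hu⟩ := (unitNear_restrict _ w).mp hu
      have hwW : D.chartInv i w ∈ D.pre i W := by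
        have h : D.π i (D.chartInv i w) = w.1 := π_chartInv w
        exact (congrArg (fun p : D.glued => p ∈ W) h).mpr hw
      have hV : D.chartInv i w ∈ V := mem_of_pre_self (hAB V) (hW hwW)
      refine (unitNear_superdomain_iff f hV).mpr ?_
      -- The invertible restriction is evaluated in the `i`-th copy, where the spread section has
      -- the values of `f`.
      have h1 : IsUnit ((locHom i W (sectionsRes hW (spread (hAB V) f))).1 ⟨_, hwW⟩) :=
        IsUnit.map ((evalSec (⟨_, hwW⟩ : D.pre i W)).comp (locHom i W)) hu
      have h2 := locHom_spread (hAB V) f ⟨D.chartInv i w, hW hwW⟩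
      exact (((congrArg IsUnit h2).mp h1).map (value d)).ne_zero }

/-- The `i`-th chart of the glued space. -/
def chartIso (i : ι) : superdomain d ≅ D.glued.restrict (D.chartRange i) where
  hom := lift (D.chartHom i) (D.chartRange i) fun x => ⟨x, rfl⟩
  inv := D.chartInvHom i
  hom_inv_id := by
    refine hom_ext' _ _ (fun x => chartInv_π x _) fun V f => ?_
    refine Subtype.ext (funext fun x => ?_)
    have h := locHom_spread (i := i) (B := V) (A := D.glued.img (D.chartRange i)
      ((Opens.map (D.chartInvHom i).toHom.hom.base).obj V)) (by
        rintro _ ⟨w, hw, rfl⟩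
        exact ⟨_, hw, π_chartInv w⟩) f ⟨x.1, ⟨⟨D.π i x.1, ⟨x.1, rfl⟩⟩, x.2, rfl⟩⟩
    exact h
  inv_hom_id := by
    refine incl_mono ?_
    have hcomp : D.chartInvHom i ≫ D.chartHom i = D.glued.incl (D.chartRange i) := by
      refine hom_ext' _ _ (fun w => π_chartInv w) fun W F => ?_
      have h := spread_locHom (D := D) (i := i) (B := D.pre i W) (A := D.glued.img (D.chartRange i)
        ((Opens.map (D.chartInvHom i).toHom.hom.base).obj (D.pre i W))) (W := W) (by
          rintro _ ⟨w, hw, rfl⟩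
          exact ⟨_, hw, π_chartInv w⟩) (by
          rintro _ ⟨w, hw, rfl⟩
          have hw' : D.π i (D.chartInv i w) ∈ W := hw
          have h : D.π i (D.chartInv i w) = w.1 := π_chartInv w
          exact (congrArg (fun p : D.glued => p ∈ W) h).mp hw') F le_rfl
      exact h
    exact (Category.assoc _ _ _).trans ((congrArg (D.chartInvHom i ≫ ·) (lift_incl _ _ _)).trans
      (hcomp.trans (Category.id_comp _).symm))

theorem chartIso_hom_incl (i : ι) :
    (D.chartIso i).hom ≫ D.glued.incl (D.chartRange i) = D.chartHom i := lift_incl _ _ _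

end GluingDatum

open PSeries Z2nRingedSpace

/-! ### The Grassmannian -/

section grassmannian

variable {k m : Z2n n → ℕ}

theorem KIndex.continuous_labelAt (I : KIndex k m) :
    Continuous fun x : Fin (grDim k m 0) → ℝ => (I.labelAt x).map (coeff 0) := by
  refine continuous_matrix fun r c => continuousOn_univ.mp ?_
  refine (ContDiffOn.continuousOn (I.smoothOn_labelAt ⊤ r c 0)).congr fun x _ => ?_
  exact (SmoothOn.extend_apply (U := ⊤) (fun x => coeff 0 (I.labelAt x r c)) ⟨x, trivial⟩).symm

/-- The graph of a coordinate change is given by an equation. -/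
theorem KIndex.trans_graph_iff (I J : KIndex k m) (x y : Fin (grDim k m 0) → ℝ) :
    (x ∈ overlap I J ∧ body (I.trans J x) = y) ↔
      J.minor ((I.labelAt x).map (coeff 0)) * (J.labelAt y).map (coeff 0) =
        (I.labelAt x).map (coeff 0) := by
  have hmap : x ∈ overlap I J → J.minor ((I.labelAt x).map (coeff 0)) *
      (I.transAt J x).map (coeff 0) = (I.labelAt x).map (coeff 0) := fun h => by
    have h1 : J.minor (I.labelAt x) * I.transAt J x = I.labelAt x := by
      rw [transAt, ← Matrix.mul_assoc, Ring.mul_inverse_cancel _ (isUnit_minor_labelAt h),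
        Matrix.one_mul]
    have h2 := congrArg (fun A => A.map (value (grDim k m))) h1
    exact (Matrix.map_mul (f := (value (grDim k m)).toRingHom)).symm.trans h2
  constructor
  · rintro ⟨h, rfl⟩
    exact (congrArg _ (J.labelAt_body (isHomogMatrix_transAt h) (minor_transAt h))).trans (hmap h)
  · intro h
    -- The columns in `I` of the equation give a right inverse of `M_J A_I(x)`. Membership in the
    -- overlap is thus a consequence, and the equation alone describes the graph.
    have h1 : J.minor ((I.labelAt x).map (coeff 0)) * I.minor ((J.labelAt y).map (coeff 0)) = 1 := by
      rw [← minor_mul, h, minor_map, minor_labelAt]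
      exact Matrix.map_one (value (grDim k m)) (map_zero _) (map_one _)
    have hu : IsUnit (J.minor ((I.labelAt x).map (coeff 0))) := IsUnit.of_mul_eq_one _ h1
    have hx : x ∈ overlap I J := hu
    refine ⟨hx, funext fun l => ?_⟩
    obtain ⟨u, hu'⟩ := hu
    have h2 : (I.transAt J x).map (coeff 0) = (J.labelAt y).map (coeff 0) := by
      have h3 := (hmap hx).trans h.symm
      rw [← hu'] at h3
      have h4 := congrArg (fun A => (↑u⁻¹ : Matrix (Idx k) (Idx k) ℝ) * A) h3
      simpa only [← Matrix.mul_assoc, Units.inv_mul, Matrix.one_mul] using h4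
    have h5 : body (I.trans J x) l = coeff 0 (J.entries (J.labelAt y) ⟨0, l⟩) :=
      congrArg (fun A => J.entries A ⟨0, l⟩) h2
    rw [h5, entries_labelAt, coordAt_zero, coeff_zero_algebraMap]

instance : Countable (KIndex k m) :=
  Function.Injective.countable (f := KIndex.cols) fun I J h => by
    cases I
    cases J
    cases h
    rfl

/-- The data for gluing the charts of the Grassmannian. -/
def grassmannianDatum (k m : Z2n n → ℕ) : GluingDatum (grDim k m) (KIndex k m) where
  V := overlap
  s I J := I.trans J
  smooth _ _ a := KIndex.trans_mem_smoothSeries a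
  hasDegrees _ _ _ h := KIndex.trans_hasDegrees h
  mem_self := mem_overlap_self
  s_self I := I.trans_self
  body_mem _ _ _ _ hJ hK := KIndex.body_trans_mem hJ hK
  subst_s _ _ _ _ hJ hK := KIndex.subst_trans hJ hK

theorem GluingDatum.isSupermanifold_glued {d : Z2n n → ℕ} {ι : Type} [Countable ι]
    (D : GluingDatum d ι) (h : ∀ i j, IsClosed {p : (Fin (d 0) → ℝ) × (Fin (d 0) → ℝ) |
      p.1 ∈ D.V i j ∧ body (D.s i j p.1) = p.2}) : IsSupermanifold d D.glued := by
  refine ⟨D.t2Space_carrier h, D.secondCountableTopology_carrier, fun p => ?_⟩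
  obtain ⟨i, x, rfl⟩ := D.exists_π_eq p
  exact ⟨D.chartRange i, ⟨x, rfl⟩, ⊤, ⟨(D.chartIso i).symm ≪≫ isoRestrictTop _⟩⟩

/-- The Hausdorff property is the point to check: each graph is the set where two continuous matrix
functions coincide, hence closed in the whole product of charts. -/
theorem isSupermanifold_grassmannian (k m : Z2n n → ℕ) :
    IsSupermanifold (grDim k m) (grassmannianDatum k m).glued := by
  refine (grassmannianDatum k m).isSupermanifold_glued fun I J => ?_
  have h : {p : (Fin (grDim k m 0) → ℝ) × (Fin (grDim k m 0) → ℝ) |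
      p.1 ∈ overlap I J ∧ body (I.trans J p.1) = p.2} = {p |
      J.minor ((I.labelAt p.1).map (coeff 0)) * (J.labelAt p.2).map (coeff 0) =
        (I.labelAt p.1).map (coeff 0)} :=
    Set.ext fun p => I.trans_graph_iff J p.1 p.2
  refine (congrArg IsClosed h).mpr (isClosed_eq ?_ ?_)
  · exact ((I.continuous_labelAt.comp continuous_fst).matrix_submatrix id J.col).matrix_mul
      (J.continuous_labelAt.comp continuous_snd)
  · exact I.continuous_labelAt.comp continuous_fst

theorem isGluing_grassmannian {g : Transitions k m} (hg : ∀ I J, IsPasting I J (g I J)) :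
    IsGluing g (grassmannianDatum k m).glued := by
  let D := grassmannianDatum k m
  refine ⟨D.chartRange, D.chartIso, fun p => ?_, fun I J x => ?_, fun I J => ?_⟩
  · obtain ⟨I, x, h⟩ := D.exists_π_eq p
    exact ⟨I, x, h⟩
  · constructor
    · rintro ⟨y, h⟩
      have h' : D.π J y = D.π I x := h
      exact (GluingDatum.π_eq_iff.mp h'.symm).1
    · exact fun h => ⟨_, D.π_body (i := I) (j := J) h⟩
  -- On sections, this equality of morphisms is the compatibility condition in the definition of the
  -- structure sheaf.
  · have h1 : (chart k m).incl (overlap J I) ≫ D.chartHom J = transHom I J ≫ D.chartHom I := by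
      refine hom_ext' _ _ (fun x => (D.π_body (i := J) (j := I) x.2).symm) fun W F =>
        valAt_ext fun x hx => ?_
      have h2 := D.subst_locHom F (i := J) (j := I) (x := x.1) hx x.2
      exact h2.symm
    have h2 : ∀ I, (D.chartIso I).hom ≫ D.glued.incl (D.chartRange I) = D.chartHom I :=
      D.chartIso_hom_incl
    have h3 := (isPasting_iff_eq_transHom (g I J)).mp (hg I J)
    refine (congrArg ((chart k m).incl (overlap J I) ≫ ·) (h2 J)).trans (h1.trans ?_)
    refine (congrArg (· ≫ D.chartHom I) h3.symm).trans ((Category.assoc _ _ _).trans ?_)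
    exact congrArg (fun t => g I J ≫ (chart k m).incl (overlap I J) ≫ t) (h2 I).symm

end grassmannian

end

theorem mainTheorem1 (n : ℕ) (k m : Z2n n → ℕ) :
    (∀ I J : KIndex k m, IsUnit (I.minor (labelOn J (overlap J I)))) ∧
    (∀ I J : KIndex k m, ∃! g, IsPasting I J g) ∧
    ∀ g : Transitions k m, (∀ I J, IsPasting I J (g I J)) →
      (∀ I, overlap I I = ⊤ ∧ g I I = 𝟙 _) ∧
      (∀ I J, g J I ≫ g I J = 𝟙 _) ∧
      (∀ I J S, Cocycle g I J S) ∧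
      ∃ G : Z2nRingedSpace n, IsSupermanifold (grDim k m) G ∧ IsGluing g G := by
  exact ⟨fun I J => J.isUnit_minor_labelSec I (Z2nRingedSpace.img_le _), existsUnique_isPasting, fun g hg =>
    ⟨fun I => ⟨KIndex.overlap_self I, eq_id_of_isPasting (hg I I)⟩,
      fun I J => comp_eq_id_of_isPasting (hg I J) (hg J I), cocycle_of_isPasting hg,
      (grassmannianDatum k m).glued, isSupermanifold_grassmannian k m, isGluing_grassmannian hg⟩⟩
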